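/- Let $A$ be a finite set and let $\alpha,\beta\subsetneq A$ be proper subsets with $\alpha\cup\beta=A$ and $\alpha\cap\beta\neq\emptyset$. For $k\in\mathbb N$ let $\tau_k$ be the $3k$-ary relation on $A$ $$\tau_k(x_1,y_1,z_1,\dots,x_k,y_k,z_k)\;:=\;\rho'(x_1,y_1,z_1)\vee\dots\vee\rho'(x_k,y_k,z_k),\qquad \rho':=(\alpha\times\alpha\times\alpha)\cup(\beta\times\beta\times\beta),$$ and consider the structure $(A;\{\tau_k:k\in\mathbb N\},(a)_{a\in A})$ in which every element of $A$ is named by a constant. Let $\mathcal B$ be any finite-signature reduct of this structure, that is, keep the relations $\tau_k$ with $k$ in a finite set $K\subseteq\mathbb N$ and the constants from a set $C\subseteq A$. Then: 1. The problem $\mathrm{QCSP}(\mathcal B)$ is in $\mathrm{NL}$ (nondeterministic logarithmic space). Here $\mathrm{QCSP}(\mathcal B)$ asks whether a given prenex positive Horn sentence $Q_1v_1\cdots Q_nv_n\,(\theta_1\wedge\dots\wedge\theta_l)$ is true in $\mathcal B$, where each $Q_i\in\{\forall,\exists\}$ and each $\theta_j$ is an equality or a relational atom of $\mathcal B$ whose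 arguments are variables or constants of $\mathcal B$; sentences are written as words over a finite alphabet. 2. For every $m\ge 1$ such that $k\le m$ for all $k\in K$, the structure $\mathcal B$ has a $(3m+1)$-ary near-unanimity polymorphism: an operation $f:A^{3m+1}\to A$ that preserves all relations and constants of $\mathcal B$ and takes the value $x$ whenever all of its arguments, with at most one exception, are equal to $x$. -/

import Mathlib

universe u v

/-! ### Nondeterministic logarithmic space -/

/-- What the input head sees: a letter of the input, or one of the two end markers. -/
inductive InputSymbol (Γ : Type u) : Type u
  | leftEnd : InputSymbol Γ
  | letter (a : Γ) : InputSymbol Γ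
  | rightEnd : InputSymbol Γ

/-- Head movements. -/
inductive HeadMove : Type
  | left
  | stay
  | right

/-- A nondeterministic Turing machine with a read-only two-way input tape and finitely many
read-write work tapes (one-way infinite, cells numbered `0, 1, 2, …`). In a state, scanning an
input symbol and one symbol on each work tape, it may perform any action in `trans`: enter a new
state, move the input head, and on each work tape write a symbol and move the head. -/
structure OfflineNTM (Γ : Type u) where
  State : Type
  Sym : Type
  finiteState : Finite State
  finiteSym : Finite Sym
  tapes : ℕ
  blank : Sym
  start : State
  accept : Set State
  trans : State → InputSymbol Γ → (Fin tapes → Sym) →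
    Set (State × HeadMove × (Fin tapes → Sym × HeadMove))

namespace OfflineNTM

variable {Γ : Type u}

/-- The input tape for the word `w` of length `n`: cell `0` holds the left end marker, cells
`1, …, n` hold the letters of `w`, cell `n + 1` holds the right end marker. -/
def inputAt (w : List Γ) : ℕ → InputSymbol Γ
  | 0 => InputSymbol.leftEnd
  | p + 1 =>
    match w[p]? with
    | some a => InputSymbol.letter a
    | none => InputSymbol.rightEnd

/-- Move a head on a one-way infinite tape; moving left from cell `0` has no effect. -/
def moveWork : HeadMove → ℕ → ℕ
  | HeadMove.left, p => p - 1
  | HeadMove.stay, p => p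
  | HeadMove.right, p => p + 1

/-- Move the input head; it cannot leave the part of the tape between the end markers. -/
def moveInput (w : List Γ) (d : HeadMove) (p : ℕ) : ℕ :=
  min (moveWork d p) (w.length + 1)

/-- Configurations: state, position of the input head, contents of the work tapes, positions of
the work heads. -/
structure Config (M : OfflineNTM Γ) where
  state : M.State
  inPos : ℕ
  work : Fin M.tapes → ℕ → M.Sym
  workPos : Fin M.tapes → ℕ

/-- The initial configuration: all work tapes blank, all heads on cell `0`. -/
def init (M : OfflineNTM Γ) : M.Config where
  state := M.start
  inPos := 0
  work := fun _ _ => M.blank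
  workPos := fun _ => 0

/-- The successor relation on configurations, on input `w`. -/
def Step (M : OfflineNTM Γ) (w : List Γ) (c c' : M.Config) : Prop :=
  ∃ q d act,
    (q, d, act) ∈ M.trans c.state (inputAt w c.inPos) (fun i => c.work i (c.workPos i)) ∧
    c' =
      { state := q
        inPos := moveInput w d c.inPos
        work := fun i => Function.update (c.work i) (c.workPos i) (act i).1
        workPos := fun i => moveWork (act i).2 (c.workPos i) }

/-- The configurations that occur in some computation on input `w`. -/
def Reachable (M : OfflineNTM Γ) (w : List Γ) (c : M.Config) : Prop :=
  Relation.ReflTransGen (M.Step w) M.init c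

/-- Some computation on `w` reaches an accepting state. -/
def Accepts (M : OfflineNTM Γ) (w : List Γ) : Prop :=
  ∃ c, M.Reachable w c ∧ c.state ∈ M.accept

/-- On inputs of length `n`, no computation moves a work head beyond the first `O(log n)` cells
(`log n + 1` instead of `log n` takes care of `n = 0` and `n = 1`). -/
def RunsInLogSpace (M : OfflineNTM Γ) : Prop :=
  ∃ C : ℕ, ∀ (w : List Γ) (c : M.Config), M.Reachable w c →
    ∀ i, c.workPos i ≤ C * (Nat.log 2 w.length + 1)

end OfflineNTM

/-- `L` is a language over a finite alphabet that belongs to the complexity class NL. -/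
def InNL {Γ : Type u} (L : Language Γ) : Prop :=
  Finite Γ ∧ ∃ M : OfflineNTM Γ, M.RunsInLogSpace ∧ ∀ w : List Γ, w ∈ L ↔ M.Accepts w

/-! ### Constraint languages and the QCSP -/

/-- A constraint language (relational structure) over the domain `A`: relation symbols with
their arities and interpretations, and a set of elements of `A` named by constants. -/
structure ConstraintLanguage (A : Type u) where
  Rel : Type v
  arity : Rel → ℕ
  interp : (r : Rel) → Set (Fin (arity r) → A)
  consts : Set A

namespace ConstraintLanguage

variable {A : Type u}

/-- The reduct that keeps the relation symbols in `R` and the constants in `C`. -/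
def reduct (B : ConstraintLanguage.{u, v} A) (R : Set B.Rel) (C : Set A) :
    ConstraintLanguage.{u, v} A where
  Rel := R
  arity := fun r => B.arity r.1
  interp := fun r => B.interp r.1
  consts := B.consts ∩ C

/-- Variables are named by arbitrary bit strings. -/
abbrev Var : Type := List Bool

/-- Terms: variables and the constants of the language. -/
inductive Term (B : ConstraintLanguage.{u, v} A) : Type u
  | var (x : Var) : Term B
  | const (a : B.consts) : Term B

/-- Atomic formulas: equalities and relational atoms. -/
inductive Atom (B : ConstraintLanguage.{u, v} A) : Type (max u v)
  | eq (s t : Term B) : Atom B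
  | rel (r : B.Rel) (ts : Fin (B.arity r) → Term B) : Atom B

/-- Quantifiers. -/
inductive Quant : Type
  | all
  | ex

/-- Prenex positive Horn formulas: a quantifier prefix followed by a conjunction of atoms. -/
structure PHFormula (B : ConstraintLanguage.{u, v} A) where
  quants : List (Quant × Var)
  atoms : List (Atom B)

variable {B : ConstraintLanguage.{u, v} A}

/-- The variables of a term. -/
def Term.vars : Term B → Set Var
  | Term.var x => {x}
  | Term.const _ => ∅

/-- The variables of an atom. -/
def Atom.vars : Atom B → Set Var
  | Atom.eq s t => s.vars ∪ t.vars
  | Atom.rel _ ts => ⋃ i, (ts i).vars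

/-- `φ` is a sentence: the quantified variables are pairwise distinct and include every variable
that occurs in an atom. -/
def PHFormula.IsSentence (φ : PHFormula B) : Prop :=
  (φ.quants.map Prod.snd).Nodup ∧
    ∀ a ∈ φ.atoms, ∀ x ∈ a.vars, x ∈ φ.quants.map Prod.snd

/-- The value of a term under an assignment. -/
def Term.eval (s : Var → A) : Term B → A
  | Term.var x => s x
  | Term.const a => a.1

/-- Truth of an atom under an assignment. -/
def Atom.Holds (s : Var → A) : Atom B → Prop
  | Atom.eq t₁ t₂ => t₁.eval s = t₂.eval s
  | Atom.rel r ts => (fun i => (ts i).eval s) ∈ B.interp r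

/-- Truth, under an assignment, of a quantifier prefix followed by a conjunction of atoms. -/
def HoldsFrom (atoms : List (Atom B)) : List (Quant × Var) → (Var → A) → Prop
  | [], s => ∀ a ∈ atoms, a.Holds s
  | (Quant.all, x) :: p, s => ∀ a : A, HoldsFrom atoms p (Function.update s x a)
  | (Quant.ex, x) :: p, s => ∃ a : A, HoldsFrom atoms p (Function.update s x a)

/-- `φ` holds in `B`; for a sentence (and non-empty `A`) the assignment `s` is irrelevant. -/
def PHFormula.IsTrue (φ : PHFormula B) : Prop :=
  ∀ s : Var → A, HoldsFrom φ.atoms φ.quants s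

/-- The alphabet in which instances are written: quantifiers, an equality sign, one letter for
each relation symbol and for each constant, a letter announcing a variable, and the two bits that
variable names are made of. -/
inductive Token (B : ConstraintLanguage.{u, v} A) : Type (max u v)
  | all : Token B
  | ex : Token B
  | eq : Token B
  | rel (r : B.Rel) : Token B
  | const (a : B.consts) : Token B
  | var : Token B
  | bit (b : Bool) : Token B

/-- A variable is written as the letter `var` and its name, a constant as its letter. -/
def Term.encode : Term B → List (Token B)
  | Term.var x => Token.var :: x.map Token.bit
  | Term.const a => [Token.const a]

/-- An atom is written as its symbol followed by its arguments (Polish notation). -/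
def Atom.encode : Atom B → List (Token B)
  | Atom.eq s t => Token.eq :: (s.encode ++ t.encode)
  | Atom.rel r ts => Token.rel r :: (List.ofFn ts).flatMap Term.encode

/-- A quantified variable is written as the quantifier followed by the name of the variable. -/
def encodeQuant : Quant × Var → List (Token B)
  | (Quant.all, x) => Token.all :: x.map Token.bit
  | (Quant.ex, x) => Token.ex :: x.map Token.bit

/-- An instance is written as its prefix followed by its atoms. -/
def PHFormula.encode (φ : PHFormula B) : List (Token B) :=
  φ.quants.flatMap encodeQuant ++ φ.atoms.flatMap Atom.encode

/-- `QCSP(B)`: given a positive Horn sentence over `B`, is it true in `B`? -/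
def QCSP (B : ConstraintLanguage.{u, v} A) : Language (Token B) :=
  {w | ∃ φ : PHFormula B, φ.IsSentence ∧ φ.IsTrue ∧ φ.encode = w}

/-- `f` is an `n`-ary polymorphism of `B`: it preserves every relation and every constant. -/
def IsPolymorphism (B : ConstraintLanguage.{u, v} A) {n : ℕ} (f : (Fin n → A) → A) : Prop :=
  (∀ (r : B.Rel) (t : Fin n → Fin (B.arity r) → A), (∀ j, t j ∈ B.interp r) →
    (fun p => f (fun j => t j p)) ∈ B.interp r) ∧
  ∀ a ∈ B.consts, f (fun _ => a) = a

end ConstraintLanguage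

/-- An `n`-ary near-unanimity operation, `n ≥ 3`: its value is `x` whenever all arguments, with at
most one exception, are equal to `x`. -/
def IsNearUnanimity {A : Type u} {n : ℕ} (f : (Fin n → A) → A) : Prop :=
  3 ≤ n ∧ ∀ (i : Fin n) (x y : A), f (Function.update (fun _ => x) i y) = x

/-! ### The relations `τ_k` -/

/-- The ternary relation `ρ' = (α × α × α) ∪ (β × β × β)`. -/
def RhoPrime {A : Type u} (α β : Set A) (x y z : A) : Prop :=
  (x ∈ α ∧ y ∈ α ∧ z ∈ α) ∨ (x ∈ β ∧ y ∈ β ∧ z ∈ β)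

/-- The `3k`-ary relation
`τ_k(x₁, y₁, z₁, …, x_k, y_k, z_k) = ρ'(x₁, y₁, z₁) ∨ … ∨ ρ'(x_k, y_k, z_k)`. -/
def tau {A : Type u} (α β : Set A) (k : ℕ) : Set (Fin (3 * k) → A) :=
  {t | ∃ i : Fin k, RhoPrime α β
    (t ⟨3 * i.1, by omega⟩) (t ⟨3 * i.1 + 1, by omega⟩) (t ⟨3 * i.1 + 2, by omega⟩)}

/-- The structure `(A; {τ_k : k ∈ ℕ}, constants naming all elements of A)`. -/
def tauLanguage {A : Type u} (α β : Set A) : ConstraintLanguage.{u, 0} A where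
  Rel := ℕ
  arity := fun k => 3 * k
  interp := fun k => tau α β k
  consts := Set.univ

/-! Truth of a sentence. The equality atoms generate an equivalence of terms. Fix `c ∈ α ∩ β`. The
existential player has a canonical strategy: a variable equivalent to a constant or to a universal
variable must take that value, and every other variable gets `c`. The strategy is playable if no two
distinct constants are equivalent, no constant is equivalent to a universal variable, and no
variable is equivalent to a universal variable quantified after it. If an atom `τ_k` fails under it,
then each of its triples contains an argument with value outside `α` and one with value outside `β`.
Since `c` lies in both sets, such values come from constants or universal variables. Since `α ∪ β`
is everything, no argument outside `α` is equivalent to one outside `β`. Conversely, whenever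
arguments can be selected in this way, the universal player falsifies the atom by giving a value
outside `α` to the universal variables equivalent to the first kind of choice and a value outside
`β` to all others. Hence truth is a condition on the equivalence alone, checked for one atom at a
time (`isTrue_iff_consistent`), and for each `k` only finitely many selections have to be tried.

Membership in NL. Equivalence of terms is reachability in a graph on the positions of the input, and
it occurs both positively and negatively. The predicates in `Def` are those recognized by
nondeterministic programs whose registers hold input positions. They are closed under conjunction,
disjunction, quantification over positions and reachability. `BiDef` asks for the predicate and its
negation, and `BiDef.reach` obtains nonreachability by the inductive counting of Immerman and
Szelepcsényi. The syntax of instances and the truth criterion are rewritten as conditions on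
positions (`mem_QCSP_iff`) and shown definable.

Register programs are turned into Turing machines in two stages. A register becomes a pair of
counters with constant sum, compared by moving tokens together with the input head. A counter
becomes a binary number on a work tape (`exists_offlineNTM`). The number of tokens is invariant and
linear in the input length, so logarithmically many cells suffice (`inNL_of_regProg`).

Near-unanimity. The operation `nearUnanimityOr c` returns the common value of all arguments but at
most one, and `c` if there is none. If it violated `τ_k`, then one coordinate outside `α` and one
outside `β` in each triple would have values different from `c`, so at most `2 * k` argument tuples
are exceptional there. Any other tuple agrees with the result at all these coordinates and would
violate `τ_k` itself (`nearUnanimityOr_mem_tau`). -/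

/-! ### Regular programs -/

/-- Regular expressions over a set of atomic actions. -/
inductive RegProg (Op : Type u) : Type u
  | atom (o : Op) : RegProg Op
  | seq (p q : RegProg Op) : RegProg Op
  | alt (p q : RegProg Op) : RegProg Op
  | star (p : RegProg Op) : RegProg Op

namespace RegProg

section Semantics

variable {Op : Type u} {σ : Type v} (sem : Op → σ → σ → Prop)

/-- The input-output relation of a regular program. -/
def Run : RegProg Op → σ → σ → Prop
  | atom o => sem o
  | seq p q => Relation.Comp (Run p) (Run q)
  | alt p q => fun s t => Run p s t ∨ Run q s t
  | star p => Relation.ReflTransGen (Run p)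

/-- The states of the automaton of a regular program. -/
def Pt : RegProg Op → Type
  | atom _ => Bool
  | seq p q => Pt p ⊕ Pt q
  | alt p q => Bool ⊕ (Pt p ⊕ Pt q)
  | star p => Option (Pt p)

theorem finite_pt : ∀ p : RegProg Op, Finite (Pt p)
  | atom _ => inferInstanceAs (Finite Bool)
  | seq p q => by
    have := finite_pt p
    have := finite_pt q
    exact inferInstanceAs (Finite (Pt p ⊕ Pt q))
  | alt p q => by
    have := finite_pt p
    have := finite_pt q
    exact inferInstanceAs (Finite (Bool ⊕ (Pt p ⊕ Pt q)))
  | star p => by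
    have := finite_pt p
    exact inferInstanceAs (Finite (Option (Pt p)))

/-- The initial state. -/
def src : (p : RegProg Op) → Pt p
  | atom _ => false
  | seq p _ => Sum.inl (src p)
  | alt _ _ => Sum.inl false
  | star _ => none

/-- The final state. -/
def tgt : (p : RegProg Op) → Pt p
  | atom _ => true
  | seq _ q => Sum.inr (tgt q)
  | alt _ _ => Sum.inl true
  | star _ => none

/-- The edges of the automaton, labelled by atomic actions or silent. -/
inductive Edge : (p : RegProg Op) → Pt p → Option Op → Pt p → Prop
  | atom (o : Op) : Edge (atom o) false (some o) true
  | seqL {p q x l y} : Edge p x l y → Edge (seq p q) (Sum.inl x) l (Sum.inl y)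
  | seqR {p q x l y} : Edge q x l y → Edge (seq p q) (Sum.inr x) l (Sum.inr y)
  | seqM {p q} : Edge (seq p q) (Sum.inl (tgt p)) none (Sum.inr (src q))
  | altL {p q x l y} : Edge p x l y →
      Edge (alt p q) (Sum.inr (Sum.inl x)) l (Sum.inr (Sum.inl y))
  | altR {p q x l y} : Edge q x l y →
      Edge (alt p q) (Sum.inr (Sum.inr x)) l (Sum.inr (Sum.inr y))
  | altLi {p q} : Edge (alt p q) (Sum.inl false) none (Sum.inr (Sum.inl (src p)))
  | altRi {p q} : Edge (alt p q) (Sum.inl false) none (Sum.inr (Sum.inr (src q)))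
  | altLo {p q} : Edge (alt p q) (Sum.inr (Sum.inl (tgt p))) none (Sum.inl true)
  | altRo {p q} : Edge (alt p q) (Sum.inr (Sum.inr (tgt q))) none (Sum.inl true)
  | starB {p x l y} : Edge p x l y → Edge (star p) (some x) l (some y)
  | starI {p} : Edge (star p) none none (some (src p))
  | starO {p} : Edge (star p) (some (tgt p)) none none

/-- The effect of a label. -/
def LabelSem : Option Op → σ → σ → Prop
  | none => Eq
  | some o => sem o

/-- One step along an edge of a labelled graph. -/
def EdgeStep {Q : Type*} (edge : Q → Option Op → Q → Prop) (x y : Q × σ) : Prop :=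
  ∃ l, edge x.1 l y.1 ∧ LabelSem sem l x.2 y.2

/-- `Visits p s x t`: a computation of `p` from `s` can be in state `x` with store `t`. -/
def Visits : (p : RegProg Op) → σ → Pt p → σ → Prop
  | atom o, s, x, t => (x = false ∧ t = s) ∨ (x = true ∧ sem o s t)
  | seq p _, s, Sum.inl x, t => Visits p s x t
  | seq p q, s, Sum.inr y, t => ∃ m, Run sem p s m ∧ Visits q m y t
  | alt _ _, s, Sum.inl false, t => t = s
  | alt p q, s, Sum.inl true, t => Run sem p s t ∨ Run sem q s t
  | alt p _, s, Sum.inr (Sum.inl x), t => Visits p s x t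
  | alt _ q, s, Sum.inr (Sum.inr x), t => Visits q s x t
  | star p, s, none, t => Relation.ReflTransGen (Run sem p) s t
  | star p, s, some x, t => ∃ m, Relation.ReflTransGen (Run sem p) s m ∧ Visits p m x t

theorem visits_src : ∀ (p : RegProg Op) (s : σ), Visits sem p s (src p) s
  | atom _, _ => Or.inl ⟨rfl, rfl⟩
  | seq p _, s => visits_src p s
  | alt _ _, _ => rfl
  | star _, _ => Relation.ReflTransGen.refl

theorem visits_tgt : ∀ (p : RegProg Op) (s t : σ), Visits sem p s (tgt p) t ↔ Run sem p s t
  | atom o, s, t => ⟨fun h => h.elim (fun h => Bool.noConfusion h.1) And.right, fun h => Or.inr ⟨rfl, h⟩⟩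
  | seq p q, s, t => by
    simp only [tgt, Visits, visits_tgt q, Run]
    rfl
  | alt _ _, _, _ => Iff.rfl
  | star _, _, _ => Iff.rfl

/-- `Visits` is defined by recursion on the program, without the automaton. Closure under edges
makes it an inductive invariant, which controls both what reaches the final state and every
intermediate store. -/
theorem Visits.step {p : RegProg Op} {s : σ} {x y : Pt p} {l : Option Op} {t t' : σ}
    (he : Edge p x l y) (hl : LabelSem sem l t t') (h : Visits sem p s x t) :
    Visits sem p s y t' := by
  induction he generalizing s with
  | atom o =>
    rcases h with h | h
    · obtain ⟨-, rfl⟩ := h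
      exact Or.inr ⟨rfl, hl⟩
    · exact Bool.noConfusion h.1
  | seqL _ ih => exact ih hl h
  | seqR _ ih =>
    obtain ⟨m, hm, h⟩ := h
    exact ⟨m, hm, ih hl h⟩
  | seqM =>
    cases hl
    exact ⟨t, (visits_tgt sem _ _ _).1 h, visits_src sem _ _⟩
  | altL _ ih => exact ih hl h
  | altR _ ih => exact ih hl h
  | altLi =>
    cases hl
    cases h
    exact visits_src sem _ _
  | altRi =>
    cases hl
    cases h
    exact visits_src sem _ _
  | altLo =>
    cases hl
    exact Or.inl ((visits_tgt sem _ _ _).1 h)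
  | altRo =>
    cases hl
    exact Or.inr ((visits_tgt sem _ _ _).1 h)
  | starB _ ih =>
    obtain ⟨m, hm, h⟩ := h
    exact ⟨m, hm, ih hl h⟩
  | starI =>
    cases hl
    exact ⟨t, h, visits_src sem _ _⟩
  | starO =>
    cases hl
    obtain ⟨m, hm, h⟩ := h
    exact hm.tail ((visits_tgt sem _ _ _).1 h)

theorem visits_of_reach {p : RegProg Op} {s : σ} {x : Pt p × σ}
    (h : Relation.ReflTransGen (EdgeStep sem (Edge p)) (src p, s) x) :
    Visits sem p s x.1 x.2 := by
  induction h with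
  | refl => exact visits_src sem p s
  | tail _ h ih =>
    obtain ⟨l, he, hl⟩ := h
    exact ih.step sem he hl

theorem reach_lift {p q : RegProg Op} (f : Pt p → Pt q)
    (hf : ∀ {x l y}, Edge p x l y → Edge q (f x) l (f y)) {x y : Pt p} {s t : σ}
    (h : Relation.ReflTransGen (EdgeStep sem (Edge p)) (x, s) (y, t)) :
    Relation.ReflTransGen (EdgeStep sem (Edge q)) (f x, s) (f y, t) :=
  Relation.ReflTransGen.lift (fun x : Pt p × σ => ((f x.1, x.2) : Pt q × σ))
    (fun _ _ ⟨l, he, hl⟩ => ⟨l, hf he, hl⟩) _ _ h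

theorem edgeStep_silent {p : RegProg Op} {x y : Pt p} (h : Edge p x none y) (s : σ) :
    EdgeStep sem (Edge p) (x, s) (y, s) :=
  ⟨none, h, rfl⟩

/-- Thompson's construction: paths for the components are glued together by silent edges. -/
theorem reach_of_run : ∀ (p : RegProg Op) {s t : σ}, Run sem p s t →
    Relation.ReflTransGen (EdgeStep sem (Edge p)) (src p, s) (tgt p, t)
  | atom o, s, t, h => Relation.ReflTransGen.single ⟨some o, Edge.atom o, h⟩
  | seq p q, s, t, h => by
    obtain ⟨m, h1, h2⟩ := h
    exact ((reach_lift sem _ Edge.seqL (reach_of_run p h1)).tail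
      (edgeStep_silent sem Edge.seqM m)).trans (reach_lift sem _ Edge.seqR (reach_of_run q h2))
  | alt p q, s, t, h => by
    rcases h with h | h
    · exact ((reach_lift sem _ Edge.altL (reach_of_run p h)).tail
        (edgeStep_silent sem Edge.altLo t)).head (edgeStep_silent sem Edge.altLi s)
    · exact ((reach_lift sem _ Edge.altR (reach_of_run q h)).tail
        (edgeStep_silent sem Edge.altRo t)).head (edgeStep_silent sem Edge.altRi s)
  | star p, s, t, h => by
    change Relation.ReflTransGen (Run sem p) s t at h
    induction h with
    | refl => exact Relation.ReflTransGen.refl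
    | @tail b c _ h ih =>
      exact ih.trans (((reach_lift sem _ Edge.starB (reach_of_run p h)).tail
        (edgeStep_silent sem Edge.starO c)).head (edgeStep_silent sem Edge.starI b))

theorem reach_tgt_iff (p : RegProg Op) (s t : σ) :
    Relation.ReflTransGen (EdgeStep sem (Edge p)) (src p, s) (tgt p, t) ↔ Run sem p s t :=
  ⟨fun h => (visits_tgt sem p s t).1 (visits_of_reach sem h), reach_of_run sem p⟩

/-- Every computation of `p` from a store satisfying `P` stays within `B` and ends in `R`. -/
def Hoare (B : σ → Prop) (P : σ → Prop) (p : RegProg Op) (R : σ → Prop) : Prop :=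
  ∀ s, P s → (∀ t, Run sem p s t → R t) ∧ ∀ x t, Visits sem p s x t → B t

variable {sem} {B P R S : σ → Prop} {p q : RegProg Op}

/-- An atomic action has only two stores, before and after, hence the two conditions on `B`. These
triples serve to bound the counters along all computations, including those that get stuck. -/
theorem Hoare.atom {o : Op} (hP : ∀ s, P s → B s) (hR : ∀ s, R s → B s)
    (h : ∀ s t, P s → sem o s t → R t) : Hoare sem B P (atom o) R := by
  refine fun s hs => ⟨fun t => h s t hs, ?_⟩
  rintro x t (⟨-, rfl⟩ | ⟨-, ht⟩)
  · exact hP _ hs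
  · exact hR _ (h s t hs ht)

theorem Hoare.seq (h1 : Hoare sem B P p R) (h2 : Hoare sem B R q S) :
    Hoare sem B P (seq p q) S := by
  intro s hs
  refine ⟨?_, ?_⟩
  · rintro t ⟨m, hm, ht⟩
    exact (h2 m ((h1 s hs).1 m hm)).1 t ht
  · rintro (x | x) t h
    · exact (h1 s hs).2 x t h
    · obtain ⟨m, hm, ht⟩ := h
      exact (h2 m ((h1 s hs).1 m hm)).2 x t ht

theorem Hoare.alt (h1 : Hoare sem B P p R) (h2 : Hoare sem B P q R) (hP : ∀ s, P s → B s)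
    (hR : ∀ s, R s → B s) : Hoare sem B P (alt p q) R := by
  intro s hs
  have key : ∀ t, Run sem (RegProg.alt p q) s t → R t := by
    rintro t (h | h)
    · exact (h1 s hs).1 t h
    · exact (h2 s hs).1 t h
  refine ⟨key, ?_⟩
  rintro ((_ | _) | x | x) t h
  · cases h
    exact hP _ hs
  · exact hR _ (key t h)
  · exact (h1 s hs).2 x t h
  · exact (h2 s hs).2 x t h

theorem Hoare.star (h : Hoare sem B P p P) (hP : ∀ s, P s → B s) :
    Hoare sem B P (star p) P := by
  intro s hs
  have key : ∀ t, Run sem (RegProg.star p) s t → P t := by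
    intro t ht
    change Relation.ReflTransGen (Run sem p) s t at ht
    induction ht with
    | refl => exact hs
    | tail _ h' ih => exact (h _ ih).1 _ h'
  refine ⟨key, ?_⟩
  rintro (_ | x) t ht
  · exact hP _ (key t ht)
  · obtain ⟨m, hm, ht⟩ := ht
    exact (h m (key m hm)).2 x t ht

theorem Hoare.mono {P' R' : σ → Prop} (h : Hoare sem B P p R) (hP : ∀ s, P' s → P s)
    (hR : ∀ s, R s → R' s) : Hoare sem B P' p R' :=
  fun s hs => ⟨fun t ht => hR t ((h s (hP s hs)).1 t ht), (h s (hP s hs)).2⟩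

theorem Hoare.weaken {B' : σ → Prop} (h : Hoare sem B P p R) (hB : ∀ s, B s → B' s) :
    Hoare sem B' P p R :=
  fun s hs => ⟨(h s hs).1, fun x t ht => hB t ((h s hs).2 x t ht)⟩

end Semantics

/-! ### Substituting programs for atomic actions -/

section Bind

variable {Op : Type u} {Op' : Type v}

/-- Replace every atomic action by a program. -/
def bind (g : Op → RegProg Op') : RegProg Op → RegProg Op'
  | atom o => g o
  | seq p q => seq (bind g p) (bind g q)
  | alt p q => alt (bind g p) (bind g q)
  | star p => star (bind g p)

/-- All atomic actions of a program satisfy `P`. -/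
def Forall (P : Op → Prop) : RegProg Op → Prop
  | atom o => P o
  | seq p q => Forall P p ∧ Forall P q
  | alt p q => Forall P p ∧ Forall P q
  | star p => Forall P p

theorem Forall.mono {P P' : Op → Prop} (h : ∀ o, P o → P' o) :
    ∀ {p : RegProg Op}, Forall P p → Forall P' p
  | .atom o, hp => h o hp
  | .seq p q, hp => ⟨Forall.mono h (p := p) hp.1, Forall.mono h (p := q) hp.2⟩
  | .alt p q, hp => ⟨Forall.mono h (p := p) hp.1, Forall.mono h (p := q) hp.2⟩
  | .star p, hp => Forall.mono h (p := p) hp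

/-- If every gadget simulates its action through the representation relation `rep`, then the
expanded program simulates the program. -/
theorem exists_run_of_run_bind {σ τ : Type*} {sem : Op → σ → σ → Prop}
    {sem' : Op' → τ → τ → Prop} {g : Op → RegProg Op'} {rep : σ → τ → Prop} {ok : Op → Prop}
    (hg : ∀ o, ok o → ∀ s s', rep s s' → ∀ t', Run sem' (g o) s' t' → ∃ t, sem o s t ∧ rep t t') :
    ∀ (p : RegProg Op), Forall ok p → ∀ s s', rep s s' → ∀ t',
      Run sem' (bind g p) s' t' → ∃ t, Run sem p s t ∧ rep t t'
  | atom o, hp, s, s', h, t', h' => hg o hp s s' h t' h'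
  | seq p q, hp, s, s', h, t', h' => by
    obtain ⟨m', h1, h2⟩ := h'
    obtain ⟨m, h1, hm⟩ := exists_run_of_run_bind hg p hp.1 s s' h m' h1
    obtain ⟨t, h2, ht⟩ := exists_run_of_run_bind hg q hp.2 m m' hm t' h2
    exact ⟨t, ⟨m, h1, h2⟩, ht⟩
  | alt p q, hp, s, s', h, t', h' => by
    rcases h' with h' | h'
    · obtain ⟨t, h1, ht⟩ := exists_run_of_run_bind hg p hp.1 s s' h t' h'
      exact ⟨t, Or.inl h1, ht⟩
    · obtain ⟨t, h1, ht⟩ := exists_run_of_run_bind hg q hp.2 s s' h t' h'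
      exact ⟨t, Or.inr h1, ht⟩
  | star p, hp, s, s', h, t', h' => by
    change Relation.ReflTransGen (Run sem' (bind g p)) s' t' at h'
    induction h' with
    | refl => exact ⟨s, Relation.ReflTransGen.refl, h⟩
    | tail _ h' ih =>
      obtain ⟨m, hm, hr⟩ := ih
      obtain ⟨t, h1, ht⟩ := exists_run_of_run_bind hg p hp m _ hr _ h'
      exact ⟨t, hm.tail h1, ht⟩

theorem exists_run_bind_of_run {σ τ : Type*} {sem : Op → σ → σ → Prop}
    {sem' : Op' → τ → τ → Prop} {g : Op → RegProg Op'} {rep : σ → τ → Prop} {ok : Op → Prop}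
    (hg : ∀ o, ok o → ∀ s s', rep s s' → ∀ t, sem o s t → ∃ t', Run sem' (g o) s' t' ∧ rep t t') :
    ∀ (p : RegProg Op), Forall ok p → ∀ s s', rep s s' → ∀ t,
      Run sem p s t → ∃ t', Run sem' (bind g p) s' t' ∧ rep t t'
  | atom o, hp, s, s', h, t, h' => hg o hp s s' h t h'
  | seq p q, hp, s, s', h, t, h' => by
    obtain ⟨m, h1, h2⟩ := h'
    obtain ⟨m', h1, hm⟩ := exists_run_bind_of_run hg p hp.1 s s' h m h1
    obtain ⟨t', h2, ht⟩ := exists_run_bind_of_run hg q hp.2 m m' hm t h2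
    exact ⟨t', ⟨m', h1, h2⟩, ht⟩
  | alt p q, hp, s, s', h, t, h' => by
    rcases h' with h' | h'
    · obtain ⟨t', h1, ht⟩ := exists_run_bind_of_run hg p hp.1 s s' h t h'
      exact ⟨t', Or.inl h1, ht⟩
    · obtain ⟨t', h1, ht⟩ := exists_run_bind_of_run hg q hp.2 s s' h t h'
      exact ⟨t', Or.inr h1, ht⟩
  | star p, hp, s, s', h, t, h' => by
    change Relation.ReflTransGen (Run sem p) s t at h'
    induction h' with
    | refl => exact ⟨s', Relation.ReflTransGen.refl, h⟩
    | tail _ h' ih =>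
      obtain ⟨m, hm, hr⟩ := ih
      obtain ⟨t', h1, ht⟩ := exists_run_bind_of_run hg p hp _ m hr _ h'
      exact ⟨t', Relation.ReflTransGen.tail hm h1, ht⟩

end Bind

end RegProg

/-! ### Machines with counters -/

/-- Atomic actions of a machine with an input head and counters. -/
inductive CounterOp (Γ : Type u) (ι : Type v) : Type (max u v)
  | test (S : Set (InputSymbol Γ)) : CounterOp Γ ι
  | move (d : HeadMove) : CounterOp Γ ι
  | inc (j : ι) : CounterOp Γ ι
  | dec (j : ι) : CounterOp Γ ι

/-- The effect of an action on the head position and the counters. -/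
def CounterOp.sem {Γ : Type u} {ι : Type v} [DecidableEq ι] (w : List Γ) :
    CounterOp Γ ι → ℕ × (ι → ℕ) → ℕ × (ι → ℕ) → Prop
  | test S, s, t => OfflineNTM.inputAt w s.1 ∈ S ∧ t = s
  | move d, s, t => t = (OfflineNTM.moveInput w d s.1, s.2)
  | inc j, s, t => t = (s.1, Function.update s.2 j (s.2 j + 1))
  | dec j, s, t => s.2 j ≠ 0 ∧ t = (s.1, Function.update s.2 j (s.2 j - 1))

/-! ### Binary counters on work tapes -/

/-- The work alphabet: a marker for cell `0`, the blank, and bits. -/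
inductive CounterSym : Type
  | mark
  | blank
  | bit (b : Bool)

instance : Finite CounterSym :=
  Finite.of_injective
    (fun s : CounterSym => match s with
      | .mark => (none : Option (Option Bool))
      | .blank => some none
      | .bit b => some (some b))
    (by rintro (_ | _ | a) (_ | _ | b) h <;> simp_all)

/-- The number with binary digits `L`, least significant first. -/
def binVal : List Bool → ℕ
  | [] => 0
  | b :: l => b.toNat + 2 * binVal l

/-- The tape holding the marker and the digits `L`. -/
def binTape (L : List Bool) : ℕ → CounterSym
  | 0 => CounterSym.mark
  | k + 1 =>
    match L[k]? with
    | some b => CounterSym.bit b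
    | none => CounterSym.blank

theorem binTape_cons (X Y : List Bool) (c : Bool) :
    binTape (X ++ c :: Y) (X.length + 1) = CounterSym.bit c := by
  simp [binTape]

theorem binTape_end (X : List Bool) : binTape X (X.length + 1) = CounterSym.blank := by
  simp [binTape]

theorem binTape_bit {X : List Bool} {p : ℕ} (h : p < X.length) :
    ∃ b, binTape X (p + 1) = CounterSym.bit b :=
  ⟨X[p], by simp [binTape, h]⟩

theorem update_binTape_cons (X Y : List Bool) (c d : Bool) :
    Function.update (binTape (X ++ c :: Y)) (X.length + 1) (CounterSym.bit d) =
      binTape (X ++ d :: Y) := by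
  funext k
  rcases k with _ | k
  · rfl
  · rcases lt_trichotomy k X.length with h | rfl | h
    · rw [Function.update_of_ne (by omega)]
      simp [binTape, List.getElem?_append_left h]
    · simp [binTape]
    · rw [Function.update_of_ne (by omega)]
      obtain ⟨m, hm⟩ : ∃ m, k - X.length = m + 1 := ⟨k - X.length - 1, by omega⟩
      simp [binTape, List.getElem?_append_right h.le, hm]

theorem update_binTape_end (X : List Bool) (d : Bool) :
    Function.update (binTape X) (X.length + 1) (CounterSym.bit d) = binTape (X ++ [d]) := by
  funext k
  rcases k with _ | k
  · rfl
  · rcases lt_trichotomy k X.length with h | rfl | h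
    · rw [Function.update_of_ne (by omega)]
      simp [binTape, List.getElem?_append_left h]
    · simp [binTape]
    · rw [Function.update_of_ne (by omega)]
      obtain ⟨m, hm⟩ : ∃ m, k - X.length = m + 1 := ⟨k - X.length - 1, by omega⟩
      simp [binTape, List.getElem?_append_right h.le, hm, h.le]

theorem update_blank_mark :
    Function.update (fun _ => CounterSym.blank) 0 CounterSym.mark = binTape [] := by
  funext k
  rcases k with _ | k
  · rfl
  · simp [binTape]

theorem binVal_replicate_true (m : ℕ) (Y : List Bool) :
    binVal (List.replicate m true ++ Y) + 1 = 2 ^ m * (binVal Y + 1) := by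
  induction m with
  | zero => simp
  | succ m ih =>
    simp only [List.replicate_succ, List.cons_append, binVal, Bool.toNat_true, pow_succ]
    linarith

theorem binVal_replicate_false (m : ℕ) (Y : List Bool) :
    binVal (List.replicate m false ++ Y) = 2 ^ m * binVal Y := by
  induction m with
  | zero => simp
  | succ m ih =>
    simp only [List.replicate_succ, List.cons_append, binVal, Bool.toNat_false, pow_succ]
    linarith

/-- A block of `m` low ones is worth `2 ^ m - 1`, one less than the digit that receives the carry.
Read in the other direction, the identity describes a borrow. -/
theorem binVal_carry (m : ℕ) (Y : List Bool) :
    binVal (List.replicate m false ++ true :: Y) =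
      binVal (List.replicate m true ++ false :: Y) + 1 := by
  rw [binVal_replicate_true, binVal_replicate_false]
  simp [binVal, add_comm]

theorem binVal_carry_end (m : ℕ) :
    binVal (List.replicate m false ++ [true]) = binVal (List.replicate m true) + 1 := by
  have := binVal_replicate_true m []
  rw [List.append_nil] at this
  rw [this, binVal_replicate_false]
  simp [binVal]

/-! ### A Turing machine that keeps each counter in binary -/

namespace CounterMachine

open Relation

/-- Control states of the Turing machine that simulates a machine with counters: before the
start, ready to act, propagating a carry or borrow, returning to the first cell. -/
inductive Ctrl (Q ι : Type) : Type
  | boot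
  | ready (q : Q)
  | carry (b : Bool) (j : ι) (q : Q)
  | ret (j : ι) (q : Q)

instance {Q ι : Type} [Finite Q] [Finite ι] : Finite (Ctrl Q ι) :=
  Finite.of_injective
    (fun s : Ctrl Q ι => match s with
      | .boot => (none : Option (Q ⊕ (Bool × ι × Q) ⊕ (ι × Q)))
      | .ready q => some (Sum.inl q)
      | .carry b j q => some (Sum.inr (Sum.inl (b, j, q)))
      | .ret j q => some (Sum.inr (Sum.inr (j, q))))
    (by rintro (_ | _ | _ | _) (_ | _ | _ | _) h <;> simp_all)

variable {Γ : Type u} {Q ι : Type} {t : ℕ}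

/-- Act on the tape of counter `j` only. -/
def onTape [DecidableEq ι] (e : Fin t ≃ ι) (σ : Fin t → CounterSym) (j : ι) (s : CounterSym)
    (d : HeadMove) : Fin t → CounterSym × HeadMove :=
  fun i => if e i = j then (s, d) else (σ i, HeadMove.stay)

/-- Leave all tapes alone. -/
def keep (σ : Fin t → CounterSym) : Fin t → CounterSym × HeadMove :=
  fun i => (σ i, HeadMove.stay)

/-- The transitions of the simulating machine. -/
def trans [DecidableEq ι] (edge : Q → Option (CounterOp Γ ι) → Q → Prop) (q₀ : Q)
    (e : Fin t ≃ ι) : Ctrl Q ι → InputSymbol Γ → (Fin t → CounterSym) →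
    Set (Ctrl Q ι × HeadMove × (Fin t → CounterSym × HeadMove))
  -- Cell `0` of each tape receives the marker. Digits start in cell `1`, where the head rests
  -- between actions, and the empty list of digits stands for `0`.
  | .boot, _, _ => {(.ready q₀, .stay, fun _ => (.mark, .right))}
  | .ready q, a, σ => {x | ∃ l q', edge q l q' ∧
      match l with
      | none => x = (.ready q', .stay, keep σ)
      | some (.test S) => a ∈ S ∧ x = (.ready q', .stay, keep σ)
      | some (.move d) => x = (.ready q', d, keep σ)
      | some (.inc j) => x = (.carry true j q', .stay, keep σ)
      | some (.dec j) => x = (.carry false j q', .stay, keep σ)}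
  -- Here `b` is `true` for an increment and `false` for a decrement. Digits equal to `b` are
  -- flipped up to the first different one, which becomes `b`. Only an increment may extend the
  -- number at a blank; a decrement arriving there started from `0` and is stuck.
  | .carry b j q, _, σ => {x |
      (σ (e.symm j) = .bit b ∧ x = (.carry b j q, .stay, onTape e σ j (.bit !b) .right)) ∨
      (σ (e.symm j) = .bit !b ∧ x = (.ret j q, .stay, onTape e σ j (.bit b) .left)) ∨
      (b = true ∧ σ (e.symm j) = .blank ∧ x = (.ret j q, .stay, onTape e σ j (.bit b) .left))}
  | .ret j q, _, σ => {x |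
      (σ (e.symm j) = .mark ∧ x = (.ready q, .stay, onTape e σ j .mark .right)) ∨
      ∃ b, σ (e.symm j) = .bit b ∧ x = (.ret j q, .stay, onTape e σ j (.bit b) .left)}

/-- The simulating machine: every counter is kept in binary on a tape of its own. -/
def machine [DecidableEq ι] [Finite Q] [Finite ι]
    (edge : Q → Option (CounterOp Γ ι) → Q → Prop) (q₀ qf : Q) (e : Fin t ≃ ι) :
    OfflineNTM Γ where
  State := Ctrl Q ι
  Sym := CounterSym
  finiteState := inferInstance
  finiteSym := inferInstance
  tapes := t
  blank := .blank
  start := .boot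
  accept := {.ready qf}
  trans := trans edge q₀ e

variable [DecidableEq ι] [Finite Q] [Finite ι]
  {edge : Q → Option (CounterOp Γ ι) → Q → Prop} {q₀ qf : Q} {e : Fin t ≃ ι} {w : List Γ}

/-- Configurations, with the tapes indexed by the counters. -/
def cfg (edge : Q → Option (CounterOp Γ ι) → Q → Prop) (q₀ qf : Q) (e : Fin t ≃ ι)
    (x : Ctrl Q ι) (h : ℕ) (T : ι → ℕ → CounterSym) (P : ι → ℕ) :
    (machine edge q₀ qf e).Config where
  state := x
  inPos := h
  work := fun i => T (e i)
  workPos := fun i => P (e i)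

theorem init_eq : (machine edge q₀ qf e).init =
    cfg edge q₀ qf e .boot 0 (fun _ _ => .blank) (fun _ => 0) := rfl

/-- The steps of the machine on configurations with tapes indexed by the counters. -/
theorem step_iff {x : Ctrl Q ι} {h : ℕ} {T : ι → ℕ → CounterSym} {P : ι → ℕ}
    {c : (machine edge q₀ qf e).Config} :
    (machine edge q₀ qf e).Step w (cfg edge q₀ qf e x h T P) c ↔
      match x with
      | .boot => c = cfg edge q₀ qf e (.ready q₀) (min h (w.length + 1))
          (fun j => Function.update (T j) (P j) .mark) (fun j => P j + 1)
      | .ready q => ∃ l q', edge q l q' ∧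
          match l with
          | none => c = cfg edge q₀ qf e (.ready q') (min h (w.length + 1)) T P
          | some (.test S) => OfflineNTM.inputAt w h ∈ S ∧
              c = cfg edge q₀ qf e (.ready q') (min h (w.length + 1)) T P
          | some (.move d) =>
              c = cfg edge q₀ qf e (.ready q') (OfflineNTM.moveInput w d h) T P
          | some (.inc j) =>
              c = cfg edge q₀ qf e (.carry true j q') (min h (w.length + 1)) T P
          | some (.dec j) =>
              c = cfg edge q₀ qf e (.carry false j q') (min h (w.length + 1)) T P
      | .carry b j q =>
          (T j (P j) = .bit b ∧ c = cfg edge q₀ qf e (.carry b j q) (min h (w.length + 1))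
            (Function.update T j (Function.update (T j) (P j) (.bit !b)))
            (Function.update P j (P j + 1))) ∨
          (T j (P j) = .bit (!b) ∧ c = cfg edge q₀ qf e (.ret j q) (min h (w.length + 1))
            (Function.update T j (Function.update (T j) (P j) (.bit b)))
            (Function.update P j (P j - 1))) ∨
          (b = true ∧ T j (P j) = .blank ∧
            c = cfg edge q₀ qf e (.ret j q) (min h (w.length + 1))
            (Function.update T j (Function.update (T j) (P j) (.bit b)))
            (Function.update P j (P j - 1)))
      | .ret j q =>
          (T j (P j) = .mark ∧ c = cfg edge q₀ qf e (.ready q) (min h (w.length + 1)) T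
            (Function.update P j (P j + 1))) ∨
          ∃ b, T j (P j) = .bit b ∧ c = cfg edge q₀ qf e (.ret j q) (min h (w.length + 1)) T
            (Function.update P j (P j - 1)) := by
  -- The `min` in the statement is the effect of `moveInput` on `stay`: an arbitrary configuration
  -- might have its input head beyond the tape. Tapes not acted on are rewritten with the scanned
  -- symbol, which changes nothing.
  have hkeep : ∀ (y : Ctrl Q ι) (d : HeadMove),
      ({ state := y
         inPos := OfflineNTM.moveInput w d h
         work := fun i => Function.update (T (e i)) (P (e i))
           (keep (fun i => T (e i) (P (e i))) i).1
         workPos := fun i => OfflineNTM.moveWork (keep (fun i => T (e i) (P (e i))) i).2 (P (e i))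
        } : (machine edge q₀ qf e).Config) =
      cfg edge q₀ qf e y (OfflineNTM.moveInput w d h) T P := by
    intro y d
    unfold cfg
    congr 1
    funext i
    exact Function.update_eq_self _ _
  have hon : ∀ (y : Ctrl Q ι) (j : ι) (s : CounterSym) (d : HeadMove),
      ({ state := y
         inPos := OfflineNTM.moveInput w .stay h
         work := fun i => Function.update (T (e i)) (P (e i))
           (onTape e (fun i => T (e i) (P (e i))) j s d i).1
         workPos := fun i => OfflineNTM.moveWork
           (onTape e (fun i => T (e i) (P (e i))) j s d i).2 (P (e i))
        } : (machine edge q₀ qf e).Config) =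
      cfg edge q₀ qf e y (min h (w.length + 1))
        (Function.update T j (Function.update (T j) (P j) s))
        (Function.update P j (OfflineNTM.moveWork d (P j))) := by
    intro y j s d
    unfold cfg onTape
    congr 1
    · funext i
      by_cases hi : e i = j
      · subst hi
        simp only [if_true, Function.update_self]
        rfl
      · simp only [if_neg hi, Function.update_of_ne hi]
        exact Function.update_eq_self _ _
    · funext i
      by_cases hi : e i = j
      · subst hi; simp
      · simp [hi, OfflineNTM.moveWork]
  have hself : ∀ j, Function.update T j (Function.update (T j) (P j) (T j (P j))) = T := by
    intro j; simp
  constructor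
  · rintro ⟨y, d, act, hmem, rfl⟩
    cases x with
    | boot =>
      change (y, d, act) = _ at hmem
      cases hmem
      rfl
    | ready q =>
      obtain ⟨l, q', he, hm⟩ := hmem
      refine ⟨l, q', he, ?_⟩
      match l, hm with
      | none, hm => cases hm; exact hkeep _ _
      | some (.test S), hm => obtain ⟨hS, hm⟩ := hm; cases hm; exact ⟨hS, hkeep _ _⟩
      | some (.move d), hm => cases hm; exact hkeep _ _
      | some (.inc j), hm => cases hm; exact hkeep _ _
      | some (.dec j), hm => cases hm; exact hkeep _ _
    | carry b j q =>
      simp only [cfg, machine, trans, Equiv.apply_symm_apply] at hmem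
      rcases hmem with ⟨hs, hm⟩ | ⟨hs, hm⟩ | ⟨hb, hs, hm⟩
      · cases hm; exact Or.inl ⟨hs, hon _ _ _ _⟩
      · cases hm; exact Or.inr (Or.inl ⟨hs, hon _ _ _ _⟩)
      · cases hm; exact Or.inr (Or.inr ⟨hb, hs, hon _ _ _ _⟩)
    | ret j q =>
      simp only [cfg, machine, trans, Equiv.apply_symm_apply] at hmem
      rcases hmem with ⟨hs, hm⟩ | ⟨b, hs, hm⟩
      · cases hm
        refine Or.inl ⟨hs, (hon _ _ _ _).trans ?_⟩
        rw [← hs, hself]; rfl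
      · cases hm
        refine Or.inr ⟨b, hs, (hon _ _ _ _).trans ?_⟩
        rw [← hs, hself]; rfl
  · cases x with
    | boot =>
      rintro rfl
      exact ⟨_, _, _, rfl, rfl⟩
    | ready q =>
      rintro ⟨l, q', he, hm⟩
      match l, hm with
      | none, hm => exact ⟨_, _, _, ⟨_, _, he, rfl⟩, hm.trans (hkeep _ .stay).symm⟩
      | some (.test S), hm =>
        exact ⟨_, _, _, ⟨_, _, he, hm.1, rfl⟩, hm.2.trans (hkeep _ .stay).symm⟩
      | some (.move d), hm => exact ⟨_, _, _, ⟨_, _, he, rfl⟩, hm.trans (hkeep _ d).symm⟩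
      | some (.inc j), hm => exact ⟨_, _, _, ⟨_, _, he, rfl⟩, hm.trans (hkeep _ .stay).symm⟩
      | some (.dec j), hm => exact ⟨_, _, _, ⟨_, _, he, rfl⟩, hm.trans (hkeep _ .stay).symm⟩
    | carry b j q =>
      have hj : (fun i => T (e i) (P (e i))) (e.symm j) = T j (P j) := by simp
      rintro (⟨hs, hm⟩ | ⟨hs, hm⟩ | ⟨hb, hs, hm⟩)
      · exact ⟨_, _, _, Or.inl ⟨hj.trans hs, rfl⟩, hm.trans (hon _ _ _ .right).symm⟩
      · exact ⟨_, _, _, Or.inr (Or.inl ⟨hj.trans hs, rfl⟩), hm.trans (hon _ _ _ .left).symm⟩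
      · exact ⟨_, _, _, Or.inr (Or.inr ⟨hb, hj.trans hs, rfl⟩),
          hm.trans (hon _ _ _ .left).symm⟩
    | ret j q =>
      have hj : (fun i => T (e i) (P (e i))) (e.symm j) = T j (P j) := by simp
      rintro (⟨hs, hm⟩ | ⟨b, hs, hm⟩)
      · refine ⟨_, _, _, Or.inl ⟨hj.trans hs, rfl⟩, hm.trans ((hon _ j _ .right).trans ?_).symm⟩
        rw [← hs, hself]; rfl
      · refine ⟨_, _, _, Or.inr ⟨b, hj.trans hs, rfl⟩,
          hm.trans ((hon _ j _ .left).trans ?_).symm⟩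
        rw [← hs, hself]; rfl

end CounterMachine

set_option linter.unusedSectionVars false

/-! ### Correctness and space bound of the binary simulation -/

namespace CounterMachine

open Relation

variable {Γ : Type u} {Q ι : Type} {t : ℕ} [DecidableEq ι] [Finite Q] [Finite ι]
  {edge : Q → Option (CounterOp Γ ι) → Q → Prop} {q₀ qf : Q} {e : Fin t ≃ ι} {w : List Γ}

theorem moveInput_le (w : List Γ) (d : HeadMove) (h : ℕ) :
    OfflineNTM.moveInput w d h ≤ w.length + 1 := min_le_right _ _

/-- Moves are clamped to the tape, so along actual computations the `min` in `step_iff` has no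
effect. -/
theorem head_le {q : Q} {s : ℕ × (ι → ℕ)}
    (h : ReflTransGen (RegProg.EdgeStep (CounterOp.sem w) edge) (q₀, (0, 0)) (q, s)) :
    s.1 ≤ w.length + 1 := by
  generalize hx : (q, s) = x at h
  induction h generalizing q s with
  | refl => cases hx; simp
  | @tail y z _ hstep ih =>
    obtain ⟨l, -, hl⟩ := hstep
    have ih := ih (q := y.1) (s := y.2) rfl
    subst hx
    match l, hl with
    | none, hl => cases hl; exact ih
    | some (.test S), hl => cases hl.2; exact ih
    | some (.move d), hl => cases hl; exact moveInput_le _ _ _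
    | some (.inc j), hl => cases hl; exact ih
    | some (.dec j), hl => cases hl.2; exact ih

/-- The counter contents `cnt` are represented by the digit lists `L`, none of them longer than
numbers up to `m` require. -/
def Represents (m : ℕ) (L : ι → List Bool) (cnt : ι → ℕ) : Prop :=
  ∀ j, binVal (L j) = cnt j ∧ (L j = [] ∨ 2 ^ ((L j).length - 1) ≤ m)

/-- The configurations that occur while the machine simulates the counters. -/
def Simulates (C : ℕ) (edge : Q → Option (CounterOp Γ ι) → Q → Prop) (q₀ qf : Q) (e : Fin t ≃ ι)
    (w : List Γ) (c : (machine edge q₀ qf e).Config) : Prop :=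
  c = cfg edge q₀ qf e .boot 0 (fun _ _ => .blank) (fun _ => 0) ∨
  ∃ (q : Q) (s : ℕ × (ι → ℕ)) (L : ι → List Bool),
    ReflTransGen (RegProg.EdgeStep (CounterOp.sem w) edge) (q₀, (0, 0)) (q, s) ∧
    Represents (C * (w.length + 1)) L s.2 ∧
    (c = cfg edge q₀ qf e (.ready q) s.1 (fun j => binTape (L j)) (fun _ => 1) ∨
    -- During the carry, `q` and `s` are still the state and store before the action, and `m` digits
    -- have been flipped. In the return phase below, they are already those after the action.
    (∃ b j q' m Y, edge q (some (if b then .inc j else .dec j)) q' ∧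
      L j = List.replicate m b ++ Y ∧
      c = cfg edge q₀ qf e (.carry b j q') s.1
        (Function.update (fun j => binTape (L j)) j (binTape (List.replicate m (!b) ++ Y)))
        (Function.update (fun _ => 1) j (m + 1))) ∨
    ∃ j p, p ≤ (L j).length ∧ c = cfg edge q₀ qf e (.ret j q) s.1 (fun j => binTape (L j))
        (Function.update (fun _ => 1) j p))

theorem update_binTape_replicate (m : ℕ) (b d : Bool) (c : Bool) (Y : List Bool) :
    Function.update (binTape (List.replicate m b ++ c :: Y)) (m + 1) (CounterSym.bit d) =
      binTape (List.replicate m b ++ d :: Y) := by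
  have := update_binTape_cons (List.replicate m b) Y c d
  rwa [List.length_replicate] at this

theorem binTape_replicate (m : ℕ) (b : Bool) (c : Bool) (Y : List Bool) :
    binTape (List.replicate m b ++ c :: Y) (m + 1) = CounterSym.bit c := by
  have := binTape_cons (List.replicate m b) Y c
  rwa [List.length_replicate] at this

theorem binTape_replicate_end (m : ℕ) (b : Bool) :
    binTape (List.replicate m b ++ []) (m + 1) = CounterSym.blank := by
  have := binTape_end (List.replicate m b)
  rwa [List.length_replicate, ← List.append_nil (List.replicate m b)] at this

theorem update_binTape_replicate_end (m : ℕ) (b d : Bool) :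
    Function.update (binTape (List.replicate m b ++ [])) (m + 1) (CounterSym.bit d) =
      binTape (List.replicate m b ++ [d]) := by
  simpa using update_binTape_end (List.replicate m b) d

theorem replicate_append_cons {m : ℕ} {b : Bool} (Y : List Bool) :
    List.replicate m b ++ b :: Y = List.replicate (m + 1) b ++ Y := by
  rw [List.replicate_succ']; simp

theorem update_tapes (L : ι → List Bool) (j : ι) (Z : List Bool) :
    Function.update (fun i => binTape (L i)) j (binTape Z) =
      fun i => binTape (Function.update L j Z i) := by
  funext i
  by_cases h : i = j
  · subst h; simp
  · simp [Function.update_of_ne h]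

theorem Represents.update {m : ℕ} {L : ι → List Bool} {cnt : ι → ℕ} (h : Represents m L cnt)
    {j : ι} {Z : List Bool} {x : ℕ} (hx : binVal Z = x) (hZ : Z = [] ∨ 2 ^ (Z.length - 1) ≤ m) :
    Represents m (Function.update L j Z) (Function.update cnt j x) := by
  intro i
  by_cases hi : i = j
  · subst hi; simpa using ⟨hx, hZ⟩
  · simpa [Function.update_of_ne hi] using h i

/-- Once the carry stops, the digits are final. The counter action is therefore credited at this
moment, while the work head is still on its way back. -/
theorem simulates_ret {C : ℕ} {q q' : Q} {s : ℕ × (ι → ℕ)} {L : ι → List Bool} {b : Bool} {j : ι}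
    (hr : ReflTransGen (RegProg.EdgeStep (CounterOp.sem w) edge) (q₀, (0, 0)) (q, s))
    (hL : Represents (C * (w.length + 1)) L s.2)
    (he : edge q (some (if b then .inc j else .dec j)) q') {Z : List Bool}
    (hv : if b then binVal Z = binVal (L j) + 1 else binVal (L j) = binVal Z + 1)
    (hZ : Z = [] ∨ 2 ^ (Z.length - 1) ≤ C * (w.length + 1)) {p : ℕ} (hp : p ≤ Z.length) :
    Simulates C edge q₀ qf e w (cfg edge q₀ qf e (.ret j q') s.1
      (fun i => binTape (Function.update L j Z i)) (Function.update (fun _ => 1) j p)) := by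
  refine Or.inr ⟨q', (s.1, Function.update s.2 j (binVal Z)), Function.update L j Z,
    hr.tail ⟨_, he, ?_⟩, hL.update rfl hZ, Or.inr (Or.inr ⟨j, p, by simpa using hp, rfl⟩)⟩
  have h1 := (hL j).1
  cases b with
  | true =>
    change _ = _
    simp only [if_true] at hv
    rw [hv, h1]
  | false =>
    simp only [Bool.false_eq_true, if_false] at hv
    refine ⟨by change s.2 j ≠ 0; omega, ?_⟩
    rw [← h1, hv]
    rfl

theorem simulates_step {C : ℕ}
    (hC : ∀ q s, ReflTransGen (RegProg.EdgeStep (CounterOp.sem w) edge) (q₀, (0, 0)) (q, s) →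
      ∀ j, s.2 j ≤ C * (w.length + 1))
    {c c' : (machine edge q₀ qf e).Config} (h : Simulates C edge q₀ qf e w c)
    (hs : (machine edge q₀ qf e).Step w c c') : Simulates C edge q₀ qf e w c' := by
  rcases h with rfl | ⟨q, s, L, hr, hL, rfl | ⟨b, j, q', m, Y, hedge, hY, rfl⟩ | ⟨j, p, hp, rfl⟩⟩
  · have hs := step_iff.1 hs
    refine Or.inr ⟨q₀, (0, 0), fun _ => [], ReflTransGen.refl, fun j => ⟨rfl, Or.inl rfl⟩,
      Or.inl ?_⟩
    simpa [update_blank_mark] using hs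
  · have hh : min s.1 (w.length + 1) = s.1 := min_eq_left (head_le hr)
    obtain ⟨l, q', he, hm⟩ := step_iff.1 hs
    rw [hh] at hm
    match l, hm with
    | none, hm => exact Or.inr ⟨q', s, L, hr.tail ⟨_, he, rfl⟩, hL, Or.inl hm⟩
    | some (.test S), hm =>
      exact Or.inr ⟨q', s, L, hr.tail ⟨_, he, hm.1, rfl⟩, hL, Or.inl hm.2⟩
    | some (.move d), hm => exact Or.inr ⟨q', (_, s.2), L, hr.tail ⟨_, he, rfl⟩, hL, Or.inl hm⟩
    | some (.inc j), hm =>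
      exact Or.inr ⟨q, s, L, hr, hL, Or.inr (Or.inl ⟨true, j, q', 0, L j, he, rfl, by
        simpa using hm⟩)⟩
    | some (.dec j), hm =>
      exact Or.inr ⟨q, s, L, hr, hL, Or.inr (Or.inl ⟨false, j, q', 0, L j, he, rfl, by
        simpa using hm⟩)⟩
  · have hh : min s.1 (w.length + 1) = s.1 := min_eq_left (head_le hr)
    have hs := step_iff.1 hs
    rw [hh] at hs
    simp only [Function.update_self, Function.update_idem, Nat.add_sub_cancel] at hs
    rcases hs with ⟨hb, rfl⟩ | ⟨hb, rfl⟩ | ⟨rfl, hb, rfl⟩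
    · rcases Y with _ | ⟨y, Y⟩
      · rw [binTape_replicate_end] at hb; cases hb
      · rw [binTape_replicate] at hb
        cases hb
        rw [update_binTape_replicate, replicate_append_cons]
        exact Or.inr ⟨q, s, L, hr, hL, Or.inr (Or.inl ⟨b, j, q', m + 1, Y, hedge, by
          rw [hY, replicate_append_cons], rfl⟩)⟩
    · rcases Y with _ | ⟨y, Y⟩
      · rw [binTape_replicate_end] at hb; cases hb
      · rw [binTape_replicate] at hb
        cases hb
        rw [update_binTape_replicate, update_tapes]
        refine simulates_ret hr hL hedge ?_ ?_ (by simp)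
        · rw [hY]
          cases b
          · simpa using binVal_carry m Y
          · simpa using binVal_carry m Y
        · refine (hL j).2.imp (fun h => ?_) (fun h => ?_)
          · rw [h] at hY
            simp at hY
          · rw [hY] at h
            simpa using h
    · rcases Y with _ | ⟨y, Y⟩
      · rw [Bool.not_true, update_binTape_replicate_end, update_tapes]
        have hv : binVal (List.replicate m false ++ [true]) = binVal (L j) + 1 := by
          rw [hY, binVal_carry_end, List.append_nil]
        refine simulates_ret hr hL hedge hv (Or.inr ?_) (by simp)
        -- A digit is appended only on overflow, when the new value is exactly `2 ^ m`. The bound on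
        -- counter values therefore bounds the number of digits. Decrements may leave leading zeros
        -- but do not lengthen the list.
        have h1 := hC q' _ (hr.tail ⟨_, hedge, rfl⟩) j
        change Function.update s.2 j (s.2 j + 1) j ≤ _ at h1
        rw [Function.update_self, ← (hL j).1, ← hv, binVal_replicate_false] at h1
        simpa [binVal] using h1
      · rw [binTape_replicate] at hb; cases hb
  · have hh : min s.1 (w.length + 1) = s.1 := min_eq_left (head_le hr)
    have hs := step_iff.1 hs
    rw [hh] at hs
    simp only [Function.update_self, Function.update_idem] at hs
    rcases hs with ⟨hm, rfl⟩ | ⟨b, hb, rfl⟩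
    · refine Or.inr ⟨q, s, L, hr, hL, Or.inl ?_⟩
      rcases p with _ | p
      · congr 1
        exact Function.update_eq_self j (fun _ => 1)
      · obtain ⟨b, hb⟩ := binTape_bit hp
        rw [hb] at hm
        cases hm
    · exact Or.inr ⟨q, s, L, hr, hL, Or.inr (Or.inr ⟨j, p - 1, by omega, rfl⟩)⟩

/-- From any cell, the work head returns to the first digit. -/
theorem return_run (w : List Γ) {h : ℕ} (hh : h ≤ w.length + 1) (L : ι → List Bool) (j : ι) (q : Q) :
    ∀ p, p ≤ (L j).length → ReflTransGen ((machine edge q₀ qf e).Step w)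
      (cfg edge q₀ qf e (.ret j q) h (fun j => binTape (L j)) (Function.update (fun _ => 1) j p))
      (cfg edge q₀ qf e (.ready q) h (fun j => binTape (L j)) (fun _ => 1))
  | 0, _ => by
    refine ReflTransGen.single (step_iff.2 (Or.inl ⟨by simp [binTape], ?_⟩))
    rw [min_eq_left hh, Function.update_idem, Function.update_self]
    congr 1
    exact (Function.update_eq_self j (fun _ => 1)).symm
  | p + 1, hp => by
    obtain ⟨b, hb⟩ := binTape_bit hp
    refine ReflTransGen.head (step_iff.2 (Or.inr ⟨b, by simpa using hb, ?_⟩))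
      (return_run w hh L j q p (by omega))
    rw [min_eq_left hh, Function.update_idem, Function.update_self, Nat.add_sub_cancel]

/-- The machine increments or decrements a counter. -/
theorem carry_run (w : List Γ) {h : ℕ} (hh : h ≤ w.length + 1) (b : Bool) (L : ι → List Bool)
    (j : ι) (q : Q) : ∀ (Y : List Bool) (m : ℕ),
      (b = true ∨ binVal (List.replicate m b ++ Y) ≠ 0) → ∃ Z,
        (if b then binVal Z = binVal (List.replicate m b ++ Y) + 1
          else binVal (List.replicate m b ++ Y) = binVal Z + 1) ∧
        ReflTransGen ((machine edge q₀ qf e).Step w)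
          (cfg edge q₀ qf e (.carry b j q) h
            (Function.update (fun j => binTape (L j)) j (binTape (List.replicate m (!b) ++ Y)))
            (Function.update (fun _ => 1) j (m + 1)))
          (cfg edge q₀ qf e (.ready q) h
            (fun i => binTape (Function.update L j Z i)) (fun _ => 1))
  | [], m, hne => by
    -- A borrow that runs past the last digit would mean that all digits were `false`, hence the
    -- value `0`.
    obtain rfl : b = true := by
      rcases hne with h | h
      · exact h
      · cases b with
        | true => rfl
        | false => exact absurd (by rw [binVal_replicate_false]; simp [binVal]) h
    refine ⟨List.replicate m false ++ [true], ?_, ReflTransGen.head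
      (step_iff.2 (Or.inr (Or.inr ⟨rfl, ?_, rfl⟩))) ?_⟩
    · rw [List.append_nil]
      exact binVal_carry_end m
    · simpa using binTape_replicate_end m false
    · simp only [Function.update_self, Function.update_idem, Nat.add_sub_cancel, Bool.not_true]
      rw [update_binTape_replicate_end, update_tapes, min_eq_left hh]
      exact return_run w hh _ j q m (by simp)
  | y :: Y, m, hne => by
    by_cases hy : y = b
    · subst hy
      obtain ⟨Z, hZ, hr⟩ := carry_run w hh y L j q Y (m + 1)
        (by rw [← replicate_append_cons]; exact hne)
      refine ⟨Z, by rw [replicate_append_cons]; exact hZ, ReflTransGen.head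
        (step_iff.2 (Or.inl ⟨?_, rfl⟩)) ?_⟩
      · simpa using binTape_replicate m (!y) y Y
      · simp only [Function.update_self, Function.update_idem]
        rw [update_binTape_replicate, replicate_append_cons, min_eq_left hh]
        exact hr
    · obtain rfl : y = !b := by cases y <;> cases b <;> simp_all
      refine ⟨List.replicate m (!b) ++ b :: Y, ?_, ReflTransGen.head
        (step_iff.2 (Or.inr (Or.inl ⟨?_, rfl⟩))) ?_⟩
      · cases b
        · simpa using binVal_carry m Y
        · simpa using binVal_carry m Y
      · simpa using binTape_replicate m (!b) (!b) Y
      · simp only [Function.update_self, Function.update_idem, Nat.add_sub_cancel]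
        rw [update_binTape_replicate, update_tapes, min_eq_left hh]
        exact return_run w hh _ j q m (by simp)

theorem run_of_edgeStep {q q' : Q} {s s' : ℕ × (ι → ℕ)} {L : ι → List Bool}
    (hh : s.1 ≤ w.length + 1) (hL : ∀ j, binVal (L j) = s.2 j)
    (h : RegProg.EdgeStep (CounterOp.sem w) edge (q, s) (q', s')) :
    ∃ L' : ι → List Bool, (∀ j, binVal (L' j) = s'.2 j) ∧
      ReflTransGen ((machine edge q₀ qf e).Step w)
        (cfg edge q₀ qf e (.ready q) s.1 (fun j => binTape (L j)) (fun _ => 1))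
        (cfg edge q₀ qf e (.ready q') s'.1 (fun j => binTape (L' j)) (fun _ => 1)) := by
  obtain ⟨l, he, hl⟩ := h
  match l, hl with
  | none, hl =>
    cases hl
    refine ⟨L, hL, ReflTransGen.single (step_iff.2 ⟨none, q', he, ?_⟩)⟩
    rw [min_eq_left hh]
  | some (.test S), hl =>
    obtain ⟨hS, rfl⟩ := hl
    refine ⟨L, hL, ReflTransGen.single (step_iff.2 ⟨some (.test S), q', he, hS, ?_⟩)⟩
    rw [min_eq_left hh]
  | some (.move d), hl =>
    cases hl
    exact ⟨L, hL, ReflTransGen.single (step_iff.2 ⟨some (.move d), q', he, rfl⟩)⟩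
  | some (.inc j), hl =>
    cases hl
    obtain ⟨Z, hZ, hr⟩ := carry_run (edge := edge) (q₀ := q₀) (qf := qf) (e := e) w hh true L j q'
      (L j) 0 (Or.inl rfl)
    refine ⟨Function.update L j Z, ?_, ReflTransGen.head
      (step_iff.2 ⟨some (.inc j), q', he, rfl⟩) ?_⟩
    · intro i
      by_cases hi : i = j
      · subst hi; simpa [hL] using hZ
      · simpa [Function.update_of_ne hi] using hL i
    · rw [min_eq_left hh]
      simpa using hr
  | some (.dec j), hl =>
    obtain ⟨hne, hl⟩ := hl
    cases hl
    obtain ⟨Z, hZ, hr⟩ := carry_run (edge := edge) (q₀ := q₀) (qf := qf) (e := e) w hh false L j q'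
      (L j) 0 (Or.inr (by simpa [hL] using hne))
    refine ⟨Function.update L j Z, ?_, ReflTransGen.head
      (step_iff.2 ⟨some (.dec j), q', he, rfl⟩) ?_⟩
    · intro i
      by_cases hi : i = j
      · subst hi
        simp [hL] at hZ
        simp [hZ]
      · simpa [Function.update_of_ne hi] using hL i
    · rw [min_eq_left hh]
      simpa using hr

theorem simulates_of_reachable {C : ℕ}
    (hC : ∀ q s, ReflTransGen (RegProg.EdgeStep (CounterOp.sem w) edge) (q₀, (0, 0)) (q, s) →
      ∀ j, s.2 j ≤ C * (w.length + 1))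
    {c : (machine edge q₀ qf e).Config} (h : (machine edge q₀ qf e).Reachable w c) :
    Simulates C edge q₀ qf e w c := by
  induction h with
  | refl => exact Or.inl rfl
  | tail _ hs ih => exact simulates_step hC ih hs

/-- From `C ≤ 2 ^ C` and `n + 1 ≤ 2 ^ (log n + 1)` the exponent `l - 1` is at most `C + log n + 1`.
The factor `C + 4` absorbs the additive constants. -/
theorem width_le {C n l : ℕ} (h : 2 ^ (l - 1) ≤ C * (n + 1)) :
    l + 1 ≤ (C + 4) * (Nat.log 2 n + 1) := by
  have h1 : n + 1 ≤ 2 ^ (Nat.log 2 n + 1) := Nat.lt_pow_succ_log_self (by norm_num) n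
  have h2 : C ≤ 2 ^ C := Nat.lt_two_pow_self.le
  have h3 : 2 ^ (l - 1) ≤ 2 ^ (C + (Nat.log 2 n + 1)) := by
    rw [pow_add]
    exact h.trans (Nat.mul_le_mul h2 h1)
  have h4 := (Nat.pow_le_pow_iff_right (by norm_num : 1 < 2)).1 h3
  nlinarith [Nat.zero_le (Nat.log 2 n), Nat.zero_le C, Nat.zero_le (C * Nat.log 2 n),
    (by omega : l ≤ C + (Nat.log 2 n + 1) + 1)]

/-- A machine with counters of polynomially bounded size is simulated in logarithmic space. -/
theorem exists_offlineNTM (edge : Q → Option (CounterOp Γ ι) → Q → Prop) (q₀ qf : Q) (C : ℕ)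
    (hC : ∀ (w : List Γ) q s,
      ReflTransGen (RegProg.EdgeStep (CounterOp.sem w) edge) (q₀, (0, 0)) (q, s) →
      ∀ j, s.2 j ≤ C * (w.length + 1)) :
    ∃ M : OfflineNTM Γ, M.RunsInLogSpace ∧ ∀ w, M.Accepts w ↔
      ∃ s, ReflTransGen (RegProg.EdgeStep (CounterOp.sem w) edge) (q₀, (0, 0)) (qf, s) := by
  obtain ⟨t, ⟨e⟩⟩ := Finite.exists_equiv_fin ι
  refine ⟨machine edge q₀ qf e.symm, ⟨C + 4, ?_⟩, fun w => ⟨?_, ?_⟩⟩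
  · intro w c hc i
    have hone : 1 ≤ (C + 4) * (Nat.log 2 w.length + 1) :=
      Nat.mul_pos (by omega) (by omega)
    have hlen : ∀ L : List Bool, (L = [] ∨ 2 ^ (L.length - 1) ≤ C * (w.length + 1)) →
        L.length + 1 ≤ (C + 4) * (Nat.log 2 w.length + 1) := by
      rintro L (rfl | h)
      · simpa using hone
      · exact width_le h
    rcases simulates_of_reachable (hC w) hc with
      rfl | ⟨q, s, L, hr, hL, rfl | ⟨b, j, q', m, Y, hedge, hY, rfl⟩ | ⟨j, p, hp, rfl⟩⟩
    · exact Nat.zero_le _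
    · exact hone
    · change Function.update (fun _ => 1) j (m + 1) (e.symm i) ≤ _
      by_cases hi : e.symm i = j
      · rw [hi, Function.update_self]
        have := hlen _ (hL j).2
        rw [hY] at this
        simp at this
        omega
      · rw [Function.update_of_ne hi]
        exact hone
    · change Function.update (fun _ => 1) j p (e.symm i) ≤ _
      by_cases hi : e.symm i = j
      · rw [hi, Function.update_self]
        have := hlen _ (hL j).2
        omega
      · rw [Function.update_of_ne hi]
        exact hone
  · rintro ⟨c, hc, hacc⟩
    have hacc : c.state = Ctrl.ready qf := hacc
    rcases simulates_of_reachable (hC w) hc with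
      rfl | ⟨q, s, L, hr, hL, rfl | ⟨b, j, q', m, Y, hedge, hY, rfl⟩ | ⟨j, p, hp, rfl⟩⟩
    · cases hacc
    · cases hacc
      exact ⟨s, hr⟩
    · cases hacc
    · cases hacc
  · rintro ⟨s, hs⟩
    have key : ∀ x : Q × (ℕ × (ι → ℕ)),
        ReflTransGen (RegProg.EdgeStep (CounterOp.sem w) edge) (q₀, (0, 0)) x →
        ∃ L : ι → List Bool, (∀ j, binVal (L j) = x.2.2 j) ∧
          (machine edge q₀ qf e.symm).Reachable w
            (cfg edge q₀ qf e.symm (.ready x.1) x.2.1 (fun j => binTape (L j)) (fun _ => 1)) := by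
      intro x hx
      induction hx with
      | refl =>
        refine ⟨fun _ => [], fun _ => rfl, ?_⟩
        rw [OfflineNTM.Reachable, init_eq]
        refine ReflTransGen.single (step_iff.2 ?_)
        simp [update_blank_mark]
      | tail hx hstep ih =>
        obtain ⟨L, hL, hr⟩ := ih
        obtain ⟨L', hL', hr'⟩ := run_of_edgeStep (q₀ := q₀) (qf := qf) (e := e.symm)
          (head_le hx) hL hstep
        exact ⟨L', hL', hr.trans hr'⟩
    obtain ⟨L, hL, hr⟩ := key _ hs
    exact ⟨_, hr, rfl⟩

end CounterMachine

/-! ### Register programs -/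

/-- Atomic actions of a machine whose registers hold positions on the input tape: move a register
to the next or the previous position, test the symbol at a register, compare two registers. -/
inductive RegOp (Γ : Type u) : Type u
  | inc (i : ℕ) : RegOp Γ
  | dec (i : ℕ) : RegOp Γ
  | letter (i : ℕ) (S : Set (InputSymbol Γ)) : RegOp Γ
  | le (i j : ℕ) : RegOp Γ

/-- The effect of an action on the registers. -/
def RegOp.sem {Γ : Type u} (w : List Γ) : RegOp Γ → (ℕ → ℕ) → (ℕ → ℕ) → Prop
  | inc i, v, v' => v i ≤ w.length ∧ v' = Function.update v i (v i + 1)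
  | dec i, v, v' => v i ≠ 0 ∧ v' = Function.update v i (v i - 1)
  | letter i S, v, v' => OfflineNTM.inputAt w (v i) ∈ S ∧ v' = v
  | le i j, v, v' => v i ≤ v j ∧ v' = v

/-- All registers of an action are below `N`. -/
def RegOp.Below {Γ : Type u} (N : ℕ) : RegOp Γ → Prop
  | inc i => i < N
  | dec i => i < N
  | letter i _ => i < N
  | le i j => i < N ∧ j < N

/-- A program mentions finitely many registers. `N ≠ 0` is wanted so that register numbers can be
cast to `Fin N`. -/
theorem RegProg.exists_below {Γ : Type u} (p : RegProg (RegOp Γ)) :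
    ∃ N, N ≠ 0 ∧ p.Forall (RegOp.Below N) := by
  have mono : ∀ {M N : ℕ} {o : RegOp Γ}, M ≤ N → o.Below M → o.Below N := by
    rintro M N (_ | _ | _ | _) h ho
    · exact lt_of_lt_of_le ho h
    · exact lt_of_lt_of_le ho h
    · exact lt_of_lt_of_le ho h
    · exact ⟨lt_of_lt_of_le ho.1 h, lt_of_lt_of_le ho.2 h⟩
  have two : ∀ {p q : RegProg (RegOp Γ)}, (∃ N, N ≠ 0 ∧ p.Forall (RegOp.Below N)) →
      (∃ N, N ≠ 0 ∧ q.Forall (RegOp.Below N)) →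
      ∃ N, N ≠ 0 ∧ p.Forall (RegOp.Below N) ∧ q.Forall (RegOp.Below N) := by
    rintro p q ⟨M, hM, hp⟩ ⟨N, hN, hq⟩
    exact ⟨max M N, by omega, hp.mono fun _ => mono (le_max_left _ _),
      hq.mono fun _ => mono (le_max_right _ _)⟩
  induction p with
  | atom o =>
    rcases o with i | i | ⟨i, S⟩ | ⟨i, j⟩
    · exact ⟨i + 1, by omega, Nat.lt_succ_self i⟩
    · exact ⟨i + 1, by omega, Nat.lt_succ_self i⟩
    · exact ⟨i + 1, by omega, Nat.lt_succ_self i⟩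
    · exact ⟨max i j + 1, by omega, by omega, by omega⟩
  | seq p q hp hq => exact two hp hq
  | alt p q hp hq => exact two hp hq
  | star p hp => exact hp

namespace OfflineNTM

variable {Γ : Type u} {w : List Γ} {p : ℕ}

theorem inputAt_eq_leftEnd : inputAt w p = InputSymbol.leftEnd ↔ p = 0 := by
  rcases p with _ | p
  · simp [inputAt]
  · simp only [inputAt]
    cases w[p]? <;> simp

theorem inputAt_eq_letter {a : Γ} :
    inputAt w p = InputSymbol.letter a ↔ ∃ q, p = q + 1 ∧ w[q]? = some a := by
  rcases p with _ | p
  · simp [inputAt]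
  · simp only [inputAt]
    cases h : w[p]? <;> simp [h]

theorem inputAt_eq_rightEnd : inputAt w p = InputSymbol.rightEnd ↔ w.length < p := by
  rcases p with _ | p
  · simp [inputAt]
  · simp only [inputAt]
    cases h : w[p]? with
    | none => simpa using List.getElem?_eq_none_iff.1 h
    | some a =>
      obtain ⟨h, -⟩ := List.getElem?_eq_some_iff.1 h
      simpa using h

end OfflineNTM

/-! ### Counters as stores of tokens moved along with the input head -/

namespace CounterMachine

open RegProg OfflineNTM

section Tokens

variable {Γ : Type u} {ι : Type} [DecidableEq ι] {w : List Γ}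

/-- Counter contents after moving `x` tokens from `a` to `b`. -/
def shiftTokens (a b : ι) (x : ℕ) (c : ι → ℕ) : ι → ℕ :=
  fun j => if j = a then c a - x else if j = b then c b + x else c j

/-- Move one token. -/
def transfer (a b : ι) : RegProg (CounterOp Γ ι) :=
  seq (atom (.dec a)) (atom (.inc b))

/-- Move one token and move the head to the right. -/
def transferRight (a b : ι) : RegProg (CounterOp Γ ι) :=
  seq (atom (.test {x | x ≠ .rightEnd})) (seq (transfer a b) (atom (.move .right)))

/-- Move one token and move the head to the left. -/
def transferLeft (a b : ι) : RegProg (CounterOp Γ ι) :=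
  seq (atom (.test {x | x ≠ .leftEnd})) (seq (transfer a b) (atom (.move .left)))

theorem run_transfer {a b : ι} (hab : a ≠ b) {h : ℕ} {c : ι → ℕ} {s : ℕ × (ι → ℕ)} :
    Run (CounterOp.sem w) (transfer a b) (h, c) s ↔ c a ≠ 0 ∧ s = (h, shiftTokens a b 1 c) := by
  have key : Function.update (Function.update c a (c a - 1)) b
      (Function.update c a (c a - 1) b + 1) = shiftTokens a b 1 c := by
    funext j
    by_cases hb : j = b
    · subst hb
      simp [shiftTokens, hab.symm]
    · by_cases ha : j = a
      · subst ha
        simp [shiftTokens, hab]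
      · simp [shiftTokens, ha, hb]
  constructor
  · rintro ⟨m, ⟨h1, rfl⟩, rfl⟩
    exact ⟨h1, by rw [← key]⟩
  · rintro ⟨h1, rfl⟩
    exact ⟨_, ⟨h1, rfl⟩, by rw [← key]; rfl⟩

/-- The end marker is tested first because a clamped move would transfer a token without moving the
head. Thus tokens moved and cells crossed always agree in number. -/
theorem run_transferRight {a b : ι} (hab : a ≠ b) {h : ℕ} {c : ι → ℕ} {s : ℕ × (ι → ℕ)} :
    Run (CounterOp.sem w) (transferRight a b) (h, c) s ↔
      h ≤ w.length ∧ c a ≠ 0 ∧ s = (h + 1, shiftTokens a b 1 c) := by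
  constructor
  · rintro ⟨m, ⟨h1, rfl⟩, m', h2, rfl⟩
    obtain ⟨h2', rfl⟩ := (run_transfer hab).1 h2
    have h1 : ¬ w.length < h := fun hlt => h1 (inputAt_eq_rightEnd.2 hlt)
    refine ⟨by omega, h2', ?_⟩
    simp [moveInput, moveWork]
    omega
  · rintro ⟨h1, h2, rfl⟩
    refine ⟨_, ⟨fun h3 => ?_, rfl⟩, _, (run_transfer hab).2 ⟨h2, rfl⟩, ?_⟩
    · have := inputAt_eq_rightEnd.1 h3
      omega
    · change (_, _) = (moveInput _ _ _, _)
      simp [moveInput, moveWork]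
      omega

theorem run_transferLeft {a b : ι} (hab : a ≠ b) {h : ℕ} (hh : h ≤ w.length + 1) {c : ι → ℕ}
    {s : ℕ × (ι → ℕ)} :
    Run (CounterOp.sem w) (transferLeft a b) (h, c) s ↔
      h ≠ 0 ∧ c a ≠ 0 ∧ s = (h - 1, shiftTokens a b 1 c) := by
  constructor
  · rintro ⟨m, ⟨h1, rfl⟩, m', h2, rfl⟩
    obtain ⟨h2', rfl⟩ := (run_transfer hab).1 h2
    refine ⟨fun h0 => h1 (inputAt_eq_leftEnd.2 h0), h2', ?_⟩
    simp [moveInput, moveWork]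
    omega
  · rintro ⟨h1, h2, rfl⟩
    refine ⟨_, ⟨fun h3 => h1 (inputAt_eq_leftEnd.1 h3), rfl⟩, _,
      (run_transfer hab).2 ⟨h2, rfl⟩, ?_⟩
    change (_, _) = (moveInput _ _ _, _)
    simp [moveInput, moveWork]
    omega

theorem shiftTokens_zero (a b : ι) (c : ι → ℕ) : shiftTokens a b 0 c = c := by
  funext j
  simp only [shiftTokens]
  split_ifs with h1 h2
  · rw [h1]; rfl
  · rw [h2]; rfl
  · rfl

theorem shiftTokens_add {a b : ι} (hab : a ≠ b) (x y : ℕ) (c : ι → ℕ) :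
    shiftTokens a b y (shiftTokens a b x c) = shiftTokens a b (x + y) c := by
  funext j
  by_cases ha : j = a
  · subst ha
    simp [shiftTokens]
    omega
  · by_cases hb : j = b
    · subst hb
      simp [shiftTokens, ha]
      omega
    · simp [shiftTokens, ha, hb]

theorem run_star_transferRight {a b : ι} (hab : a ≠ b) {h : ℕ} (hh : h ≤ w.length + 1)
    {c : ι → ℕ} {s : ℕ × (ι → ℕ)} :
    Run (CounterOp.sem w) (star (transferRight a b)) (h, c) s ↔
      ∃ x, x ≤ c a ∧ h + x ≤ w.length + 1 ∧ s = (h + x, shiftTokens a b x c) := by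
  constructor
  · intro hr
    change Relation.ReflTransGen _ _ _ at hr
    induction hr with
    | refl => exact ⟨0, Nat.zero_le _, hh, by rw [shiftTokens_zero]; rfl⟩
    | tail _ hs ih =>
      obtain ⟨x, hx, hn, rfl⟩ := ih
      obtain ⟨h1, h2, rfl⟩ := (run_transferRight hab).1 hs
      have h2' : c a - x ≠ 0 := by simpa [shiftTokens] using h2
      exact ⟨x + 1, by omega, by omega, by rw [shiftTokens_add hab]; rfl⟩
  · rintro ⟨x, hx, hn, rfl⟩
    change Relation.ReflTransGen _ _ _
    induction x with
    | zero => rw [shiftTokens_zero]; exact Relation.ReflTransGen.refl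
    | succ x ih =>
      refine (ih (by omega) (by omega)).tail ((run_transferRight hab).2 ⟨by omega, ?_, ?_⟩)
      · simp [shiftTokens]
        omega
      · rw [shiftTokens_add hab]; rfl

theorem run_star_transferLeft {a b : ι} (hab : a ≠ b) {h : ℕ} (hh : h ≤ w.length + 1)
    {c : ι → ℕ} {s : ℕ × (ι → ℕ)} :
    Run (CounterOp.sem w) (star (transferLeft a b)) (h, c) s ↔
      ∃ x, x ≤ c a ∧ x ≤ h ∧ s = (h - x, shiftTokens a b x c) := by
  constructor
  · intro hr
    change Relation.ReflTransGen _ _ _ at hr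
    induction hr with
    | refl => exact ⟨0, Nat.zero_le _, Nat.zero_le _, by rw [shiftTokens_zero]; rfl⟩
    | tail _ hs ih =>
      obtain ⟨x, hx, hn, rfl⟩ := ih
      obtain ⟨h1, h2, rfl⟩ := (run_transferLeft hab (by omega)).1 hs
      have h2' : c a - x ≠ 0 := by simpa [shiftTokens] using h2
      exact ⟨x + 1, by omega, by omega, by rw [shiftTokens_add hab]; rfl⟩
  · rintro ⟨x, hx, hn, rfl⟩
    change Relation.ReflTransGen _ _ _
    induction x with
    | zero => rw [shiftTokens_zero]; exact Relation.ReflTransGen.refl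
    | succ x ih =>
      refine (ih (by omega) (by omega)).tail
        ((run_transferLeft hab (by omega)).2 ⟨by omega, ?_, ?_⟩)
      · simp [shiftTokens]
        omega
      · rw [shiftTokens_add hab]; rfl

/-- Test whether the input tape can be scanned with some of the tokens of `a` up to a symbol in
`S`, and on to the right end with some of the tokens of `b`. The counters `e` and `f` serve to
restore `a` and `b`. -/
def scan (a b e f : ι) (S : Set (InputSymbol Γ)) : RegProg (CounterOp Γ ι) :=
  seq (star (transferRight a e)) (seq (atom (.test S)) (seq (star (transferRight b f))
    (seq (atom (.test {.rightEnd})) (seq (star (transferLeft e a))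
      (seq (star (transferLeft f b)) (atom (.test {.leftEnd})))))))

/-- The loops may stop anywhere, but the end-marker tests leave no freedom. Reaching the right end
forces `x + y = w.length + 1`. Coming back to the left end takes as many token moves, so both
auxiliary counters are emptied and `a`, `b` are restored. -/
theorem run_scan {a b e f : ι} (hae : a ≠ e) (haf : a ≠ f) (hbe : b ≠ e) (hbf : b ≠ f)
    (hab : a ≠ b) (hef : e ≠ f) {c : ι → ℕ} (he : c e = 0) (hf : c f = 0) {S}
    {s : ℕ × (ι → ℕ)} :
    Run (CounterOp.sem w) (scan a b e f S) (0, c) s ↔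
      s = (0, c) ∧ ∃ x y, x ≤ c a ∧ y ≤ c b ∧ x + y = w.length + 1 ∧ inputAt w x ∈ S := by
  have restore : ∀ x y, x ≤ c a → y ≤ c b →
      shiftTokens f b y (shiftTokens e a x (shiftTokens b f y (shiftTokens a e x c))) = c := by
    intro x y hx hy
    funext j
    by_cases h1 : j = a
    · subst h1; simp [shiftTokens, *]
    · by_cases h2 : j = b
      · subst h2; simp [shiftTokens, *]
      · by_cases h3 : j = e
        · subst h3; simp [shiftTokens, *]
        · by_cases h4 : j = f
          · subst h4; simp [shiftTokens, *]
          · simp [shiftTokens, *]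
  constructor
  · rintro ⟨s1, h1, s2, ⟨h2, rfl⟩, s3, h3, s4, ⟨h4, rfl⟩, s5, h5, s6, h6, h7, rfl⟩
    obtain ⟨x, hx, hxn, rfl⟩ := (run_star_transferRight hae (Nat.zero_le _)).1 h1
    obtain ⟨y, hy, hyn, rfl⟩ := (run_star_transferRight hbf hxn).1 h3
    obtain ⟨x', hx', hxn', rfl⟩ := (run_star_transferLeft hae.symm hyn).1 h5
    obtain ⟨y', hy', hyn', rfl⟩ := (run_star_transferLeft hbf.symm (by omega)).1 h6
    have e1 : shiftTokens b f y (shiftTokens a e x c) e = x := by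
      simp [shiftTokens, hbe.symm, hef, hae.symm, he]
    have e2 : shiftTokens e a x' (shiftTokens b f y (shiftTokens a e x c)) f = y := by
      simp [shiftTokens, hbf.symm, hef.symm, haf.symm, hf]
    have e3 : shiftTokens a e x c b = c b := by
      simp [shiftTokens, hab.symm, hbe]
    rw [e1] at hx'
    rw [e2] at hy'
    rw [e3] at hy
    have h4 := inputAt_eq_rightEnd.1 h4
    have h7 := inputAt_eq_leftEnd.1 h7
    simp only at h4 h7
    -- At most `x` and `y` tokens are available for the way back, and `x + y` cells have to be
    -- crossed.
    obtain rfl : x' = x := by omega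
    obtain rfl : y' = y := by omega
    refine ⟨?_, x', y', hx, hy, by omega, by simpa using h2⟩
    rw [restore _ _ hx hy, h7]
  · rintro ⟨rfl, x, y, hx, hy, hxy, hS⟩
    have e1 : shiftTokens b f y (shiftTokens a e x c) e = x := by
      simp [shiftTokens, hbe.symm, hef, hae.symm, he]
    have e2 : shiftTokens e a x (shiftTokens b f y (shiftTokens a e x c)) f = y := by
      simp [shiftTokens, hbf.symm, hef.symm, haf.symm, hf]
    have e3 : shiftTokens a e x c b = c b := by
      simp [shiftTokens, hab.symm, hbe]
    refine ⟨_, (run_star_transferRight hae (Nat.zero_le _)).2 ⟨x, hx, by omega, rfl⟩,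
      _, ⟨by simpa using hS, rfl⟩,
      _, (run_star_transferRight hbf (by omega)).2 ⟨y, by omega, by omega, rfl⟩,
      _, ⟨inputAt_eq_rightEnd.2 (by simp only; omega), rfl⟩,
      _, (run_star_transferLeft hae.symm (by omega)).2 ⟨x, by omega, by omega, rfl⟩,
      _, (run_star_transferLeft hbf.symm (by omega)).2 ⟨y, by omega, by omega, rfl⟩,
      inputAt_eq_leftEnd.2 (by simp only; omega), ?_⟩
    rw [restore _ _ hx hy]
    congr 1
    omega

variable [Fintype ι]

theorem sum_update_succ (c : ι → ℕ) (j : ι) :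
    ∑ i, Function.update c j (c j + 1) i = ∑ i, c i + 1 := by
  rw [Finset.sum_update_of_mem (Finset.mem_univ j),
    ← Finset.add_sum_erase Finset.univ c (Finset.mem_univ j), Finset.sdiff_singleton_eq_erase]
  ring

theorem sum_update_pred (c : ι → ℕ) (j : ι) (h : c j ≠ 0) :
    ∑ i, Function.update c j (c j - 1) i + 1 = ∑ i, c i := by
  rw [Finset.sum_update_of_mem (Finset.mem_univ j),
    ← Finset.add_sum_erase Finset.univ c (Finset.mem_univ j), Finset.sdiff_singleton_eq_erase]
  omega

/-- The number of tokens is `M`. -/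
def Total (M : ℕ) (s : ℕ × (ι → ℕ)) : Prop := ∑ i, s.2 i = M

/-- No counter exceeds `M`. -/
def AtMost (M : ℕ) (s : ℕ × (ι → ℕ)) : Prop := ∀ i, s.2 i ≤ M

theorem AtMost.of_total {M : ℕ} {s : ℕ × (ι → ℕ)} (h : Total M s) : AtMost M s := by
  intro i
  rw [← h]
  exact Finset.single_le_sum (f := s.2) (fun _ _ => Nat.zero_le _) (Finset.mem_univ i)

theorem hoare_test (M : ℕ) (S : Set (InputSymbol Γ)) :
    Hoare (CounterOp.sem w) (AtMost (ι := ι) M) (Total M) (atom (.test S)) (Total M) :=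
  Hoare.atom (fun _ => AtMost.of_total) (fun _ => AtMost.of_total) (by
    rintro s t hs ⟨-, rfl⟩
    exact hs)

theorem hoare_move (M : ℕ) (d : HeadMove) :
    Hoare (CounterOp.sem w) (AtMost (ι := ι) M) (Total M) (atom (.move d)) (Total M) :=
  Hoare.atom (fun _ => AtMost.of_total) (fun _ => AtMost.of_total) (by
    rintro s t hs rfl
    exact hs)

theorem hoare_transfer (M : ℕ) (a b : ι) :
    Hoare (CounterOp.sem w) (AtMost M) (Total M) (transfer a b) (Total M) := by
  have hB : ∀ s : ℕ × (ι → ℕ), ∑ i, s.2 i + 1 = M → AtMost M s := fun s hs i => by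
    have := Finset.single_le_sum (f := s.2) (fun _ _ => Nat.zero_le _) (Finset.mem_univ i)
    omega
  -- Between the two actions one token is missing.
  refine Hoare.seq (R := fun s => ∑ i, s.2 i + 1 = M) ?_ ?_
  · refine Hoare.atom (fun _ => AtMost.of_total) hB ?_
    rintro s t hs ⟨hne, rfl⟩
    exact (sum_update_pred s.2 a hne).trans hs
  · refine Hoare.atom hB (fun _ => AtMost.of_total) ?_
    rintro s t hs rfl
    exact (sum_update_succ s.2 b).trans hs

theorem hoare_scan (M : ℕ) (a b e f : ι) (S : Set (InputSymbol Γ)) :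
    Hoare (CounterOp.sem w) (AtMost M) (Total M) (scan a b e f S) (Total M) := by
  have hr : ∀ a b : ι, Hoare (CounterOp.sem w) (AtMost M) (Total M)
      (star (transferRight a b)) (Total M) := fun a b =>
    Hoare.star ((hoare_test M _).seq ((hoare_transfer M a b).seq (hoare_move M _)))
      fun _ => AtMost.of_total
  have hl : ∀ a b : ι, Hoare (CounterOp.sem w) (AtMost M) (Total M)
      (star (transferLeft a b)) (Total M) := fun a b =>
    Hoare.star ((hoare_test M _).seq ((hoare_transfer M a b).seq (hoare_move M _)))
      fun _ => AtMost.of_total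
  exact (hr a e).seq ((hoare_test M _).seq ((hr b f).seq ((hoare_test M _).seq
    ((hl e a).seq ((hl f b).seq (hoare_test M _))))))

end Tokens

end CounterMachine

/-! ### Registers as pairs of complementary counters -/

namespace CounterMachine

open RegProg OfflineNTM

/-- The counters that implement `N` registers: each register has one counter for its value and
one for the distance of its value to the right end; there are two auxiliary counters. -/
inductive Cell (N : ℕ) : Type
  | val (i : Fin N)
  | co (i : Fin N)
  | aux (b : Bool)
  deriving DecidableEq

instance (N : ℕ) : Finite (Cell N) :=
  Finite.of_injective
    (fun c : Cell N => match c with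
      | .val i => (Sum.inl i : Fin N ⊕ Fin N ⊕ Bool)
      | .co i => Sum.inr (Sum.inl i)
      | .aux b => Sum.inr (Sum.inr b))
    (by rintro (_ | _ | _) (_ | _ | _) h <;> simp_all)

noncomputable instance (N : ℕ) : Fintype (Cell N) := Fintype.ofFinite _

variable {Γ : Type u} {w : List Γ} {N : ℕ}

/-- The implementation of the register actions. -/
def gadget (N : ℕ) [NeZero N] : RegOp Γ → RegProg (CounterOp Γ (Cell N))
  | .inc i => transfer (.co (Fin.ofNat N i)) (.val (Fin.ofNat N i))
  | .dec i => transfer (.val (Fin.ofNat N i)) (.co (Fin.ofNat N i))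
  | .letter i S => scan (.val (Fin.ofNat N i)) (.co (Fin.ofNat N i))
      (.aux true) (.aux false) S
  | .le i j => scan (.val (Fin.ofNat N j)) (.co (Fin.ofNat N i))
      (.aux true) (.aux false) Set.univ

/-- The registers `v` are represented by the counters `s`. -/
def Implements (w : List Γ) (v : ℕ → ℕ) (s : ℕ × (Cell N → ℕ)) : Prop :=
  s.1 = 0 ∧ (∀ i : Fin N, v i ≤ w.length + 1 ∧ s.2 (.val i) = v i ∧
    s.2 (.co i) = w.length + 1 - v i) ∧ ∀ b, s.2 (.aux b) = 0

theorem ofNat_ne {N : ℕ} [NeZero N] {i : ℕ} (hi : i < N) {k : Fin N} (h : (k : ℕ) ≠ i) :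
    k ≠ Fin.ofNat N i := by
  rintro rfl
  exact h (Nat.mod_eq_of_lt hi)

theorem val_ofNat {N : ℕ} [NeZero N] {i : ℕ} (hi : i < N) : ((Fin.ofNat N i : Fin N) : ℕ) = i :=
  Nat.mod_eq_of_lt hi

theorem Implements.inc [NeZero N] {v : ℕ → ℕ} {c : Cell N → ℕ} (h : Implements w v (0, c)) {i : ℕ}
    (hi : i < N) (hv : v i ≤ w.length) :
    Implements w (Function.update v i (v i + 1)) (0, shiftTokens
      (.co (Fin.ofNat N i)) (.val (Fin.ofNat N i)) 1 c) := by
  refine ⟨rfl, fun k => ?_, fun b => ?_⟩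
  · by_cases hk : (k : ℕ) = i
    · obtain rfl : k = Fin.ofNat N i := Fin.ext (by rw [hk, val_ofNat hi])
      obtain ⟨h1, h2, h3⟩ := h.2.1 (Fin.ofNat N i)
      rw [val_ofNat hi] at h1 h2 h3 ⊢
      simp only [] at h1 h2 h3
      simp only [Function.update_self, shiftTokens, if_true, h2, h3]
      refine ⟨by omega, by simp, by omega⟩
    · have hk' := ofNat_ne hi hk
      obtain ⟨h1, h2, h3⟩ := h.2.1 k
      simp only [] at h1 h2 h3
      simp only [shiftTokens, Function.update_of_ne hk, Cell.val.injEq, Cell.co.injEq, hk',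
        reduceCtorEq, if_false, h1, h2, h3, and_self]
  · simpa [shiftTokens] using h.2.2 b

theorem Implements.dec [NeZero N] {v : ℕ → ℕ} {c : Cell N → ℕ} (h : Implements w v (0, c)) {i : ℕ}
    (hi : i < N) (hv : v i ≠ 0) :
    Implements w (Function.update v i (v i - 1)) (0, shiftTokens
      (.val (Fin.ofNat N i)) (.co (Fin.ofNat N i)) 1 c) := by
  refine ⟨rfl, fun k => ?_, fun b => ?_⟩
  · by_cases hk : (k : ℕ) = i
    · obtain rfl : k = Fin.ofNat N i := Fin.ext (by rw [hk, val_ofNat hi])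
      obtain ⟨h1, h2, h3⟩ := h.2.1 (Fin.ofNat N i)
      rw [val_ofNat hi] at h1 h2 h3 ⊢
      simp only [] at h1 h2 h3
      simp only [Function.update_self, shiftTokens, if_true, h2, h3]
      refine ⟨by omega, by simp, ?_⟩
      simp
      omega
    · have hk' := ofNat_ne hi hk
      obtain ⟨h1, h2, h3⟩ := h.2.1 k
      simp only [] at h1 h2 h3
      simp only [shiftTokens, Function.update_of_ne hk, Cell.val.injEq, Cell.co.injEq, hk',
        reduceCtorEq, if_false, h1, h2, h3, and_self]
  · simpa [shiftTokens] using h.2.2 b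

/-- For `letter i`, the two counters together hold exactly `w.length + 1` tokens, so the scan must
use all of them and reads the symbol at cell `v i`. For `le i j`, a scan needs `x ≤ v j` and `y ≤
w.length + 1 - v i` with sum `w.length + 1`, which exist exactly if `v i ≤ v j`. -/
theorem run_gadget_iff [NeZero N] {o : RegOp Γ} (ho : o.Below N) {v : ℕ → ℕ}
    {s : ℕ × (Cell N → ℕ)} (h : Implements w v s) (s' : ℕ × (Cell N → ℕ)) :
    Run (CounterOp.sem w) (gadget N o) s s' ↔
      match o with
      | .inc i => v i ≤ w.length ∧ s' = (0, shiftTokens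
          (.co (Fin.ofNat N i)) (.val (Fin.ofNat N i)) 1 s.2)
      | .dec i => v i ≠ 0 ∧ s' = (0, shiftTokens
          (.val (Fin.ofNat N i)) (.co (Fin.ofNat N i)) 1 s.2)
      | .letter i S => s' = s ∧ inputAt w (v i) ∈ S
      | .le i j => s' = s ∧ v i ≤ v j := by
  obtain ⟨h0, c⟩ := s
  obtain rfl : h0 = 0 := h.1
  cases o with
  | inc i =>
    obtain ⟨h1, h2, h3⟩ := h.2.1 (Fin.ofNat N i)
    rw [val_ofNat ho] at h1 h2 h3
    simp only [] at h1 h2 h3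
    refine (run_transfer (by simp)).trans (and_congr_left fun _ => ?_)
    rw [h3]
    omega
  | dec i =>
    obtain ⟨h1, h2, h3⟩ := h.2.1 (Fin.ofNat N i)
    rw [val_ofNat ho] at h1 h2 h3
    simp only [] at h1 h2 h3
    refine (run_transfer (by simp)).trans (and_congr_left fun _ => ?_)
    rw [h2]
  | letter i S =>
    obtain ⟨h1, h2, h3⟩ := h.2.1 (Fin.ofNat N i)
    rw [val_ofNat ho] at h1 h2 h3
    refine (run_scan (by simp) (by simp) (by simp) (by simp) (by simp) (by simp) (h.2.2 _)
      (h.2.2 _)).trans (and_congr_right fun _ => ?_)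
    rw [h2, h3]
    constructor
    · rintro ⟨x, y, hx, hy, hxy, hS⟩
      obtain rfl : x = v i := by omega
      exact hS
    · intro hS
      exact ⟨v i, w.length + 1 - v i, le_rfl, le_rfl, by omega, hS⟩
  | le i j =>
    obtain ⟨h1, h2, h3⟩ := h.2.1 (Fin.ofNat N i)
    obtain ⟨h1', h2', h3'⟩ := h.2.1 (Fin.ofNat N j)
    rw [val_ofNat ho.1] at h1 h2 h3
    rw [val_ofNat ho.2] at h1' h2' h3'
    refine (run_scan (by simp) (by simp) (by simp) (by simp) (by simp) (by simp) (h.2.2 _)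
      (h.2.2 _)).trans (and_congr_right fun _ => ?_)
    rw [h2', h3]
    constructor
    · rintro ⟨x, y, hx, hy, hxy, -⟩
      omega
    · intro hle
      exact ⟨v i, w.length + 1 - v i, hle, le_rfl, by omega, Set.mem_univ _⟩

theorem exists_sem_of_run_gadget [NeZero N] (o : RegOp Γ) (ho : o.Below N) (v : ℕ → ℕ)
    (s : ℕ × (Cell N → ℕ)) (h : Implements w v s) (s' : ℕ × (Cell N → ℕ))
    (hr : Run (CounterOp.sem w) (gadget N o) s s') :
    ∃ v', RegOp.sem w o v v' ∧ Implements w v' s' := by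
  have hr := (run_gadget_iff ho h s').1 hr
  obtain ⟨h0, c⟩ := s
  obtain rfl : h0 = 0 := h.1
  cases o with
  | inc i =>
    obtain ⟨h1, rfl⟩ := hr
    exact ⟨_, ⟨h1, rfl⟩, h.inc ho h1⟩
  | dec i =>
    obtain ⟨h1, rfl⟩ := hr
    exact ⟨_, ⟨h1, rfl⟩, h.dec ho h1⟩
  | letter i S =>
    obtain ⟨rfl, hS⟩ := hr
    exact ⟨v, ⟨hS, rfl⟩, h⟩
  | le i j =>
    obtain ⟨rfl, hle⟩ := hr
    exact ⟨v, ⟨hle, rfl⟩, h⟩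

theorem exists_run_gadget_of_sem [NeZero N] (o : RegOp Γ) (ho : o.Below N) (v : ℕ → ℕ)
    (s : ℕ × (Cell N → ℕ)) (h : Implements w v s) (v' : ℕ → ℕ) (hs : RegOp.sem w o v v') :
    ∃ s', Run (CounterOp.sem w) (gadget N o) s s' ∧ Implements w v' s' := by
  obtain ⟨h0, c⟩ := s
  obtain rfl : h0 = 0 := h.1
  cases o with
  | inc i =>
    obtain ⟨h1, rfl⟩ := hs
    exact ⟨_, (run_gadget_iff ho h _).2 ⟨h1, rfl⟩, h.inc ho h1⟩
  | dec i =>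
    obtain ⟨h1, rfl⟩ := hs
    exact ⟨_, (run_gadget_iff ho h _).2 ⟨h1, rfl⟩, h.dec ho h1⟩
  | letter i S =>
    obtain ⟨h1, rfl⟩ := hs
    exact ⟨_, (run_gadget_iff ho h _).2 ⟨rfl, h1⟩, h⟩
  | le i j =>
    obtain ⟨h1, rfl⟩ := hs
    exact ⟨_, (run_gadget_iff ho h _).2 ⟨rfl, h1⟩, h⟩

theorem hoare_gadget [NeZero N] (M : ℕ) (o : RegOp Γ) :
    Hoare (CounterOp.sem w) (AtMost M) (Total M) (gadget N o) (Total M) := by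
  cases o with
  | inc i => exact hoare_transfer M _ _
  | dec i => exact hoare_transfer M _ _
  | letter i S => exact hoare_scan M _ _ _ _ _
  | le i j => exact hoare_scan M _ _ _ _ _

theorem hoare_bind_gadget [NeZero N] (M : ℕ) : ∀ p : RegProg (RegOp Γ),
    Hoare (CounterOp.sem w) (AtMost M) (Total M) (p.bind (gadget N)) (Total M)
  | .atom o => hoare_gadget M o
  | .seq p q => (hoare_bind_gadget M p).seq (hoare_bind_gadget M q)
  | .alt p q => (hoare_bind_gadget M p).alt (hoare_bind_gadget M q)
      (fun _ => AtMost.of_total) (fun _ => AtMost.of_total)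
  | .star p => (hoare_bind_gadget M p).star (fun _ => AtMost.of_total)

/-! ### Initialization -/

section Fill

variable {ι : Type} [DecidableEq ι]

/-- Increment all counters in a list. -/
def incAll : List ι → RegProg (CounterOp Γ ι)
  | [] => atom (.test Set.univ)
  | j :: l => seq (atom (.inc j)) (incAll l)

theorem run_incAll : ∀ (l : List ι) (s t : ℕ × (ι → ℕ)), Run (CounterOp.sem w) (incAll l) s t ↔
    t = (s.1, fun j => s.2 j + l.count j)
  | [], s, t => by simp [incAll, Run, CounterOp.sem]
  | i :: l, s, t => by
    have key : ∀ m : ℕ × (ι → ℕ), m = (s.1, Function.update s.2 i (s.2 i + 1)) →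
        ((m.1, fun j => m.2 j + l.count j) : ℕ × (ι → ℕ)) =
          (s.1, fun j => s.2 j + (i :: l).count j) := by
      rintro m rfl
      refine Prod.ext rfl (funext fun j => ?_)
      by_cases hj : j = i
      · subst hj
        simp
        omega
      · simp [Function.update_of_ne hj, List.count_cons_of_ne (Ne.symm hj)]
    constructor
    · rintro ⟨m, hm, h⟩
      rw [(run_incAll l m t).1 h, key m hm]
    · rintro rfl
      exact ⟨_, rfl, (run_incAll l _ _).2 (key _ rfl).symm⟩

theorem visits_incAll : ∀ (l : List ι) (s : ℕ × (ι → ℕ)) (x : Pt (incAll l)) (t : ℕ × (ι → ℕ)),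
    Visits (CounterOp.sem w) (incAll (Γ := Γ) l) s x t → ∀ j, t.2 j ≤ s.2 j + l.count j
  | [], s, x, t, h, j => by
    rcases h with ⟨-, rfl⟩ | ⟨-, -, rfl⟩ <;> simp
  | i :: l, s, .inl x, t, h, j => by
    rcases h with ⟨-, rfl⟩ | ⟨-, rfl⟩
    · simp
    · by_cases hj : j = i
      · subst hj; simp
      · simp [Function.update_of_ne hj]
  | i :: l, s, .inr x, t, ⟨m, hm, h⟩, j => by
    have h1 := visits_incAll l m x t h j
    have hm : m = (s.1, Function.update s.2 i (s.2 i + 1)) := hm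
    subst hm
    by_cases hj : j = i
    · subst hj
      simp at h1 ⊢
      omega
    · simpa [Function.update_of_ne hj, List.count_cons_of_ne (Ne.symm hj)] using h1

/-- Set the counters in `l` to the position of the right end; return to the left end. -/
def fill (l : List ι) : RegProg (CounterOp Γ ι) :=
  seq (star (seq (atom (.test {x | x ≠ .rightEnd})) (seq (incAll l) (atom (.move .right)))))
    (seq (atom (.test {.rightEnd})) (seq (star (atom (.move .left))) (atom (.test {.leftEnd}))))

theorem hoare_fill (l : List ι) (hl : l.Nodup) :
    Hoare (CounterOp.sem w) (AtMost (w.length + 1)) (fun s => s = (0, 0)) (fill (Γ := Γ) l)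
      (fun s => s = (0, fun j => (w.length + 1) * l.count j)) := by
  -- Without repetitions in `l`, each pass over a cell increments a counter at most once, so the
  -- contents never exceed the position of the right end.
  have hcount : ∀ j, l.count j ≤ 1 := fun j => List.nodup_iff_count_le_one.1 hl j
  have hbound : ∀ h, h ≤ w.length + 1 → ∀ j, h * l.count j ≤ w.length + 1 := fun h hh j =>
    (Nat.mul_le_mul hh (hcount j)).trans (by simp)
  refine Hoare.seq (R := fun s => ∃ h ≤ w.length + 1, s = (h, fun j => h * l.count j)) ?_ ?_
  · refine Hoare.mono (Hoare.star (P := fun s => ∃ h ≤ w.length + 1, s = (h, fun j => h * l.count j))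
      ?_ ?_) ?_ (fun _ h => h)
    · refine Hoare.seq (R := fun s => ∃ h ≤ w.length, s = (h, fun j => h * l.count j)) ?_
        (Hoare.seq (R := fun s => ∃ h ≤ w.length, s = (h, fun j => (h + 1) * l.count j)) ?_ ?_)
      · refine Hoare.atom ?_ ?_ ?_
        · rintro s ⟨h, hh, rfl⟩
          exact hbound h hh
        · rintro s ⟨h, hh, rfl⟩
          exact hbound h (by omega)
        · rintro s t ⟨h, hh, rfl⟩ ⟨hS, rfl⟩
          refine ⟨h, ?_, rfl⟩
          have : ¬ w.length < h := fun hlt => hS (inputAt_eq_rightEnd.2 hlt)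
          omega
      · rintro s ⟨h, hh, rfl⟩
        refine ⟨fun t ht => ?_, fun x t ht j => ?_⟩
        · rw [(run_incAll l _ t).1 ht]
          refine ⟨h, hh, Prod.ext rfl (funext fun j => ?_)⟩
          simp only
          ring
        · refine (visits_incAll l _ x t ht j).trans ?_
          have := hbound (h + 1) (by omega) j
          rw [add_mul, one_mul] at this
          exact this
      · refine Hoare.atom ?_ ?_ ?_
        · rintro s ⟨h, hh, rfl⟩
          exact hbound (h + 1) (by omega)
        · rintro s ⟨h, hh, rfl⟩
          exact hbound h hh
        · rintro s t ⟨h, hh, rfl⟩ rfl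
          refine ⟨h + 1, by omega, ?_⟩
          simp [moveInput, moveWork, hh]
    · rintro s ⟨h, hh, rfl⟩
      exact hbound h hh
    · rintro s rfl
      exact ⟨0, Nat.zero_le _, Prod.ext rfl (funext fun j => (by simp))⟩
  -- On the way back the head position need not be tracked, since the final test for the left end
  -- determines it.
  · refine Hoare.seq (R := fun s => s.2 = fun j => (w.length + 1) * l.count j) ?_ (Hoare.seq
      (R := fun s => s.2 = fun j => (w.length + 1) * l.count j) ?_ ?_)
    · refine Hoare.atom ?_ ?_ ?_
      · rintro s ⟨h, hh, rfl⟩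
        exact hbound h hh
      · rintro ⟨h, s⟩ hs j
        obtain rfl : s = _ := hs
        exact hbound _ le_rfl j
      · rintro s t ⟨h, hh, rfl⟩ ⟨hS, rfl⟩
        have := inputAt_eq_rightEnd.1 hS
        simp only at this
        obtain rfl : h = w.length + 1 := by omega
        rfl
    · have hb : ∀ s : ℕ × (ι → ℕ), (s.2 = fun j => (w.length + 1) * l.count j) →
          AtMost (w.length + 1) s := by
        rintro ⟨h, s⟩ hs j
        obtain rfl : s = _ := hs
        exact hbound _ le_rfl j
      refine Hoare.star (Hoare.atom hb hb ?_) hb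
      rintro s t hs rfl
      exact hs
    · refine Hoare.atom ?_ ?_ ?_
      · rintro ⟨h, s⟩ hs j
        obtain rfl : s = _ := hs
        exact hbound _ le_rfl j
      · rintro s rfl
        exact hbound _ le_rfl
      · rintro ⟨h, s⟩ t hs ⟨hS, rfl⟩
        obtain rfl : s = _ := hs
        have := inputAt_eq_leftEnd.1 hS
        simp only at this
        rw [this]

theorem run_fill (l : List ι) :
    Run (CounterOp.sem w) (fill (Γ := Γ) l) (0, 0) (0, fun j => (w.length + 1) * l.count j) := by
  have h1 : ∀ h, h ≤ w.length + 1 → Run (CounterOp.sem w) (star (seq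
      (atom (.test {x : InputSymbol Γ | x ≠ .rightEnd})) (seq (incAll l) (atom (.move .right)))))
      (0, 0) (h, fun j => h * l.count j) := by
    intro h hh
    change Relation.ReflTransGen _ _ _
    induction h with
    | zero =>
      have : ((0, fun j => 0 * l.count j) : ℕ × (ι → ℕ)) = (0, 0) :=
        Prod.ext rfl (funext fun j => (by simp))
      rw [this]
    | succ h ih =>
      refine (ih (by omega)).tail ⟨_, ⟨fun hS => ?_, rfl⟩, _, (run_incAll l _ _).2 rfl, ?_⟩
      · have := inputAt_eq_rightEnd.1 hS
        simp only at this
        omega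
      · change (_, _) = (moveInput _ _ _, _)
        refine Prod.ext ?_ (funext fun j => ?_)
        · simp [moveInput, moveWork]
          omega
        · simp only
          ring
  have h2 : ∀ (c : ι → ℕ) h, h ≤ w.length + 1 →
      Run (CounterOp.sem w) (star (atom (.move .left))) (h, c) (0, c) := by
    intro c h hh
    change Relation.ReflTransGen _ _ _
    induction h with
    | zero => exact Relation.ReflTransGen.refl
    | succ h ih =>
      refine Relation.ReflTransGen.head ?_ (ih (by omega))
      change (_, _) = (moveInput _ _ _, _)
      simp [moveInput, moveWork]
      omega
  exact ⟨_, h1 _ le_rfl, _, ⟨inputAt_eq_rightEnd.2 (Nat.lt_succ_self _), rfl⟩,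
    _, h2 _ _ le_rfl, inputAt_eq_leftEnd.2 rfl, rfl⟩

end Fill

end CounterMachine

open CounterMachine RegProg in
/-- Languages accepted by register programs belong to NL. -/
theorem inNL_of_regProg {Γ : Type u} [Finite Γ] (p : RegProg (RegOp Γ)) (L : Language Γ)
    (hL : ∀ w, w ∈ L ↔ ∃ v, Run (RegOp.sem w) p (fun _ => 0) v) : InNL L := by
  refine ⟨inferInstance, ?_⟩
  obtain ⟨N, hN, hp⟩ := p.exists_below
  have : NeZero N := ⟨hN⟩
  -- All registers start at `0`, so exactly their complementary counters have to be filled.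
  let l : List (Cell N) := (List.finRange N).map fun i => .co i
  have hl : l.Nodup := (List.nodup_finRange N).map fun i j h => by simpa using h
  let P : RegProg (CounterOp Γ (Cell N)) := seq (fill l) (p.bind (gadget N))
  have := finite_pt P
  have himp : ∀ w : List Γ, Implements w (fun _ => 0)
      ((0, fun j => (w.length + 1) * l.count j) : ℕ × (Cell N → ℕ)) := by
    intro w
    refine ⟨rfl, fun i => ⟨Nat.zero_le _, ?_, ?_⟩, fun b => ?_⟩
    · have : l.count (.val i) = 0 := List.count_eq_zero.2 (by simp [l])
      simp [this]
    · have : l.count (.co i) = 1 := List.count_eq_one_of_mem hl (by simp [l])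
      simp [this]
    · have : l.count (.aux b) = 0 := List.count_eq_zero.2 (by simp [l])
      simp [this]
  have hsum : ∀ w : List Γ, ∑ j : Cell N, (w.length + 1) * l.count j =
      (w.length + 1) * N := by
    intro w
    have : ∀ l : List (Cell N), ∑ j, l.count j = l.length := by
      intro l
      induction l with
      | nil => simp
      | cons i l ih => simp [List.count_cons, Finset.sum_add_distrib, ih]
    rw [← Finset.mul_sum, this]
    simp [l]
  -- After the filling, the number of tokens between actions is `(w.length + 1) * N`; during the
  -- filling no counter exceeds `w.length + 1`. The factor `N + 1` covers both phases.
  obtain ⟨M, hM, hacc⟩ := exists_offlineNTM (Edge P) (src P) (tgt P) (N + 1) (by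
    intro w q s hr
    have hv := visits_of_reach _ hr
    have hpos : w.length + 1 ≤ (N + 1) * (w.length + 1) := Nat.le_mul_of_pos_left _ (by omega)
    have h1 : Hoare (CounterOp.sem w) (AtMost ((N + 1) * (w.length + 1))) _ P _ :=
      ((hoare_fill (w := w) l hl).weaken fun s hs j => (hs j).trans hpos).seq
        (((hoare_bind_gadget ((w.length + 1) * N) p).mono
        (P' := fun s => s = (0, fun j => (w.length + 1) * l.count j))
        (by rintro s rfl; exact hsum w) fun _ h => h).weaken fun s hs j => (hs j).trans
          (by nlinarith))
    exact (h1 _ rfl).2 _ _ hv)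
  refine ⟨M, hM, fun w => ?_⟩
  rw [hL, hacc]
  simp only [reach_tgt_iff]
  constructor
  · rintro ⟨v, hv⟩
    obtain ⟨s, hs, -⟩ := exists_run_bind_of_run exists_run_gadget_of_sem p hp _ _ (himp w) v hv
    exact ⟨s, _, run_fill l, hs⟩
  · rintro ⟨s, m, h1, h2⟩
    obtain rfl := (hoare_fill l hl _ rfl).1 _ h1
    obtain ⟨v, hv, -⟩ := exists_run_of_run_bind exists_sem_of_run_gadget p hp _ _ (himp w) s h2
    exact ⟨v, hv⟩

/-! ### Tools for register programs -/

namespace RegProg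

open Relation

variable {Γ : Type u} {w : List Γ}

/-- All registers hold positions on the tape of `w`. -/
def OnTape (w : List Γ) (v : ℕ → ℕ) : Prop := ∀ i, v i ≤ w.length + 1

theorem OnTape.update {v : ℕ → ℕ} (h : OnTape w v) {a : ℕ} (ha : a ≤ w.length + 1) (j : ℕ) :
    OnTape w (Function.update v j a) := by
  intro i
  by_cases hi : i = j
  · subst hi; simpa using ha
  · simpa [Function.update_of_ne hi] using h i

/-- Registers cannot leave the tape because `inc` is blocked at the right end. -/
theorem OnTape.run : ∀ {p : RegProg (RegOp Γ)} {v v' : ℕ → ℕ}, OnTape w v →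
    Run (RegOp.sem w) p v v' → OnTape w v'
  | atom (.inc i), v, v', h, hr => by
    obtain ⟨h1, rfl⟩ := hr
    exact h.update (by omega) i
  | atom (.dec i), v, v', h, hr => by
    obtain ⟨h1, rfl⟩ := hr
    exact h.update ((Nat.sub_le _ _).trans (h i)) i
  | atom (.letter i S), v, v', h, hr => by
    obtain ⟨h1, rfl⟩ := hr
    exact h
  | atom (.le i j), v, v', h, hr => by
    obtain ⟨h1, rfl⟩ := hr
    exact h
  | seq p q, v, v', h, ⟨m, h1, h2⟩ => (h.run h1).run h2
  | alt p q, v, v', h, hr => hr.elim (fun hr => h.run hr) (fun hr => h.run hr)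
  | star p, v, v', h, hr => by
    change ReflTransGen _ _ _ at hr
    induction hr with
    | refl => exact h
    | tail _ hr ih => exact ih.run hr

/-- Do nothing. -/
def skip : RegProg (RegOp Γ) := atom (.le 0 0)

theorem run_skip {v v' : ℕ → ℕ} : Run (RegOp.sem w) skip v v' ↔ v' = v :=
  ⟨fun h => h.2, fun h => ⟨le_rfl, h⟩⟩

/-- Set a register to an arbitrary position. -/
def guess (j : ℕ) : RegProg (RegOp Γ) := seq (star (atom (.dec j))) (star (atom (.inc j)))

theorem run_star_dec {j : ℕ} {v v' : ℕ → ℕ} : Run (RegOp.sem w) (star (atom (.dec j))) v v' ↔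
    ∃ a ≤ v j, v' = Function.update v j a := by
  constructor
  · intro hr
    change ReflTransGen _ _ _ at hr
    induction hr with
    | refl => exact ⟨v j, le_rfl, by simp⟩
    | tail _ hs ih =>
      obtain ⟨a, ha, rfl⟩ := ih
      obtain ⟨-, rfl⟩ := hs
      exact ⟨a - 1, by omega, by simp⟩
  · rintro ⟨a, ha, rfl⟩
    obtain ⟨d, hd⟩ := Nat.exists_eq_add_of_le ha
    change ReflTransGen _ _ _
    induction d generalizing a with
    | zero =>
      obtain rfl : a = v j := by omega
      rw [Function.update_eq_self]
    | succ d ih =>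
      refine (ih (a + 1) (by omega) (by omega)).tail ⟨by simp, by simp⟩

theorem run_star_inc {j : ℕ} {v v' : ℕ → ℕ} (h : OnTape w v) :
    Run (RegOp.sem w) (star (atom (.inc j))) v v' ↔
      ∃ a, v j ≤ a ∧ a ≤ w.length + 1 ∧ v' = Function.update v j a := by
  constructor
  · intro hr
    change ReflTransGen _ _ _ at hr
    induction hr with
    | refl => exact ⟨v j, le_rfl, h j, by simp⟩
    | tail _ hs ih =>
      obtain ⟨a, ha, hn, rfl⟩ := ih
      obtain ⟨hn', rfl⟩ := hs
      simp at hn'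
      exact ⟨a + 1, by omega, by omega, by simp⟩
  · rintro ⟨a, ha, hn, rfl⟩
    obtain ⟨d, rfl⟩ := Nat.exists_eq_add_of_le ha
    change ReflTransGen _ _ _
    induction d with
    | zero =>
      rw [Nat.add_zero, Function.update_eq_self]
    | succ d ih =>
      refine (ih (by omega) (by omega)).tail ⟨?_, ?_⟩
      · simp
        omega
      · simp
        rfl

theorem run_guess {j : ℕ} {v v' : ℕ → ℕ} (h : OnTape w v) : Run (RegOp.sem w) (guess j) v v' ↔
    ∃ a ≤ w.length + 1, v' = Function.update v j a := by
  constructor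
  · rintro ⟨m, h1, h2⟩
    obtain ⟨b, -, rfl⟩ := run_star_dec.1 h1
    obtain ⟨a, -, ha, rfl⟩ := (run_star_inc (h.run h1)).1 h2
    exact ⟨a, ha, by simp⟩
  · rintro ⟨a, ha, rfl⟩
    refine ⟨_, run_star_dec.2 ⟨0, Nat.zero_le _, rfl⟩,
      (run_star_inc (h.update (Nat.zero_le _) j)).2 ⟨a, by simp, ha, by simp⟩⟩

/-- Test whether two registers are equal. -/
def testEq (i j : ℕ) : RegProg (RegOp Γ) := seq (atom (.le i j)) (atom (.le j i))

theorem run_testEq {i j : ℕ} {v v' : ℕ → ℕ} :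
    Run (RegOp.sem w) (testEq i j) v v' ↔ v i = v j ∧ v' = v := by
  constructor
  · rintro ⟨m, ⟨h1, rfl⟩, h2, rfl⟩
    exact ⟨le_antisymm h1 h2, rfl⟩
  · rintro ⟨h, rfl⟩
    exact ⟨v', ⟨h.le, rfl⟩, h.ge, rfl⟩

/-- Copy register `i` to register `j`. -/
def copy (i j : ℕ) : RegProg (RegOp Γ) := seq (guess j) (testEq i j)

theorem run_copy {i j : ℕ} (hij : i ≠ j) {v v' : ℕ → ℕ} (h : OnTape w v) :
    Run (RegOp.sem w) (copy i j) v v' ↔ v' = Function.update v j (v i) := by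
  constructor
  · rintro ⟨m, h1, h2⟩
    obtain ⟨a, ha, rfl⟩ := (run_guess h).1 h1
    obtain ⟨h3, rfl⟩ := run_testEq.1 h2
    rw [Function.update_of_ne hij, Function.update_self] at h3
    rw [h3]
  · rintro rfl
    exact ⟨_, (run_guess h).2 ⟨v i, h i, rfl⟩, run_testEq.2 ⟨by simp [hij], rfl⟩⟩

/-- `v` with the registers `k, …, k + m - 1` replaced by those of `u`. -/
def splice (k m : ℕ) (u v : ℕ → ℕ) : ℕ → ℕ :=
  fun j => if k ≤ j ∧ j < k + m then u (j - k) else v j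

theorem splice_zero (k : ℕ) (u v : ℕ → ℕ) : splice k 0 u v = v := by
  funext j
  simp only [splice]
  rw [if_neg (by omega)]

theorem update_splice (k m : ℕ) (u v : ℕ → ℕ) (a : ℕ) :
    Function.update (splice k m u v) (k + m) a =
      splice k (m + 1) (Function.update u m a) v := by
  funext j
  by_cases hj : j = k + m
  · subst hj
    simp [splice]
  · rw [Function.update_of_ne hj]
    simp only [splice]
    by_cases h : k ≤ j ∧ j < k + m
    · rw [if_pos h, if_pos (by omega), Function.update_of_ne (by omega)]
    · rw [if_neg h, if_neg (by omega)]

theorem splice_below {k m i : ℕ} (h : i < k) (u v : ℕ → ℕ) : splice k m u v i = v i := by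
  simp only [splice]
  rw [if_neg (by omega)]

theorem splice_above {k m i : ℕ} (h : k + m ≤ i) (u v : ℕ → ℕ) : splice k m u v i = v i := by
  simp only [splice]
  rw [if_neg (by omega)]

theorem splice_at {k m i : ℕ} (h : i < m) (u v : ℕ → ℕ) : splice k m u v (k + i) = u i := by
  simp only [splice]
  rw [if_pos (by omega), Nat.add_sub_cancel_left]

theorem OnTape.splice {k m : ℕ} {u v : ℕ → ℕ} (hu : OnTape w u) (hv : OnTape w v) :
    OnTape w (splice k m u v) := by
  intro j
  simp only [RegProg.splice]
  split_ifs
  · exact hu _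
  · exact hv _

/-- Set the registers `k, …, k + m - 1` to arbitrary positions. -/
def guessAll (k : ℕ) : ℕ → RegProg (RegOp Γ)
  | 0 => skip
  | m + 1 => seq (guessAll k m) (guess (k + m))

theorem run_guessAll {k : ℕ} : ∀ {m : ℕ} {v v' : ℕ → ℕ}, OnTape w v →
    (Run (RegOp.sem w) (guessAll k m) v v' ↔ ∃ u, OnTape w u ∧ v' = splice k m u v)
  | 0, v, v', h => run_skip.trans
    ⟨fun h' => ⟨v, h, h'.trans (splice_zero _ _ _).symm⟩,
      fun ⟨_, _, h'⟩ => h'.trans (splice_zero _ _ _)⟩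
  | m + 1, v, v', h => by
    constructor
    · rintro ⟨x, h1, h2⟩
      obtain ⟨u, hu, rfl⟩ := (run_guessAll h).1 h1
      obtain ⟨a, ha, rfl⟩ := (run_guess (hu.splice h)).1 h2
      exact ⟨_, hu.update ha m, update_splice _ _ _ _ _⟩
    · rintro ⟨u, hu, rfl⟩
      refine ⟨_, (run_guessAll h).2 ⟨u, hu, rfl⟩, (run_guess (hu.splice h)).2 ⟨u m, hu m, ?_⟩⟩
      rw [update_splice, Function.update_eq_self]

/-- Copy the registers `g 0, …, g (m - 1)` to the registers `k, …, k + m - 1`. -/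
def copyAll (g : ℕ → ℕ) (k : ℕ) : ℕ → RegProg (RegOp Γ)
  | 0 => skip
  | m + 1 => seq (copyAll g k m) (copy (g m) (k + m))

/-- Sources outside the target block are not overwritten by earlier copies. Sources above the block
are needed when the next vertex of a path is moved down onto the current one. -/
theorem run_copyAll {g : ℕ → ℕ} {k : ℕ} : ∀ {m : ℕ}, (∀ i < m, g i < k ∨ k + m ≤ g i) →
    ∀ {v v' : ℕ → ℕ}, OnTape w v →
    (Run (RegOp.sem w) (copyAll g k m) v v' ↔ v' = splice k m (fun i => v (g i)) v)
  | 0, _, v, v', h => run_skip.trans (by rw [splice_zero])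
  | m + 1, hg, v, v', h => by
    have hg' : ∀ i < m, g i < k ∨ k + m ≤ g i := fun i hi =>
      (hg i (by omega)).imp id (fun h => by omega)
    have hm := hg m (by omega)
    have hon : OnTape w (splice k m (fun i => v (g i)) v) :=
      OnTape.splice (fun i => h (g i)) h
    have e : splice k m (fun i => v (g i)) v (g m) = v (g m) := by
      rcases hm with hm | hm
      · exact splice_below hm _ _
      · exact splice_above (by omega) _ _
    have e' : Function.update (splice k m (fun i => v (g i)) v) (k + m) (v (g m)) =
        splice k (m + 1) (fun i => v (g i)) v := by
      rw [update_splice]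
      congr 1
      funext i
      by_cases hi : i = m
      · subst hi; simp
      · simp [Function.update_of_ne hi]
    constructor
    · rintro ⟨x, h1, h2⟩
      obtain rfl := (run_copyAll hg' h).1 h1
      rw [(run_copy (by omega) hon).1 h2, e, e']
    · rintro rfl
      exact ⟨_, (run_copyAll hg' h).2 rfl, (run_copy (by omega) hon).2 (by rw [e, e'])⟩

/-- Test whether the registers `k, …, k + m - 1` equal the registers `l, …, l + m - 1`. -/
def testAll (k l : ℕ) : ℕ → RegProg (RegOp Γ)
  | 0 => skip
  | m + 1 => seq (testAll k l m) (testEq (k + m) (l + m))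

theorem run_testAll {k l : ℕ} : ∀ {m : ℕ} {v v' : ℕ → ℕ},
    Run (RegOp.sem w) (testAll k l m) v v' ↔ (∀ i < m, v (k + i) = v (l + i)) ∧ v' = v
  | 0, v, v' => run_skip.trans (by simp)
  | m + 1, v, v' => by
    constructor
    · rintro ⟨x, h1, h2⟩
      obtain ⟨h1, rfl⟩ := run_testAll.1 h1
      obtain ⟨h2, rfl⟩ := run_testEq.1 h2
      exact ⟨Nat.forall_lt_succ_right.2 ⟨h1, h2⟩, rfl⟩
    · rintro ⟨h, rfl⟩
      have h := Nat.forall_lt_succ_right.1 h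
      exact ⟨_, run_testAll.2 ⟨h.1, rfl⟩, run_testEq.2 ⟨h.2, rfl⟩⟩

/-- Renumber the registers of an action. -/
def shiftOp (k : ℕ) : RegOp Γ → RegOp Γ
  | .inc i => .inc (k + i)
  | .dec i => .dec (k + i)
  | .letter i S => .letter (k + i) S
  | .le i j => .le (k + i) (k + j)

/-- Renumber the registers of a program. -/
def shift (k : ℕ) (p : RegProg (RegOp Γ)) : RegProg (RegOp Γ) :=
  p.bind fun o => atom (shiftOp k o)

theorem forall_true {Op : Type*} : ∀ p : RegProg Op, p.Forall fun _ => True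
  | .atom _ => trivial
  | .seq p q => ⟨forall_true p, forall_true q⟩
  | .alt p q => ⟨forall_true p, forall_true q⟩
  | .star p => forall_true p

/-- `v` extends `u`, read from register `k` on, by the first `k` registers of `v₀`. -/
def Shifted (k : ℕ) (v₀ u v : ℕ → ℕ) : Prop :=
  (∀ i < k, v i = v₀ i) ∧ ∀ i, v (k + i) = u i

theorem Shifted.update {k : ℕ} {v₀ u v : ℕ → ℕ} (h : Shifted k v₀ u v) (i a : ℕ) :
    Shifted k v₀ (Function.update u i a) (Function.update v (k + i) a) := by
  refine ⟨fun j hj => ?_, fun j => ?_⟩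
  · rw [Function.update_of_ne (by omega), h.1 j hj]
  · by_cases hj : j = i
    · subst hj; simp
    · rw [Function.update_of_ne (by omega), Function.update_of_ne hj, h.2]

/-- `Shifted` contains a frame condition: a renumbered program leaves the registers below `k` alone,
so those of the caller survive a subroutine. -/
theorem exists_run_of_run_shift {k : ℕ} {p : RegProg (RegOp Γ)} {v v' : ℕ → ℕ}
    (h : Run (RegOp.sem w) (shift k p) v v') :
    ∃ u', Run (RegOp.sem w) p (fun i => v (k + i)) u' ∧ Shifted k v u' v' := by
  refine exists_run_of_run_bind (ok := fun _ => True) (rep := Shifted k v) ?_ p (forall_true p)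
    _ _ ⟨fun _ _ => rfl, fun _ => rfl⟩ v' h
  rintro (i | i | ⟨i, S⟩ | ⟨i, j⟩) - u x hu x' hr
  · obtain ⟨h1, rfl⟩ := hr
    rw [hu.2] at h1 ⊢
    exact ⟨_, ⟨h1, rfl⟩, hu.update _ _⟩
  · obtain ⟨h1, rfl⟩ := hr
    rw [hu.2] at h1 ⊢
    exact ⟨_, ⟨h1, rfl⟩, hu.update _ _⟩
  · obtain ⟨h1, rfl⟩ := hr
    rw [hu.2] at h1
    exact ⟨_, ⟨h1, rfl⟩, hu⟩
  · obtain ⟨h1, rfl⟩ := hr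
    rw [hu.2, hu.2] at h1
    exact ⟨_, ⟨h1, rfl⟩, hu⟩

theorem exists_run_shift_of_run {k : ℕ} {p : RegProg (RegOp Γ)} {v u' : ℕ → ℕ}
    (h : Run (RegOp.sem w) p (fun i => v (k + i)) u') :
    ∃ v', Run (RegOp.sem w) (shift k p) v v' := by
  refine (exists_run_bind_of_run (ok := fun _ => True) (rep := Shifted k v) ?_ p (forall_true p)
    _ v ⟨fun _ _ => rfl, fun _ => rfl⟩ u' h).imp fun _ h => h.1
  rintro (i | i | ⟨i, S⟩ | ⟨i, j⟩) - u x hu u' hr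
  · obtain ⟨h1, rfl⟩ := hr
    rw [← hu.2] at h1 ⊢
    exact ⟨_, ⟨h1, rfl⟩, hu.update _ _⟩
  · obtain ⟨h1, rfl⟩ := hr
    rw [← hu.2] at h1 ⊢
    exact ⟨_, ⟨h1, rfl⟩, hu.update _ _⟩
  · obtain ⟨h1, rfl⟩ := hr
    rw [← hu.2] at h1
    exact ⟨_, ⟨h1, rfl⟩, hu⟩
  · obtain ⟨h1, rfl⟩ := hr
    rw [← hu.2, ← hu.2] at h1
    exact ⟨_, ⟨h1, rfl⟩, hu⟩

end RegProg

/-! ### Definable predicates on tuples of positions -/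

/-- Types of tuples of natural numbers, read off from the first `size` registers. -/
class PosTuple (T : Type) where
  size : ℕ
  ofReg : (ℕ → ℕ) → T
  ofReg_eq_iff (v v' : ℕ → ℕ) : ofReg v = ofReg v' ↔ ∀ i < size, v i = v' i

namespace PosTuple

instance : PosTuple Unit where
  size := 0
  ofReg _ := ()
  ofReg_eq_iff _ _ := by simp

instance : PosTuple ℕ where
  size := 1
  ofReg v := v 0
  ofReg_eq_iff _ _ := by simp

instance {T U : Type} [PosTuple T] [PosTuple U] : PosTuple (T × U) where
  size := size T + size U
  ofReg v := (ofReg v, ofReg fun i => v (size T + i))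
  ofReg_eq_iff v v' := by
    rw [Prod.mk.injEq, ofReg_eq_iff, ofReg_eq_iff]
    refine ⟨fun h i hi => ?_, fun h => ⟨fun i hi => h i (by omega), fun i hi => h _ (by omega)⟩⟩
    by_cases h' : i < size T
    · exact h.1 i h'
    · obtain ⟨j, rfl⟩ := Nat.exists_eq_add_of_le (not_lt.1 h')
      exact h.2 j (by omega)

/-- Functions that select and rearrange coordinates. -/
@[fun_prop]
def IsPos {T U : Type} [PosTuple T] [PosTuple U] (f : T → U) : Prop :=
  ∃ g : ℕ → ℕ, (∀ i < size U, g i < size T) ∧ ∀ v, f (ofReg v) = ofReg fun i => v (g i)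

section

variable {T U S : Type} [PosTuple T] [PosTuple U] [PosTuple S]

@[fun_prop]
theorem IsPos.id : IsPos fun x : T => x := ⟨fun i => i, fun _ h => h, fun _ => rfl⟩

@[fun_prop]
theorem IsPos.comp {f : U → S} {g : T → U} (hf : IsPos f) (hg : IsPos g) :
    IsPos fun x => f (g x) := by
  obtain ⟨f', hf1, hf2⟩ := hf
  obtain ⟨g', hg1, hg2⟩ := hg
  exact ⟨fun i => g' (f' i), fun i hi => hg1 _ (hf1 i hi), fun v => by
    change f (g (ofReg v)) = _
    rw [hg2, hf2]⟩

@[fun_prop]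
theorem IsPos.fst {f : T → U × S} (hf : IsPos f) : IsPos fun x => (f x).1 :=
  IsPos.comp (f := fun x : U × S => x.1)
    ⟨fun i => i, fun _ h => h.trans_le (Nat.le_add_right _ _), fun _ => rfl⟩ hf

@[fun_prop]
theorem IsPos.snd {f : T → U × S} (hf : IsPos f) : IsPos fun x => (f x).2 :=
  IsPos.comp (f := fun x : U × S => x.2)
    ⟨fun i => size U + i, fun _ h => Nat.add_lt_add_left h _, fun _ => rfl⟩ hf

@[fun_prop]
theorem IsPos.prodMk {f : T → U} {g : T → S} (hf : IsPos f) (hg : IsPos g) :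
    IsPos fun x => (f x, g x) := by
  obtain ⟨f', hf1, hf2⟩ := hf
  obtain ⟨g', hg1, hg2⟩ := hg
  obtain ⟨G, hG1, hG2⟩ : ∃ G : ℕ → ℕ, (∀ i < size U, G i = f' i) ∧
      ∀ i, G (size U + i) = g' i :=
    ⟨fun i => if i < size U then f' i else g' (i - size U), fun i hi => if_pos hi, fun i => by
      simp⟩
  refine ⟨G, fun i hi => ?_, fun v => ?_⟩
  · change i < size U + size S at hi
    by_cases h : i < size U
    · rw [hG1 i h]
      exact hf1 i h
    · obtain ⟨j, rfl⟩ := Nat.exists_eq_add_of_le (not_lt.1 h)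
      rw [hG2]
      exact hg1 j (by omega)
  · change (f (ofReg v), g (ofReg v)) = _
    rw [hf2, hg2]
    refine Prod.ext ((ofReg_eq_iff _ _).2 fun i hi => ?_) ((ofReg_eq_iff _ _).2 fun i hi => ?_)
    · rw [hG1 i hi]
    · change v (g' i) = v (G (size U + i))
      rw [hG2]

end

end PosTuple

open PosTuple RegProg

/-- The tuple `t` consists of positions on the tape of `w`. -/
def TupleOnTape {Γ : Type u} {T : Type} [PosTuple T] (w : List Γ) (t : T) : Prop :=
  ∃ v, OnTape w v ∧ ofReg v = t

theorem tupleOnTape_nat {Γ : Type u} {w : List Γ} {a : ℕ} :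
    TupleOnTape w a ↔ a ≤ w.length + 1 :=
  ⟨fun ⟨_, hv, h⟩ => h ▸ hv 0, fun h => ⟨fun _ => a, fun _ => h, rfl⟩⟩

theorem tupleOnTape_prod {Γ : Type u} {T U : Type} [PosTuple T] [PosTuple U] {w : List Γ}
    {x : T × U} : TupleOnTape w x ↔ TupleOnTape w x.1 ∧ TupleOnTape w x.2 := by
  constructor
  · rintro ⟨v, hv, rfl⟩
    exact ⟨⟨v, hv, rfl⟩, ⟨_, fun i => hv (size T + i), rfl⟩⟩
  · rintro ⟨⟨v, hv, h1⟩, u, hu, h2⟩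
    refine ⟨splice (size T) (size U) u v, hu.splice hv, Prod.ext ?_ ?_⟩
    · rw [← h1]
      exact (ofReg_eq_iff _ _).2 fun i hi => splice_below hi _ _
    · rw [← h2]
      exact (ofReg_eq_iff _ _).2 fun i hi => splice_at hi _ _

/-- Predicates on words and tuples of positions that are recognized by register programs. -/
def Def {Γ : Type u} {T : Type} [PosTuple T] (P : List Γ → T → Prop) : Prop :=
  ∃ p : RegProg (RegOp Γ), ∀ w v, OnTape w v →
    (∀ v', Run (RegOp.sem w) p v v' → (∀ i < size T, v' i = v i) ∧ P w (ofReg v)) ∧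
    (P w (ofReg v) → ∃ v', Run (RegOp.sem w) p v v')

namespace Def

open Relation

variable {Γ : Type u} {T U S : Type} [PosTuple T] [PosTuple U] [PosTuple S]
  {P Q : List Γ → T → Prop}

theorem inNL [Finite Γ] {P : List Γ → Unit → Prop} (h : Def P) (L : Language Γ)
    (hL : ∀ w, w ∈ L ↔ P w ()) : InNL L := by
  obtain ⟨p, hp⟩ := h
  refine inNL_of_regProg p L fun w => ?_
  have := hp w (fun _ => 0) fun _ => Nat.zero_le _
  rw [hL]
  exact ⟨this.2, fun ⟨v, hv⟩ => (this.1 v hv).2⟩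

theorem of_iff (h : Def P) (hPQ : ∀ w t, TupleOnTape w t → (Q w t ↔ P w t)) : Def Q := by
  obtain ⟨p, hp⟩ := h
  refine ⟨p, fun w v hv => ?_⟩
  rw [hPQ w _ ⟨v, hv, rfl⟩]
  exact hp w v hv

theorem true : Def fun (_ : List Γ) (_ : T) => True :=
  ⟨skip, fun w v _ => ⟨fun v' h => ⟨fun i _ => by rw [run_skip.1 h], trivial⟩,
    fun _ => ⟨v, run_skip.2 rfl⟩⟩⟩

theorem false : Def fun (_ : List Γ) (_ : T) => False :=
  ⟨atom (.letter 0 ∅), fun _ _ _ => ⟨fun _ h => h.1.elim, False.elim⟩⟩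

/-- The programs can be run one after the other because the first preserves the input registers, and
the second must work for any contents of the scratch registers. -/
theorem and (hP : Def P) (hQ : Def Q) : Def fun w t => P w t ∧ Q w t := by
  obtain ⟨p, hp⟩ := hP
  obtain ⟨q, hq⟩ := hQ
  refine ⟨seq p q, fun w v hv => ⟨?_, ?_⟩⟩
  · rintro v' ⟨x, h1, h2⟩
    obtain ⟨h3, h4⟩ := (hp w v hv).1 x h1
    obtain ⟨h5, h6⟩ := (hq w x (hv.run h1)).1 v' h2
    refine ⟨fun i hi => (h5 i hi).trans (h3 i hi), h4, ?_⟩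
    rwa [(ofReg_eq_iff x v).2 h3] at h6
  · rintro ⟨h1, h2⟩
    obtain ⟨x, hx⟩ := (hp w v hv).2 h1
    obtain ⟨v', hv'⟩ := (hq w x (hv.run hx)).2
      (by rwa [(ofReg_eq_iff x v).2 ((hp w v hv).1 x hx).1])
    exact ⟨v', x, hx, hv'⟩

theorem or (hP : Def P) (hQ : Def Q) : Def fun w t => P w t ∨ Q w t := by
  obtain ⟨p, hp⟩ := hP
  obtain ⟨q, hq⟩ := hQ
  refine ⟨alt p q, fun w v hv => ⟨?_, ?_⟩⟩
  · rintro v' (h | h)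
    · exact ((hp w v hv).1 v' h).imp id Or.inl
    · exact ((hq w v hv).1 v' h).imp id Or.inr
  · rintro (h | h)
    · exact ((hp w v hv).2 h).imp fun _ => Or.inl
    · exact ((hq w v hv).2 h).imp fun _ => Or.inr

/-- The coordinates of `f t` are copied behind those of `t` and the program for `P` runs on the
copies. This leaves `t` itself intact. -/
theorem comp {P : List Γ → U → Prop} (hP : Def P) {f : T → U} (hf : IsPos f) :
    Def fun w t => P w (f t) := by
  obtain ⟨p, hp⟩ := hP
  obtain ⟨g, hg, hfg⟩ := hf
  refine ⟨seq (copyAll g (size T) (size U)) (shift (size T) p), fun w v hv => ?_⟩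
  have hx := fun x => run_copyAll (w := w) (g := g) (k := size T) (m := size U)
    (fun i hi => Or.inl (hg i hi)) (v' := x) hv
  have hon : OnTape w (splice (size T) (size U) (fun i => v (g i)) v) :=
    OnTape.splice (fun i => hv (g i)) hv
  have e : ofReg (fun i => splice (size T) (size U) (fun i => v (g i)) v (size T + i)) =
      f (ofReg v) := by
    rw [hfg]
    exact (ofReg_eq_iff _ _).2 fun i hi => splice_at hi _ _
  have := hp w (fun i => splice (size T) (size U) (fun i => v (g i)) v (size T + i))
    fun i => hon _
  rw [e] at this
  constructor
  · rintro v' ⟨x, h1, h2⟩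
    obtain rfl := (hx x).1 h1
    obtain ⟨u, hu, hs⟩ := exists_run_of_run_shift h2
    exact ⟨fun i hi => (hs.1 i hi).trans (splice_below hi _ _), (this.1 u hu).2⟩
  · intro h
    obtain ⟨u, hu⟩ := this.2 h
    obtain ⟨v', hv'⟩ := exists_run_shift_of_run hu
    exact ⟨v', _, (hx _).2 rfl, hv'⟩

theorem exTuple {R : List Γ → T → U → Prop} (h : Def fun w (x : T × U) => R w x.1 x.2) :
    Def fun w t => ∃ u, TupleOnTape w u ∧ R w t u := by
  obtain ⟨p, hp⟩ := h
  refine ⟨seq (guessAll (size T) (size U)) p, fun w v hv => ⟨?_, ?_⟩⟩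
  · rintro v' ⟨x, h1, h2⟩
    obtain ⟨u, hu, rfl⟩ := (run_guessAll hv).1 h1
    obtain ⟨h3, h4⟩ := (hp w _ (hu.splice hv)).1 v' h2
    refine ⟨fun i hi => (h3 i (hi.trans_le (Nat.le_add_right _ _))).trans (splice_below hi _ _),
      ofReg u, ⟨u, hu, rfl⟩, ?_⟩
    change R w (ofReg _) (ofReg fun i => _) at h4
    rwa [(ofReg_eq_iff _ v).2 fun i hi => splice_below hi _ _,
      (ofReg_eq_iff _ u).2 fun i hi => splice_at hi _ _] at h4
  · rintro ⟨_, ⟨u, hu, rfl⟩, hR⟩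
    obtain ⟨v', hv'⟩ := (hp w _ (hu.splice (k := size T) (m := size U) hv)).2 (by
      change R w (ofReg _) (ofReg fun i => _)
      rwa [(ofReg_eq_iff _ v).2 fun i hi => splice_below hi _ _,
        (ofReg_eq_iff _ u).2 fun i hi => splice_at hi _ _])
    exact ⟨v', _, (run_guessAll hv).2 ⟨u, hu, rfl⟩, hv'⟩

theorem ex {R : List Γ → T → ℕ → Prop} (h : Def fun w (x : T × ℕ) => R w x.1 x.2) :
    Def fun w t => ∃ a ≤ w.length + 1, R w t a :=
  h.exTuple.of_iff fun w t _ => by simp only [tupleOnTape_nat]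

/-- No complementation is involved: the program for `R` is rerun for every position in turn, and all
these runs must succeed. -/
theorem all {R : List Γ → T → ℕ → Prop} (h : Def fun w (x : T × ℕ) => R w x.1 x.2) :
    Def fun w t => ∀ a ≤ w.length + 1, R w t a := by
  obtain ⟨p, hp⟩ := h
  let k := size T
  have hp : ∀ w x, OnTape w x → (∀ x', Run (RegOp.sem w) p x x' → (∀ i < k + 1, x' i = x i) ∧
      R w (ofReg x) (x k)) ∧ (R w (ofReg x) (x k) → ∃ x', Run (RegOp.sem w) p x x') := hp
  -- The test for the left end makes the loop start at `0`, and the test for the right end makes it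
  -- complete. The last call of `p` stands outside the loop because `inc` is blocked at the right
  -- end.
  refine ⟨seq (star (atom (.dec k))) (seq (atom (.letter k {.leftEnd}))
    (seq (star (seq p (atom (.inc k)))) (seq p (atom (.letter k {.rightEnd}))))),
    fun w v hv => ⟨?_, ?_⟩⟩
  · rintro v' ⟨x, h1, x', ⟨h2, rfl⟩, y, h3, z, h4, h5, rfl⟩
    obtain ⟨a, -, rfl⟩ := run_star_dec.1 h1
    have h2 := OfflineNTM.inputAt_eq_leftEnd.1 h2
    have key : OnTape w y ∧ (∀ i < k, y i = v i) ∧ ∀ b < y k, R w (ofReg v) b := by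
      clear h4
      change ReflTransGen _ _ _ at h3
      induction h3 with
      | refl =>
        refine ⟨hv.run h1, fun i hi => by rw [Function.update_of_ne (by omega)], ?_⟩
        rw [h2]
        intro b hb
        exact absurd hb (Nat.not_lt_zero b)
      | tail _ hs ih =>
        obtain ⟨i1, i2, i3⟩ := ih
        obtain ⟨m, hs1, hs2, rfl⟩ := hs
        obtain ⟨h6, h7⟩ := (hp w _ i1).1 m hs1
        refine ⟨(i1.run hs1).update (by omega) k, fun i hi => ?_, ?_⟩
        · rw [Function.update_of_ne (by omega), h6 i (by omega), i2 i hi]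
        · rw [Function.update_self, h6 k (by omega)]
          intro b hb
          rcases Nat.lt_succ_iff_lt_or_eq.1 hb with hb | rfl
          · exact i3 b hb
          · rwa [(ofReg_eq_iff _ v).2 i2] at h7
    obtain ⟨i1, i2, i3⟩ := key
    obtain ⟨h6, h7⟩ := (hp w _ i1).1 v' h4
    have h5 := OfflineNTM.inputAt_eq_rightEnd.1 h5
    rw [h6 k (by omega)] at h5
    refine ⟨fun i hi => (h6 i (by omega)).trans (i2 i hi), fun b hb => ?_⟩
    rcases lt_or_eq_of_le hb with hb | hb
    · exact i3 b (by omega)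
    · have : y k = b := by have := i1 k; omega
      rwa [(ofReg_eq_iff _ v).2 i2, this] at h7
  · intro hall
    have h1 : Run (RegOp.sem w) (star (atom (.dec k))) v (Function.update v k 0) :=
      run_star_dec.2 ⟨0, Nat.zero_le _, rfl⟩
    have key : ∀ a ≤ w.length + 1, ∃ y, OnTape w y ∧ (∀ i < k, y i = v i) ∧ y k = a ∧
        Run (RegOp.sem w) (star (seq p (atom (.inc k)))) (Function.update v k 0) y := by
      intro a
      induction a with
      | zero =>
        intro _
        exact ⟨_, hv.run h1, fun i hi => by rw [Function.update_of_ne (by omega)],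
          Function.update_self _ _ _, ReflTransGen.refl⟩
      | succ a ih =>
        intro ha
        obtain ⟨y, i1, i2, rfl, i3⟩ := ih (by omega)
        obtain ⟨m, hm⟩ := (hp w y i1).2 (by
          rw [(ofReg_eq_iff _ v).2 i2]
          exact hall _ (by omega))
        obtain ⟨h6, -⟩ := (hp w y i1).1 m hm
        refine ⟨Function.update m k (m k + 1), (i1.run hm).update ?_ k, fun i hi => ?_, ?_,
          ReflTransGen.tail i3 ⟨m, hm, ?_, rfl⟩⟩
        · rw [h6 k (by omega)]
          exact ha
        · rw [Function.update_of_ne (by omega), h6 i (by omega), i2 i hi]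
        · rw [Function.update_self, h6 k (by omega)]
        · rw [h6 k (by omega)]
          omega
    obtain ⟨y, i1, i2, i3, i4⟩ := key _ le_rfl
    obtain ⟨m, hm⟩ := (hp w y i1).2 (by
      rw [(ofReg_eq_iff _ v).2 i2]
      exact hall _ (by omega))
    obtain ⟨h6, -⟩ := (hp w y i1).1 m hm
    refine ⟨m, _, h1, _, ⟨OfflineNTM.inputAt_eq_leftEnd.2 (Function.update_self _ _ _), rfl⟩, y, i4,
      m, hm, OfflineNTM.inputAt_eq_rightEnd.2 ?_, rfl⟩
    rw [h6 k (by omega), i3]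
    omega

/-- Reachability by steps within the tape. -/
theorem reach {R : List Γ → T → S → S → Prop}
    (h : Def fun w (x : T × S × S) => R w x.1 x.2.1 x.2.2) {f g : T → S} (hf : IsPos f)
    (hg : IsPos g) :
    Def fun w t => ReflTransGen (fun a b => TupleOnTape w b ∧ R w t a b) (f t) (g t) := by
  suffices h' : Def fun w (x : T × S × S) =>
      ReflTransGen (fun a b => TupleOnTape w b ∧ R w x.1 a b) x.2.1 x.2.2 from
    h'.comp (f := fun t => (t, f t, g t)) (by fun_prop)
  obtain ⟨p, hp⟩ := h.comp (T := (T × S × S) × S × S)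
    (f := fun y => (y.1.1, y.2.1, y.2.2)) (by fun_prop)
  let k := size T
  let m := size S
  -- Layout: the registers below `K` hold the parameter, the start and the goal; the block at `K`
  -- holds the current vertex; the block at `K + m` holds the guessed next vertex.
  let K := k + (m + m)
  have hp : ∀ w x, OnTape w x →
      (∀ x', Run (RegOp.sem w) p x x' → (∀ i < K + (m + m), x' i = x i) ∧
        R w (ofReg x) (ofReg fun i => x (K + i)) (ofReg fun i => x (K + (m + i)))) ∧
      (R w (ofReg x) (ofReg fun i => x (K + i)) (ofReg fun i => x (K + (m + i))) →
        ∃ x', Run (RegOp.sem w) p x x') := hp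
  let body : RegProg (RegOp Γ) :=
    seq (guessAll (K + m) m) (seq p (copyAll (fun i => K + m + i) K m))
  refine ⟨seq (copyAll (fun i => k + i) K m) (seq (star body) (testAll K (k + m) m)),
    fun w v hv => ?_⟩
  change (∀ v' : ℕ → ℕ, _ → (∀ i < K, v' i = v i) ∧ ReflTransGen (fun a b => TupleOnTape w b ∧
    R w (ofReg v) a b) (ofReg fun i => v (k + i)) (ofReg fun i => v (k + (m + i)))) ∧
    (ReflTransGen (fun a b => TupleOnTape w b ∧
    R w (ofReg v) a b) (ofReg fun i => v (k + i)) (ofReg fun i => v (k + (m + i))) → _)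
  have hcopy := fun x => run_copyAll (w := w) (g := fun i => k + i) (k := K) (m := m)
    (fun i hi => Or.inl (by omega)) (v' := x) hv
  have hback := fun x x' => run_copyAll (w := w) (g := fun i => K + m + i) (k := K) (m := m)
    (fun i hi => Or.inr (by omega)) (v := x) (v' := x')
  set v₁ := splice K m (fun i => v (k + i)) v with hv₁
  have hon₁ : OnTape w v₁ := OnTape.splice (fun i => hv (k + i)) hv
  have e₁ : (ofReg fun i => v₁ (K + i) : S) = ofReg fun i => v (k + i) :=
    (ofReg_eq_iff _ _).2 fun i hi => splice_at hi _ _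
  have hbody : ∀ x x', OnTape w x → (∀ i < K, x i = v i) → Run (RegOp.sem w) body x x' →
      (∀ i < K, x' i = v i) ∧ R w (ofReg v) (ofReg fun i => x (K + i))
        (ofReg fun i => x' (K + i)) := by
    rintro x x' hx hxv ⟨y, h1, z, h2, h3⟩
    obtain ⟨u, hu, rfl⟩ := (run_guessAll hx).1 h1
    have hy := hu.splice (k := K + m) (m := m) hx
    obtain ⟨h4, h5⟩ := (hp w _ hy).1 z h2
    obtain rfl := (hback z x' (hy.run h2)).1 h3
    refine ⟨fun i hi => ?_, ?_⟩
    · rw [splice_below hi, h4 i (by omega), splice_below (by omega), hxv i hi]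
    · rw [(ofReg_eq_iff _ v).2 fun i hi => by rw [splice_below (by omega), hxv i (by omega)],
        (ofReg_eq_iff (T := S) _ fun i => x (K + i)).2 fun i hi => splice_below (by omega) _ _] at h5
      convert h5 using 1
      refine (ofReg_eq_iff _ _).2 fun i hi => ?_
      rw [splice_at hi, h4 _ (by omega), Nat.add_assoc K m i]
  have hbody' : ∀ x (b : S), OnTape w x → (∀ i < K, x i = v i) → TupleOnTape w b →
      R w (ofReg v) (ofReg fun i => x (K + i)) b →
      ∃ x', Run (RegOp.sem w) body x x' ∧ (ofReg fun i => x' (K + i)) = b := by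
    rintro x b hx hxv ⟨u, hu, rfl⟩ hR
    have hy := hu.splice (k := K + m) (m := m) hx
    have hu' : (ofReg (fun i => splice (K + m) m u x (K + (m + i))) : S) = ofReg u :=
      (ofReg_eq_iff _ _).2 fun i hi => by rw [← add_assoc, splice_at hi]
    obtain ⟨z, hz⟩ := (hp w _ hy).2 (by
      rw [(ofReg_eq_iff _ v).2 fun i hi => by rw [splice_below (by omega), hxv i (by omega)],
        (ofReg_eq_iff (T := S) _ fun i => x (K + i)).2 fun i hi => splice_below (by omega) _ _,
        hu']
      exact hR)
    obtain ⟨h4, -⟩ := (hp w _ hy).1 z hz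
    refine ⟨_, ⟨_, (run_guessAll hx).2 ⟨u, hu, rfl⟩, z, hz, (hback z _ (hy.run hz)).2 rfl⟩, ?_⟩
    rw [← hu']
    refine (ofReg_eq_iff _ _).2 fun i hi => ?_
    rw [splice_at hi, h4 _ (by omega), Nat.add_assoc K m i]
  constructor
  · rintro v' ⟨x, h1, y, h2, h3⟩
    obtain rfl := (hcopy x).1 h1
    obtain ⟨h4, rfl⟩ := run_testAll.1 h3
    have key : OnTape w v' ∧ (∀ i < K, v' i = v i) ∧
        ReflTransGen (fun a b => TupleOnTape w b ∧ R w (ofReg v) a b)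
          (ofReg fun i => v (k + i)) (ofReg fun i => v' (K + i)) := by
      change ReflTransGen _ _ _ at h2
      clear h3 h4
      induction h2 with
      | refl =>
        refine ⟨hon₁, fun i hi => splice_below hi _ _, ?_⟩
        rw [← e₁]
      | tail _ hs ih =>
        obtain ⟨i1, i2, i3⟩ := ih
        obtain ⟨h5, h6⟩ := hbody _ _ i1 i2 hs
        have := i1.run hs
        exact ⟨this, h5, i3.tail ⟨⟨_, fun i => this (K + i), rfl⟩, h6⟩⟩
    obtain ⟨-, i2, i3⟩ := key
    refine ⟨i2, ?_⟩
    have e : (ofReg (fun i => v' (K + i)) : S) = ofReg fun i => v (k + (m + i)) :=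
      (ofReg_eq_iff _ _).2 fun i hi => by
        rw [h4 i hi, Nat.add_assoc k m i, i2 _ (by change k + (m + i) < k + (m + m); omega)]
    rwa [e] at i3
  · intro hr
    have key : ∀ c : S, ReflTransGen (fun a b => TupleOnTape w b ∧ R w (ofReg v) a b)
        (ofReg fun i => v (k + i)) c → ∃ y, OnTape w y ∧ (∀ i < K, y i = v i) ∧
          (ofReg fun i => y (K + i)) = c ∧ Run (RegOp.sem w) (star body) v₁ y := by
      intro c hc
      induction hc with
      | refl => exact ⟨v₁, hon₁, fun i hi => splice_below hi _ _, e₁, ReflTransGen.refl⟩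
      | tail _ hs ih =>
        obtain ⟨y, i1, i2, rfl, i4⟩ := ih
        obtain ⟨y', h4, h5⟩ := hbody' y _ i1 i2 hs.1 hs.2
        exact ⟨y', i1.run h4, (hbody _ _ i1 i2 h4).1, h5, ReflTransGen.tail i4 h4⟩
    obtain ⟨y, -, i2, i3, i4⟩ := key _ hr
    refine ⟨y, v₁, (hcopy _).2 rfl, y, i4, run_testAll.2 ⟨fun i hi => ?_, rfl⟩⟩
    rw [(ofReg_eq_iff _ _).1 i3 i hi, Nat.add_assoc k m i, i2 _ (by omega)]

end Def

open PosTuple RegProg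

/-! ### Predicates definable together with their negations -/

/-- Both `P` and its negation are recognized by register programs. -/
def BiDef {Γ : Type u} {T : Type} [PosTuple T] (P : List Γ → T → Prop) : Prop :=
  Def P ∧ Def fun w t => ¬ P w t

section Primitives

variable {Γ : Type u} {T U : Type} [PosTuple T] [PosTuple U]

namespace Def

theorem letter (S : Set (InputSymbol Γ)) {f : T → ℕ} (hf : IsPos f) :
    Def fun w t => OfflineNTM.inputAt w (f t) ∈ S :=
  Def.comp (P := fun w (x : ℕ) => OfflineNTM.inputAt w x ∈ S)
    ⟨atom (.letter 0 S), fun _ v _ => ⟨fun _ h => ⟨fun _ _ => by rw [h.2], h.1⟩,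
      fun h => ⟨v, h, rfl⟩⟩⟩ hf

theorem le {f g : T → ℕ} (hf : IsPos f) (hg : IsPos g) : Def fun (_ : List Γ) t => f t ≤ g t :=
  Def.comp (P := fun (_ : List Γ) (x : ℕ × ℕ) => x.1 ≤ x.2) (f := fun t => (f t, g t))
    ⟨atom (.le 0 1), fun _ v _ => ⟨fun _ h => ⟨fun _ _ => by rw [h.2], h.1⟩,
      fun h => ⟨v, h, rfl⟩⟩⟩ (by fun_prop)

/-- This is the negation of a comparison by `≤`, which nondeterministic programs do not provide for
free. The successor is computed in scratch register `2`; it fits on the tape as long as the smaller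
position is not the right end. -/
theorem lt {f g : T → ℕ} (hf : IsPos f) (hg : IsPos g) : Def fun (_ : List Γ) t => f t < g t := by
  refine Def.comp (P := fun (_ : List Γ) (x : ℕ × ℕ) => x.1 < x.2) (f := fun t => (f t, g t))
    ⟨seq (copy 0 2) (seq (atom (.inc 2)) (atom (.le 2 1))), fun w v hv => ⟨?_, ?_⟩⟩ (by fun_prop)
  · rintro v' ⟨x, h1, y, ⟨h2, rfl⟩, h3, rfl⟩
    obtain rfl := (run_copy (by norm_num) hv).1 h1
    simp only [Function.update_self, Function.update_idem] at h2 h3 ⊢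
    rw [Function.update_of_ne (by norm_num)] at h3
    refine ⟨fun i hi => ?_, h3⟩
    change i < 2 at hi
    rw [Function.update_of_ne (by omega)]
  · intro h
    change v 0 < v 1 at h
    have := hv 1
    refine ⟨_, _, (run_copy (by norm_num) hv).2 rfl, _, ⟨?_, rfl⟩, ?_, rfl⟩
    · rw [Function.update_self]
      omega
    · rw [Function.update_idem, Function.update_self, Function.update_self,
        Function.update_of_ne (by norm_num)]
      exact h

end Def

namespace BiDef

variable {P Q : List Γ → T → Prop}

theorem of_iff (h : BiDef P) (hPQ : ∀ w t, TupleOnTape w t → (Q w t ↔ P w t)) : BiDef Q :=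
  ⟨h.1.of_iff hPQ, h.2.of_iff fun w t ht => not_congr (hPQ w t ht)⟩

theorem not (h : BiDef P) : BiDef fun w t => ¬ P w t :=
  ⟨h.2, h.1.of_iff fun _ _ _ => not_not⟩

theorem and (hP : BiDef P) (hQ : BiDef Q) : BiDef fun w t => P w t ∧ Q w t :=
  ⟨hP.1.and hQ.1, (hP.2.or hQ.2).of_iff fun _ _ _ => not_and_or⟩

theorem or (hP : BiDef P) (hQ : BiDef Q) : BiDef fun w t => P w t ∨ Q w t :=
  ⟨hP.1.or hQ.1, (hP.2.and hQ.2).of_iff fun _ _ _ => not_or⟩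

theorem imp (hP : BiDef P) (hQ : BiDef Q) : BiDef fun w t => P w t → Q w t :=
  (hP.not.or hQ).of_iff fun _ _ _ => imp_iff_not_or

theorem ex {R : List Γ → T → ℕ → Prop} (h : BiDef fun w (x : T × ℕ) => R w x.1 x.2) :
    BiDef fun w t => ∃ a ≤ w.length + 1, R w t a :=
  ⟨h.1.ex, (Def.all (R := fun w t a => ¬ R w t a) h.2).of_iff fun _ _ _ => by simp⟩

theorem all {R : List Γ → T → ℕ → Prop} (h : BiDef fun w (x : T × ℕ) => R w x.1 x.2) :
    BiDef fun w t => ∀ a ≤ w.length + 1, R w t a :=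
  ⟨h.1.all, (Def.ex (R := fun w t a => ¬ R w t a) h.2).of_iff fun _ _ _ => by simp⟩

theorem const (p : Prop) : BiDef fun (_ : List Γ) (_ : T) => p := by
  by_cases hp : p
  · exact ⟨Def.true.of_iff fun _ _ _ => by simp [hp], Def.false.of_iff fun _ _ _ => by simp [hp]⟩
  · exact ⟨Def.false.of_iff fun _ _ _ => by simp [hp], Def.true.of_iff fun _ _ _ => by simp [hp]⟩

theorem forall_fin : ∀ {n : ℕ} {P : Fin n → List Γ → T → Prop}, (∀ i, BiDef (P i)) →
    BiDef fun w t => ∀ i, P i w t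
  | 0, _, _ => (const True).of_iff fun _ _ _ => by simp
  | n + 1, P, h => ((h 0).and (forall_fin fun i => h i.succ)).of_iff fun _ _ _ => Fin.forall_fin_succ

theorem forall_finite {I : Type*} [Finite I] {P : I → List Γ → T → Prop}
    (h : ∀ i, BiDef (P i)) : BiDef fun w t => ∀ i, P i w t := by
  obtain ⟨n, ⟨e⟩⟩ := Finite.exists_equiv_fin I
  exact (forall_fin fun i => h (e.symm i)).of_iff fun _ _ _ => e.symm.forall_congr_right.symm

theorem exists_finite {I : Type*} [Finite I] {P : I → List Γ → T → Prop}
    (h : ∀ i, BiDef (P i)) : BiDef fun w t => ∃ i, P i w t :=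
  (forall_finite fun i => (h i).not).not.of_iff fun _ _ _ => by simp

theorem comp {P : List Γ → U → Prop} (hP : BiDef P) {f : T → U} (hf : IsPos f) :
    BiDef fun w t => P w (f t) :=
  ⟨hP.1.comp hf, hP.2.comp hf⟩

theorem letter (S : Set (InputSymbol Γ)) {f : T → ℕ} (hf : IsPos f) :
    BiDef fun w t => OfflineNTM.inputAt w (f t) ∈ S :=
  ⟨Def.letter S hf, (Def.letter Sᶜ hf).of_iff fun _ _ _ => Iff.rfl⟩

theorem le {f g : T → ℕ} (hf : IsPos f) (hg : IsPos g) :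
    BiDef fun (_ : List Γ) t => f t ≤ g t :=
  ⟨Def.le hf hg, (Def.lt hg hf).of_iff fun _ _ _ => not_le⟩

theorem lt {f g : T → ℕ} (hf : IsPos f) (hg : IsPos g) :
    BiDef fun (_ : List Γ) t => f t < g t :=
  ⟨Def.lt hf hg, (Def.le hg hf).of_iff fun _ _ _ => not_lt⟩

theorem eq {f g : T → ℕ} (hf : IsPos f) (hg : IsPos g) :
    BiDef fun (_ : List Γ) t => f t = g t :=
  ((le hf hg).and (le hg hf)).of_iff fun _ _ _ => le_antisymm_iff

/-- Adjacency is expressed by the order alone: no tape position lies strictly between. The point `f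
t + 1` can be tested because `f t < g t` and `g t`, being a coordinate of `t`, is on the tape. -/
theorem succ {f g : T → ℕ} (hf : IsPos f) (hg : IsPos g) :
    BiDef fun (_ : List Γ) t => f t + 1 = g t := by
  refine ((lt hf hg).and (BiDef.all (R := fun _ t z => z ≤ f t ∨ g t ≤ z)
    ((le (by fun_prop) (by fun_prop)).or (le (by fun_prop) (by fun_prop))))).of_iff
    fun w t ht => ⟨fun h => ⟨by omega, fun z _ => by omega⟩, fun ⟨h1, h2⟩ => ?_⟩
  by_contra hne
  have hle : g t ≤ w.length + 1 := by
    obtain ⟨v, hv, rfl⟩ := ht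
    obtain ⟨g', -, hg'⟩ := hg
    rw [hg']
    exact hv _
  rcases h2 (f t + 1) (by omega) with h | h <;> omega

theorem isZero {f : T → ℕ} (hf : IsPos f) : BiDef fun (_ : List Γ) t => f t = 0 :=
  (letter {.leftEnd} hf).of_iff fun _ _ _ => OfflineNTM.inputAt_eq_leftEnd.symm

theorem leLength {f : T → ℕ} (hf : IsPos f) : BiDef fun (w : List Γ) t => f t ≤ w.length :=
  (letter {.rightEnd} hf).not.of_iff fun _ _ _ =>
    (not_lt.symm).trans (not_congr OfflineNTM.inputAt_eq_rightEnd.symm)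

end BiDef

end Primitives

/-! ### Nonreachability by inductive counting -/

section Counting

open Relation

/-- `v` is reached from `a` by at most `k` steps of `r` through `0, …, n`. -/
def Within (n : ℕ) (r : ℕ → ℕ → Prop) (a : ℕ) : ℕ → ℕ → Prop
  | 0, v => v = a
  | k + 1, v => v ≤ n ∧ ∃ u, Within n r a k u ∧ (r u v ∨ u = v)

variable {n : ℕ} {r : ℕ → ℕ → Prop} {a : ℕ}

theorem Within.le (ha : a ≤ n) : ∀ {k v : ℕ}, Within n r a k v → v ≤ n
  | 0, _, h => h ▸ ha
  | _ + 1, _, h => h.1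

theorem Within.succ (ha : a ≤ n) {k v : ℕ} (h : Within n r a k v) : Within n r a (k + 1) v :=
  ⟨h.le ha, v, h, Or.inr rfl⟩

theorem Within.reach : ∀ {k v : ℕ}, Within n r a k v →
    ReflTransGen (fun x y => y ≤ n ∧ r x y) a v
  | 0, _, h => by rw [show _ = a from h]
  | _ + 1, _, ⟨hv, _, hu, hr⟩ => by
    rcases hr with hr | rfl
    · exact hu.reach.tail ⟨hv, hr⟩
    · exact hu.reach

/-- The number of `x < N` with `p x`. -/
noncomputable def countBelow (p : ℕ → Prop) (N : ℕ) : ℕ := {x | x < N ∧ p x}.ncard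

theorem finite_below (p : ℕ → Prop) (N : ℕ) : {x | x < N ∧ p x}.Finite :=
  (Set.finite_lt_nat N).subset fun _ h => h.1

theorem countBelow_zero (p : ℕ → Prop) : countBelow p 0 = 0 := by
  simp [countBelow]

theorem countBelow_succ_pos {p : ℕ → Prop} {N : ℕ} (h : p N) :
    countBelow p (N + 1) = countBelow p N + 1 := by
  rw [countBelow, countBelow, ← Set.ncard_insert_of_notMem (a := N) (by simp) (finite_below p N)]
  congr 1
  ext x
  simp only [Set.mem_insert_iff, Set.mem_ofPred_eq]
  constructor
  · rintro ⟨h1, h2⟩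
    rcases Nat.lt_succ_iff_lt_or_eq.1 h1 with h1 | h1
    · exact Or.inr ⟨h1, h2⟩
    · exact Or.inl h1
  · rintro (rfl | ⟨h1, h2⟩)
    · exact ⟨Nat.lt_succ_self _, h⟩
    · exact ⟨by omega, h2⟩

theorem countBelow_succ_neg {p : ℕ → Prop} {N : ℕ} (h : ¬ p N) :
    countBelow p (N + 1) = countBelow p N := by
  rw [countBelow, countBelow]
  congr 1
  ext x
  simp only [Set.mem_ofPred_eq]
  refine and_congr_left fun hx => ⟨fun h1 => ?_, fun h1 => by omega⟩
  rcases Nat.lt_succ_iff_lt_or_eq.1 h1 with h1 | rfl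
  · exact h1
  · exact absurd hx h

theorem countBelow_le_succ (p : ℕ → Prop) (N : ℕ) : countBelow p N ≤ countBelow p (N + 1) :=
  Set.ncard_le_ncard (fun _ hx => ⟨Nat.lt_succ_of_lt hx.1, hx.2⟩) (finite_below p (N + 1))

theorem countBelow_le (p : ℕ → Prop) (N : ℕ) : countBelow p N ≤ N := by
  induction N with
  | zero => rw [countBelow_zero]
  | succ N ih =>
    by_cases h : p N
    · rw [countBelow_succ_pos h]
      omega
    · rw [countBelow_succ_neg h]
      omega

theorem countBelow_mono {p q : ℕ → Prop} {N : ℕ} (h : ∀ x < N, p x → q x) :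
    countBelow p N ≤ countBelow q N :=
  Set.ncard_le_ncard (fun x hx => ⟨hx.1, h x hx.1 hx.2⟩) (finite_below q N)

theorem of_countBelow_le {p q : ℕ → Prop} {N : ℕ} (h : ∀ x < N, p x → q x)
    (hc : countBelow q N ≤ countBelow p N) : ∀ x < N, q x → p x := by
  have := Set.eq_of_subset_of_ncard_le (s := {x | x < N ∧ p x}) (t := {x | x < N ∧ q x})
    (fun x hx => ⟨hx.1, h x hx.1 hx.2⟩) hc (finite_below q N)
  intro x hx hq
  have hmem : x ∈ {x | x < N ∧ q x} := ⟨hx, hq⟩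
  rw [← this] at hmem
  exact hmem.2

/-- The number of vertices reached by at most `k` steps. -/
noncomputable def withinCount (n : ℕ) (r : ℕ → ℕ → Prop) (a k : ℕ) : ℕ :=
  countBelow (Within n r a k) (n + 1)

theorem withinCount_zero (ha : a ≤ n) : withinCount n r a 0 = 1 := by
  rw [withinCount, countBelow, Set.ncard_eq_one]
  refine ⟨a, ?_⟩
  ext x
  exact ⟨fun h => h.2, fun h => ⟨by rw [show x = a from h]; omega, h⟩⟩

/-- If the count does not grow in a round, neither does the set, and a set that repeats once repeats
forever. Otherwise every round has added a vertex. -/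
theorem within_stable_or (ha : a ≤ n) : ∀ k, (∀ v, Within n r a (k + 1) v → Within n r a k v) ∨
    k + 1 ≤ withinCount n r a k
  | 0 => Or.inr (withinCount_zero ha).ge
  | k + 1 => by
    rcases within_stable_or ha k with h | h
    · exact Or.inl fun v ⟨hv, u, hu, hr⟩ => ⟨hv, u, h u hu, hr⟩
    · by_cases hc : withinCount n r a (k + 1) ≤ withinCount n r a k
      · have := of_countBelow_le (fun x _ hx => hx.succ ha) hc
        have : ∀ v, Within n r a (k + 1) v → Within n r a k v := fun v hv =>
          this v (Nat.lt_succ_of_le (hv.le ha)) hv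
        exact Or.inl fun v ⟨hv, u, hu, hr⟩ => ⟨hv, u, this u hu, hr⟩
      · right
        omega

/-- There are only `n + 1` vertices, so growth must have stopped by round `n + 1`. -/
theorem within_iff_reach (ha : a ≤ n) {v : ℕ} :
    Within n r a (n + 1) v ↔ ReflTransGen (fun x y => y ≤ n ∧ r x y) a v := by
  refine ⟨Within.reach, fun h => ?_⟩
  have hst : ∀ v, Within n r a (n + 1 + 1) v → Within n r a (n + 1) v := by
    refine (within_stable_or ha (n + 1)).resolve_right fun h => ?_
    have := countBelow_le (Within n r a (n + 1)) (n + 1)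
    rw [withinCount] at h
    omega
  have hz : ∀ k, Within n r a k a := fun k => by
    induction k with
    | zero => exact rfl
    | succ k ih => exact ih.succ ha
  induction h with
  | refl => exact hz _
  | tail _ hs ih => exact hst _ ⟨hs.1, _, ih, Or.inl hs.2⟩

/-- One step of a loop that counts the numbers satisfying `P`, where passing over a number
requires `Q`. -/
def CountStep (P Q : ℕ → Prop) (x y : ℕ × ℕ) : Prop :=
  x.1 + 1 = y.1 ∧ ((x.2 + 1 = y.2 ∧ P x.1) ∨ (x.2 = y.2 ∧ Q x.1))

/-- The loop can count up to `c`. -/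
def CanCount (n : ℕ) (P Q : ℕ → Prop) (c : ℕ) : Prop :=
  ReflTransGen (fun x y : ℕ × ℕ => (y.1 ≤ n + 1 ∧ y.2 ≤ n + 1) ∧ CountStep P Q x y)
    (0, 0) (n + 1, c)

variable {P Q : ℕ → Prop} {c : ℕ}

/-- A counted number satisfies `P` and none is visited twice, so wrong guesses can undercount but
never overcount. -/
theorem CanCount.le_count (h : CanCount n P Q c) : c ≤ countBelow P (n + 1) := by
  have : ∀ x : ℕ × ℕ, ReflTransGen (fun x y : ℕ × ℕ => (y.1 ≤ n + 1 ∧ y.2 ≤ n + 1) ∧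
      CountStep P Q x y) (0, 0) x → x.2 ≤ countBelow P x.1 := by
    intro x hx
    induction hx with
    | refl => simp [countBelow_zero]
    | tail _ hs ih =>
      obtain ⟨-, h1, h2⟩ := hs
      rw [← h1]
      rcases h2 with ⟨h2, h3⟩ | ⟨h2, -⟩
      · rw [countBelow_succ_pos h3]
        omega
      · exact h2 ▸ ih.trans (countBelow_le_succ _ _)
  exact this _ h

/-- If `Q` certifies the failure of `P`, no number satisfying `P` can be passed over. -/
theorem CanCount.count_le (h : CanCount n P Q c) (hQ : ∀ x ≤ n, Q x → ¬ P x) :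
    countBelow P (n + 1) ≤ c := by
  have : ∀ x : ℕ × ℕ, ReflTransGen (fun x y : ℕ × ℕ => (y.1 ≤ n + 1 ∧ y.2 ≤ n + 1) ∧
      CountStep P Q x y) (0, 0) x → countBelow P x.1 ≤ x.2 := by
    intro x hx
    induction hx with
    | refl => simp [countBelow_zero]
    | tail _ hs ih =>
      obtain ⟨⟨h0, -⟩, h1, h2⟩ := hs
      rw [← h1]
      rcases h2 with ⟨h2, h3⟩ | ⟨h2, h3⟩
      · rw [countBelow_succ_pos h3]
        omega
      · rw [countBelow_succ_neg (hQ _ (by omega) h3)]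
        omega
  exact this _ h

theorem canCount_count (hQ : ∀ x ≤ n, ¬ P x → Q x) : CanCount n P Q (countBelow P (n + 1)) := by
  have : ∀ m ≤ n + 1, ReflTransGen (fun x y : ℕ × ℕ => (y.1 ≤ n + 1 ∧ y.2 ≤ n + 1) ∧
      CountStep P Q x y) (0, 0) (m, countBelow P m) := by
    intro m
    induction m with
    | zero => intro _; rw [countBelow_zero]
    | succ m ih =>
      intro hm
      refine (ih (by omega)).tail ⟨⟨hm, (countBelow_le _ _).trans hm⟩, rfl, ?_⟩
      by_cases h : P m
      · rw [countBelow_succ_pos h]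
        exact Or.inl ⟨rfl, h⟩
      · rw [countBelow_succ_neg h]
        exact Or.inr ⟨rfl, hQ m (by omega) h⟩
  exact this _ le_rfl

/-- Every vertex that `u` counts as reached is different from `v` and not adjacent to it. -/
def Avoids (n : ℕ) (r : ℕ → ℕ → Prop) (a k c v : ℕ) : Prop :=
  CanCount n (fun x => Within n r a k x ∧ ¬ (r x v ∨ x = v)) (fun _ => True) c

/-- The core of inductive counting: if the number of vertices within `k` steps is known, then
exhibiting that many such vertices exhibits all of them. If none of these equals `v` or has an edge
to it, then `v` is certified to be missing in the next round. -/
theorem avoids_iff (ha : a ≤ n) {k v : ℕ} (hv : v ≤ n) :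
    Avoids n r a k (withinCount n r a k) v ↔ ¬ Within n r a (k + 1) v := by
  constructor
  · rintro h ⟨-, u, hu, hr⟩
    have h1 := CanCount.le_count h
    have h2 := of_countBelow_le (fun x _ hx => hx.1) h1 u (Nat.lt_succ_of_le (hu.le ha)) hu
    exact h2.2 hr
  · intro h
    have h1 : withinCount n r a k =
        countBelow (fun x => Within n r a k x ∧ ¬ (r x v ∨ x = v)) (n + 1) :=
      le_antisymm (countBelow_mono fun x _ hx => ⟨hx, fun hr => h ⟨hv, x, hx, hr⟩⟩)
        (countBelow_mono fun x _ hx => hx.1)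
    rw [Avoids, h1]
    exact canCount_count fun _ _ _ => trivial

/-- One round of inductive counting. -/
def NextCount (n : ℕ) (r : ℕ → ℕ → Prop) (a : ℕ) (x y : ℕ × ℕ) : Prop :=
  x.1 + 1 = y.1 ∧ CanCount n (fun v => ∃ u ≤ n + 1, Within n r a x.1 u ∧ (r u v ∨ u = v))
    (Avoids n r a x.1 x.2) y.2

/-- Given the right count for one round, membership and nonmembership in the next round both have
certificates. The loop can therefore finish only with the right count. -/
theorem canCount_next_iff (ha : a ≤ n) {k c : ℕ} :
    CanCount n (fun v => ∃ u ≤ n + 1, Within n r a k u ∧ (r u v ∨ u = v))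
      (Avoids n r a k (withinCount n r a k)) c ↔ c = withinCount n r a (k + 1) := by
  have hP : ∀ v ≤ n, (∃ u ≤ n + 1, Within n r a k u ∧ (r u v ∨ u = v)) ↔
      Within n r a (k + 1) v := fun v hv =>
    ⟨fun ⟨u, _, hu⟩ => ⟨hv, u, hu⟩, fun ⟨_, u, hu⟩ => ⟨u, (hu.1.le ha).trans (by omega), hu⟩⟩
  have hc : countBelow (fun v => ∃ u ≤ n + 1, Within n r a k u ∧ (r u v ∨ u = v)) (n + 1) =
      withinCount n r a (k + 1) :=
    le_antisymm (countBelow_mono fun x hx => (hP x (Nat.le_of_lt_succ hx)).1)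
      (countBelow_mono fun x hx => (hP x (Nat.le_of_lt_succ hx)).2)
  constructor
  · intro h
    refine le_antisymm (h.le_count.trans hc.le) (hc.ge.trans (h.count_le ?_))
    intro x hx hQ
    rw [hP x hx]
    exact (avoids_iff ha hx).1 hQ
  · rintro rfl
    rw [← hc]
    refine canCount_count fun x hx h => (avoids_iff ha hx).2 ?_
    rwa [hP x hx] at h

theorem reach_nextCount_iff (ha : a ≤ n) {c : ℕ} :
    ReflTransGen (fun x y : ℕ × ℕ => (y.1 ≤ n + 1 ∧ y.2 ≤ n + 1) ∧ NextCount n r a x y)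
      (0, 1) (n + 1, c) ↔ c = withinCount n r a (n + 1) := by
  constructor
  · intro h
    have : ∀ x : ℕ × ℕ, ReflTransGen (fun x y : ℕ × ℕ => (y.1 ≤ n + 1 ∧ y.2 ≤ n + 1) ∧
        NextCount n r a x y) (0, 1) x → x.2 = withinCount n r a x.1 := by
      intro x hx
      induction hx with
      | refl => exact (withinCount_zero ha).symm
      | tail _ hs ih =>
        obtain ⟨-, h1, h2⟩ := hs
        rw [ih] at h2
        rw [← h1]
        exact (canCount_next_iff ha).1 h2
    exact this _ h
  · rintro rfl
    have : ∀ m ≤ n + 1, ReflTransGen (fun x y : ℕ × ℕ => (y.1 ≤ n + 1 ∧ y.2 ≤ n + 1) ∧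
        NextCount n r a x y) (0, 1) (m, withinCount n r a m) := by
      intro m
      induction m with
      | zero => intro _; rw [withinCount_zero ha]
      | succ m ih =>
        intro hm
        exact (ih (by omega)).tail ⟨⟨hm, countBelow_le _ _⟩, rfl, (canCount_next_iff ha).2 rfl⟩
    exact this _ le_rfl

end Counting

/-! ### Definability of nonreachability -/

section Immerman

open Relation

variable {Γ : Type u} {T U : Type} [PosTuple T] [PosTuple U]

theorem Def.canCount {P Q : List Γ → T → ℕ → Prop} (hP : Def fun w (x : T × ℕ) => P w x.1 x.2)
    (hQ : Def fun w (x : T × ℕ) => Q w x.1 x.2) {c : T → ℕ} (hc : IsPos c) :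
    Def fun w t => CanCount w.length (P w t) (Q w t) (c t) := by
  have hstep : Def fun w (x : T × (ℕ × ℕ) × (ℕ × ℕ)) => CountStep (P w x.1) (Q w x.1) x.2.1 x.2.2 :=
    (BiDef.succ (by fun_prop) (by fun_prop)).1.and
      (((BiDef.succ (by fun_prop) (by fun_prop)).1.and
        (hP.comp (f := fun x : T × (ℕ × ℕ) × (ℕ × ℕ) => (x.1, x.2.1.1)) (by fun_prop))).or
      ((BiDef.eq (by fun_prop) (by fun_prop)).1.and
        (hQ.comp (f := fun x : T × (ℕ × ℕ) × (ℕ × ℕ) => (x.1, x.2.1.1)) (by fun_prop))))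
  have hreach : Def fun w (x : (T × ℕ) × ℕ) => ReflTransGen (fun a b : ℕ × ℕ => TupleOnTape w b ∧
      CountStep (P w x.1.1) (Q w x.1.1) a b) (x.1.2, x.1.2) (x.2, c x.1.1) :=
    Def.reach (R := fun w (x : (T × ℕ) × ℕ) => CountStep (P w x.1.1) (Q w x.1.1))
      (hstep.comp (f := fun y : ((T × ℕ) × ℕ) × (ℕ × ℕ) × (ℕ × ℕ) => (y.1.1.1, y.2))
        (by fun_prop)) (by fun_prop) (by fun_prop)
  -- The endpoints `0` and `w.length + 1` are not coordinates of `t`, so they are guessed and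
  -- checked.
  refine (Def.ex (R := fun w t z => z = 0 ∧ ∃ m ≤ w.length + 1, ¬ m ≤ w.length ∧
    ReflTransGen (fun a b : ℕ × ℕ => TupleOnTape w b ∧ CountStep (P w t) (Q w t) a b)
      (z, z) (m, c t)) ((BiDef.isZero (by fun_prop)).1.and
        (Def.ex ((BiDef.leLength (by fun_prop)).2.and hreach)))).of_iff fun w t _ => ?_
  simp only [tupleOnTape_prod, tupleOnTape_nat, CanCount]
  constructor
  · intro h
    exact ⟨0, Nat.zero_le _, rfl, w.length + 1, le_rfl, by omega, h⟩
  · rintro ⟨_, -, rfl, m, h1, h2, h⟩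
    obtain rfl : m = w.length + 1 := by omega
    exact h

variable {R : List Γ → T → ℕ → ℕ → Prop}

theorem Def.within (hR : Def fun w (x : T × ℕ × ℕ) => R w x.1 x.2.1 x.2.2) {τ : U → T}
    {a k v : U → ℕ} (hτ : IsPos τ) (ha : IsPos a) (hk : IsPos k) (hv : IsPos v) :
    Def fun w u => Within w.length (R w (τ u)) (a u) (k u) (v u) := by
  -- The walk carries the number of steps as a second coordinate, and pausing counts as a step, as
  -- in `Within`.
  let step : List Γ → T → ℕ × ℕ → ℕ × ℕ → Prop := fun w t x y =>
    y.1 ≤ w.length ∧ x.2 + 1 = y.2 ∧ (R w t x.1 y.1 ∨ x.1 = y.1)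
  have hstep : Def fun w (x : T × (ℕ × ℕ) × (ℕ × ℕ)) => step w x.1 x.2.1 x.2.2 :=
    (BiDef.leLength (by fun_prop)).1.and ((BiDef.succ (by fun_prop) (by fun_prop)).1.and
      ((hR.comp (f := fun x : T × (ℕ × ℕ) × (ℕ × ℕ) => (x.1, x.2.1.1, x.2.2.1)) (by fun_prop)).or
        (BiDef.eq (by fun_prop) (by fun_prop)).1))
  have hreach : Def fun w (x : U × ℕ) => ReflTransGen (fun a b : ℕ × ℕ => TupleOnTape w b ∧
      step w (τ x.1) a b) (a x.1, x.2) (v x.1, k x.1) :=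
    Def.reach (R := fun w (x : U × ℕ) => step w (τ x.1))
      (hstep.comp (f := fun y : (U × ℕ) × (ℕ × ℕ) × (ℕ × ℕ) => (τ y.1.1, y.2))
        (by fun_prop)) (by fun_prop) (by fun_prop)
  refine (Def.ex (R := fun w u z => z = 0 ∧ ReflTransGen (fun a b : ℕ × ℕ => TupleOnTape w b ∧
      step w (τ u) a b) (a u, z) (v u, k u))
    ((BiDef.isZero (by fun_prop)).1.and hreach)).of_iff fun w u hu => ?_
  have hkn : k u ≤ w.length + 1 := by
    obtain ⟨x, hx, rfl⟩ := hu
    obtain ⟨k', -, hk'⟩ := hk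
    rw [hk']
    exact hx _
  simp only [tupleOnTape_prod, tupleOnTape_nat]
  have key : ∀ x : ℕ × ℕ, x.2 ≤ w.length + 1 → (ReflTransGen (fun a b : ℕ × ℕ =>
      (b.1 ≤ w.length + 1 ∧ b.2 ≤ w.length + 1) ∧ step w (τ u) a b) (a u, 0) x ↔
      Within w.length (R w (τ u)) (a u) x.2 x.1) := by
    rintro ⟨y, i⟩ hi
    constructor
    · intro h
      clear hi
      generalize hx : (y, i) = x at h
      induction h generalizing y i with
      | refl =>
        cases hx
        exact rfl
      | @tail b c _ hs ih =>
        obtain ⟨-, h1, h2, h3⟩ := hs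
        subst hx
        simp only at h1 h2 h3
        subst h2
        exact ⟨h1, b.1, ih b.1 b.2 rfl, h3⟩
    · intro h
      simp only at hi h
      induction i generalizing y with
      | zero =>
        obtain rfl : y = a u := h
        exact ReflTransGen.refl
      | succ i ih =>
        obtain ⟨h1, x, h2, h3⟩ := h
        exact (ih x (by omega) h2).tail ⟨⟨by simp only; omega, hi⟩, h1, rfl, h3⟩
  constructor
  · intro h
    exact ⟨0, Nat.zero_le _, rfl, (key (v u, k u) hkn).2 h⟩
  · rintro ⟨_, -, rfl, h⟩
    exact (key (v u, k u) hkn).1 h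

/-- Nonadjacency is tested for each counted vertex; this is why `R` must be definable together with
its negation. -/
theorem Def.avoids (hR : BiDef fun w (x : T × ℕ × ℕ) => R w x.1 x.2.1 x.2.2) {τ : U → T}
    {a k c v : U → ℕ} (hτ : IsPos τ) (ha : IsPos a) (hk : IsPos k) (hc : IsPos c)
    (hv : IsPos v) : Def fun w u => Avoids w.length (R w (τ u)) (a u) (k u) (c u) (v u) := by
  refine Def.canCount (P := fun w u x => Within w.length (R w (τ u)) (a u) (k u) x ∧
    ¬ (R w (τ u) x (v u) ∨ x = v u)) (Q := fun _ _ _ => True) ?_ Def.true hc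
  exact (Def.within (U := U × ℕ) hR.1 (by fun_prop) (by fun_prop) (by fun_prop)
    (by fun_prop)).and ((hR.comp (f := fun x : U × ℕ => (τ x.1, x.2, v x.1)) (by fun_prop)).or
      (BiDef.eq (by fun_prop) (by fun_prop))).2

theorem Def.nextCount (hR : BiDef fun w (x : T × ℕ × ℕ) => R w x.1 x.2.1 x.2.2) {τ : U → T}
    {a : U → ℕ} {x y : U → ℕ × ℕ} (hτ : IsPos τ) (ha : IsPos a) (hx : IsPos x) (hy : IsPos y) :
    Def fun w u => NextCount w.length (R w (τ u)) (a u) (x u) (y u) := by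
  refine (BiDef.succ (by fun_prop) (by fun_prop)).1.and (Def.canCount
    (P := fun w t v => ∃ u ≤ w.length + 1, Within w.length (R w (τ t)) (a t) (x t).1 u ∧
      (R w (τ t) u v ∨ u = v))
    (Q := fun w t => Avoids w.length (R w (τ t)) (a t) (x t).1 (x t).2) ?_ ?_ (by fun_prop))
  · refine Def.ex ((Def.within (U := (U × ℕ) × ℕ) hR.1 (by fun_prop) (by fun_prop) (by fun_prop)
      (by fun_prop)).and ?_)
    exact (hR.1.comp (f := fun z : (U × ℕ) × ℕ => (τ z.1.1, z.2, z.1.2)) (by fun_prop)).or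
      (BiDef.eq (by fun_prop) (by fun_prop)).1
  · exact Def.avoids (U := U × ℕ) hR (by fun_prop) (by fun_prop) (by fun_prop) (by fun_prop)
      (by fun_prop)

/-- Reachability between cells of the input is definable together with its negation. -/
theorem BiDef.reach (hR : BiDef fun w (x : T × ℕ × ℕ) => R w x.1 x.2.1 x.2.2) :
    BiDef fun w (x : T × ℕ × ℕ) => x.2.1 ≤ w.length ∧ x.2.2 ≤ w.length ∧
      ReflTransGen (fun a b => b ≤ w.length ∧ R w x.1 a b) x.2.1 x.2.2 := by
  refine ⟨?_, ?_⟩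
  · refine (BiDef.leLength (by fun_prop)).1.and ((BiDef.leLength (by fun_prop)).1.and ?_)
    refine (Def.reach (R := fun w (x : T × ℕ × ℕ) a b => b ≤ w.length ∧ R w x.1 a b)
      ((BiDef.leLength (by fun_prop)).1.and
        (hR.1.comp (f := fun y : (T × ℕ × ℕ) × ℕ × ℕ => (y.1.1, y.2)) (by fun_prop)))
      (f := fun x => x.2.1) (g := fun x => x.2.2) (by fun_prop) (by fun_prop)).of_iff
      fun w x _ => ?_
    have : (fun a b => TupleOnTape w b ∧ b ≤ w.length ∧ R w x.1 a b) =
        fun a b => b ≤ w.length ∧ R w x.1 a b := by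
      funext a b
      rw [tupleOnTape_nat, ← and_assoc]
      congr 1
      exact propext ⟨And.right, fun h => ⟨by omega, h⟩⟩
    rw [this]
  · have hnext : Def fun w (x : (((T × ℕ × ℕ) × ℕ) × ℕ) × ℕ × ℕ) =>
        ReflTransGen (fun a b : ℕ × ℕ => TupleOnTape w b ∧
          NextCount w.length (R w x.1.1.1.1) x.1.1.1.2.1 a b) (x.1.1.2, x.1.2) (x.2.1, x.2.2) :=
      Def.reach (R := fun w (x : (((T × ℕ × ℕ) × ℕ) × ℕ) × ℕ × ℕ) =>
          NextCount w.length (R w x.1.1.1.1) x.1.1.1.2.1)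
        (Def.nextCount hR (by fun_prop) (by fun_prop) (by fun_prop) (by fun_prop))
        (by fun_prop) (by fun_prop)
    have hfin : Def fun w (x : T × ℕ × ℕ) => ∃ z ≤ w.length + 1, z = 0 ∧ ∃ o ≤ w.length + 1,
        z + 1 = o ∧ ∃ m ≤ w.length + 1, ¬ m ≤ w.length ∧ ∃ c ≤ w.length + 1,
          ReflTransGen (fun a b : ℕ × ℕ => TupleOnTape w b ∧
            NextCount w.length (R w x.1) x.2.1 a b) (z, o) (m, c) ∧
          Avoids w.length (R w x.1) x.2.1 m c x.2.2 := by
      refine Def.ex ((BiDef.isZero (by fun_prop)).1.and (Def.ex ((BiDef.succ (by fun_prop)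
        (by fun_prop)).1.and (Def.ex ((BiDef.leLength (by fun_prop)).2.and (Def.ex ?_))))))
      refine (hnext.comp (f := fun x : ((((T × ℕ × ℕ) × ℕ) × ℕ) × ℕ) × ℕ =>
        (x.1.1, x.1.2, x.2)) (by fun_prop)).and ?_
      exact Def.avoids hR (by fun_prop) (by fun_prop) (by fun_prop) (by fun_prop) (by fun_prop)
    have h1 : BiDef fun (w : List Γ) (x : T × ℕ × ℕ) => x.2.1 ≤ w.length :=
      BiDef.leLength (by fun_prop)
    have h2 : BiDef fun (w : List Γ) (x : T × ℕ × ℕ) => x.2.2 ≤ w.length :=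
      BiDef.leLength (by fun_prop)
    refine (h1.2.or (h2.2.or hfin)).of_iff fun w x _ => ?_
    by_cases ha : x.2.1 ≤ w.length
    · by_cases hb : x.2.2 ≤ w.length
      · simp only [ha, hb, true_and, not_true, false_or]
        rw [← within_iff_reach ha]
        simp only [tupleOnTape_prod, tupleOnTape_nat]
        -- `Avoids` at round `m` decides membership in round `m + 1`. With `m = w.length + 1` this
        -- is one round more than necessary, and the sets are stable by then.
        have hiff : Within w.length (R w x.1) x.2.1 (w.length + 1) x.2.2 ↔
            Within w.length (R w x.1) x.2.1 (w.length + 1 + 1) x.2.2 :=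
          ⟨Within.succ ha, fun h => (within_iff_reach ha).2 h.reach⟩
        rw [hiff]
        constructor
        · intro h
          exact ⟨0, by omega, rfl, 1, by omega, rfl, w.length + 1, le_rfl, by omega, _,
            countBelow_le _ _, (reach_nextCount_iff ha).2 rfl, (avoids_iff ha hb).2 h⟩
        · rintro ⟨_, -, rfl, _, -, rfl, m, h3, h4, c, -, h5, h6⟩
          obtain rfl : m = w.length + 1 := by omega
          obtain rfl := (reach_nextCount_iff ha).1 h5
          exact (avoids_iff ha hb).1 h6
      · simp [hb]
    · simp [ha]

end Immerman

/-! ### A combinatorial criterion for truth -/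

namespace ConstraintLanguage

open Relation

section Play

variable {A : Type u} {B : ConstraintLanguage.{u, v} A}

/-- The equivalence of terms generated by the equality atoms. -/
def Eqv (T : List (Atom B)) : Term B → Term B → Prop :=
  ReflTransGen fun s t => Atom.eq s t ∈ T ∨ Atom.eq t s ∈ T

variable {T : List (Atom B)}

theorem Eqv.symm {s t : Term B} (h : Eqv T s t) : Eqv T t s := by
  induction h with
  | refl => exact .refl
  | tail _ h ih => exact ih.head h.symm

theorem Eqv.trans {s t r : Term B} (h : Eqv T s t) (h' : Eqv T t r) : Eqv T s r :=
  ReflTransGen.trans h h'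

theorem Eqv.eval_eq {σ : Var → A} (hσ : ∀ a ∈ T, a.Holds σ) {s t : Term B} (h : Eqv T s t) :
    s.eval σ = t.eval σ := by
  induction h with
  | refl => rfl
  | tail _ h ih =>
    rw [ih]
    rcases h with h | h
    · exact hσ _ h
    · exact (hσ _ h).symm

theorem HoldsFrom.of_append : ∀ {P Q : List (Quant × Var)} {s : Var → A}, [Nonempty A] →
    HoldsFrom T (P ++ Q) s → ∃ s', HoldsFrom T Q s'
  | [], _, s, _, h => ⟨s, h⟩
  | (Quant.all, _) :: _, _, _, _, h => HoldsFrom.of_append (h (Classical.arbitrary A))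
  | (Quant.ex, _) :: _, _, _, _, h => HoldsFrom.of_append h.choose_spec

/-- If a formula holds, then its atoms are satisfied by some play in which the universal variables
take prescribed values. -/
theorem HoldsFrom.exists_play (u : Var → A) : ∀ {Q : List (Quant × Var)} {s : Var → A},
    (Q.map Prod.snd).Nodup → HoldsFrom T Q s →
      ∃ σ : Var → A, (∀ a ∈ T, a.Holds σ) ∧ (∀ y, (Quant.all, y) ∈ Q → σ y = u y) ∧
        ∀ x ∉ Q.map Prod.snd, σ x = s x
  | [], s, _, h => ⟨s, h, by simp, fun _ _ => rfl⟩
  | (q, x) :: Q, s, hn, h => by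
    rw [List.map_cons, List.nodup_cons] at hn
    obtain ⟨a, ha, h'⟩ : ∃ a, (q = Quant.all → a = u x) ∧
        HoldsFrom T Q (Function.update s x a) := by
      cases q with
      | all => exact ⟨u x, fun _ => rfl, h (u x)⟩
      | ex =>
        obtain ⟨a, ha⟩ := h
        exact ⟨a, (nomatch ·), ha⟩
    obtain ⟨σ, h1, h2, h3⟩ := exists_play u hn.2 h'
    refine ⟨σ, h1, fun y hy => ?_, fun y hy => ?_⟩
    · rcases List.mem_cons.1 hy with hy | hy
      · obtain ⟨rfl, rfl⟩ := Prod.mk.inj hy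
        rw [h3 _ hn.1, Function.update_self, ha rfl]
      · exact h2 y hy
    · rw [List.map_cons, List.mem_cons, not_or] at hy
      rw [h3 _ hy.2, Function.update_of_ne hy.1]

end Play

/-! ### Truth for the relations `τ_k`: refutations and forced values -/

section Tau

variable {A : Type u} {α β : Set A} {K : Set ℕ} {C : Set A}

/-- The `j`-th argument of the `i`-th triple of arguments of `τ_k`. -/
def tripleIndex {k : ℕ} (i : Fin k) (j : Fin 3) : Fin (3 * k) := ⟨3 * i.1 + j.1, by omega⟩

theorem mem_tau {k : ℕ} {t : Fin (3 * k) → A} : t ∈ tau α β k ↔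
    ∃ i : Fin k, (∀ j, t (tripleIndex i j) ∈ α) ∨ ∀ j, t (tripleIndex i j) ∈ β := by
  simp only [Fin.forall_fin_succ]
  simp only [tau, RhoPrime, tripleIndex, Set.mem_ofPred_eq]
  simp

/-- A reduct of the language of the relations `τ_k`. -/
abbrev TauReduct (α β : Set A) (K : Set ℕ) (C : Set A) : ConstraintLanguage.{u, 0} A :=
  (tauLanguage α β).reduct K C

/-- The class of `t` contains a universal variable or a constant outside `S`. -/
def Avoidable (φ : PHFormula (TauReduct α β K C)) (S : Set A) (t : Term (TauReduct α β K C)) :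
    Prop :=
  (∃ a, a.1 ∉ S ∧ Eqv φ.atoms t (.const a)) ∨
    ∃ y, (Quant.all, y) ∈ φ.quants ∧ Eqv φ.atoms t (.var y)

/-- The universal player can falsify the atom `τ_k(ts)`: choose in each triple an argument to be
put outside `α` and one to be put outside `β`, without conflict. -/
def Refutable (φ : PHFormula (TauReduct α β K C)) {k : ℕ}
    (ts : Fin (3 * k) → Term (TauReduct α β K C)) : Prop :=
  ∃ J : Fin k → Fin 3 × Fin 3,
    (∀ i, Avoidable φ α (ts (tripleIndex i (J i).1)) ∧
      Avoidable φ β (ts (tripleIndex i (J i).2))) ∧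
    ∀ i i', ¬ Eqv φ.atoms (ts (tripleIndex i (J i).1)) (ts (tripleIndex i' (J i').2))

/-- The combinatorial criterion for truth. -/
structure Consistent (φ : PHFormula (TauReduct α β K C)) : Prop where
  const_univ : ∀ a y, (Quant.all, y) ∈ φ.quants → ¬ Eqv φ.atoms (.const a) (.var y)
  var_univ : ∀ P y Q, φ.quants = P ++ (Quant.all, y) :: Q → ∀ x ∈ P.map Prod.snd,
    ¬ Eqv φ.atoms (.var x) (.var y)
  const_const : ∀ a b, Eqv φ.atoms (.const a) (.const b) → a = b
  not_refutable : ∀ (r : K) ts, Atom.rel r ts ∈ φ.atoms → ¬ Refutable φ (k := r.1) ts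

variable {φ : PHFormula (TauReduct α β K C)}

/-- Each violation gives the universal player a winning reply. A universal variable tied to a
constant, or to a variable fixed earlier, is given a different value, which exists since `a` and `c`
differ. A refutable atom is falsified with elements outside `α` and outside `β`. -/
theorem Consistent.of_isTrue (hα : α ≠ Set.univ) (hβ : β ≠ Set.univ) (hmeet : (α ∩ β).Nonempty)
    (hs : φ.IsSentence) (h : φ.IsTrue) : Consistent φ := by
  obtain ⟨c, hcα, hcβ⟩ := hmeet
  obtain ⟨a, ha⟩ := (Set.ne_univ_iff_exists_notMem _).1 hα
  obtain ⟨b, hb⟩ := (Set.ne_univ_iff_exists_notMem _).1 hβ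
  have : Nonempty A := ⟨a⟩
  have : Nontrivial A := ⟨a, c, fun h => ha (h ▸ hcα)⟩
  have play := fun u => HoldsFrom.exists_play u hs.1 (h fun _ => a)
  refine ⟨fun d y hy he => ?_, fun P y Q hQ x hx he => ?_, fun d e he => ?_, ?_⟩
  · obtain ⟨a', ha'⟩ := exists_ne d.1
    obtain ⟨σ, h1, h2, -⟩ := play fun _ => a'
    exact ha' ((h2 y hy).symm.trans (he.eval_eq h1).symm)
  · have hn := hs.1
    have h' := h fun _ => a
    rw [hQ] at hn h'
    obtain ⟨s, h'⟩ := h'.of_append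
    rw [List.map_append, List.nodup_append] at hn
    obtain ⟨a', ha'⟩ := exists_ne (s x)
    obtain ⟨σ, h1, h2, h3⟩ := HoldsFrom.exists_play (fun _ => a') hn.2.1 h'
    have e1 := h2 y (by simp)
    have e2 := h3 x fun hx' => hn.2.2 _ hx _ hx' rfl
    exact ha' (e1.symm.trans ((he.eval_eq h1).symm.trans e2))
  · obtain ⟨σ, h1, -⟩ := play fun _ => a
    exact Subtype.ext (he.eval_eq h1)
  · rintro r ts hr ⟨J, hJ, hne⟩
    classical
    -- Universal variables equivalent to a choice for `α` are put outside `α` and all others outside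
    -- `β`. The second kind includes those equivalent to choices for `β`, because the two kinds of
    -- choices are never equivalent.
    obtain ⟨σ, h1, h2, -⟩ := play fun y =>
      if ∃ i, Eqv φ.atoms (.var y) (ts (tripleIndex i (J i).1)) then a else b
    obtain ⟨i, hi | hi⟩ := mem_tau.1 (h1 _ hr)
    · have hi := hi (J i).1
      rcases (hJ i).1 with ⟨d, hd, he⟩ | ⟨y, hy, he⟩
      · rw [he.eval_eq h1] at hi
        exact hd hi
      · rw [he.eval_eq h1, Term.eval, h2 y hy, if_pos ⟨i, he.symm⟩] at hi
        exact ha hi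
    · have hi := hi (J i).2
      rcases (hJ i).2 with ⟨d, hd, he⟩ | ⟨y, hy, he⟩
      · rw [he.eval_eq h1] at hi
        exact hd hi
      · rw [he.eval_eq h1, Term.eval, h2 y hy, if_neg ?_] at hi
        · exact hb hi
        · rintro ⟨i', he'⟩
          exact hne i' i (he.trans he').symm

open Classical in
/-- The value of a term in the play where the existential player assigns `c` to every variable
whose value is not forced by a constant or by the values `f` of the universal variables. -/
noncomputable def forcedValue (φ : PHFormula (TauReduct α β K C)) (c : A) (f : Var → A)
    (t : Term (TauReduct α β K C)) : A :=
  if h : ∃ a, Eqv φ.atoms t (.const a) then h.choose.1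
  else if h : ∃ y, (Quant.all, y) ∈ φ.quants ∧ Eqv φ.atoms t (.var y) then f h.choose else c

variable {c : A} {f : Var → A} {t s : Term (TauReduct α β K C)}

theorem forcedValue_cases (φ : PHFormula (TauReduct α β K C)) (c : A) (f : Var → A)
    (t : Term (TauReduct α β K C)) :
    (∃ a, Eqv φ.atoms t (.const a) ∧ forcedValue φ c f t = a.1) ∨
    (∃ y, (Quant.all, y) ∈ φ.quants ∧ Eqv φ.atoms t (.var y) ∧ forcedValue φ c f t = f y) ∨
    forcedValue φ c f t = c := by
  by_cases h : ∃ a, Eqv φ.atoms t (.const a)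
  · exact Or.inl ⟨_, h.choose_spec, dif_pos h⟩
  by_cases h' : ∃ y, (Quant.all, y) ∈ φ.quants ∧ Eqv φ.atoms t (.var y)
  · exact Or.inr (Or.inl ⟨_, h'.choose_spec.1, h'.choose_spec.2,
      (dif_neg h).trans (dif_pos h')⟩)
  · exact Or.inr (Or.inr ((dif_neg h).trans (dif_neg h')))

theorem forcedValue_congr (h : Eqv φ.atoms t s) : forcedValue φ c f t = forcedValue φ c f s := by
  have : Eqv φ.atoms t = Eqv φ.atoms s := funext fun r =>
    propext ⟨fun h' => h.symm.trans h', fun h' => h.trans h'⟩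
  unfold forcedValue
  rw [this]

theorem Consistent.forcedValue_const (hφ : Consistent φ) (a : (TauReduct α β K C).consts) :
    forcedValue φ c f (.const a) = a.1 := by
  have h : ∃ b, Eqv φ.atoms (.const a) (.const b) := ⟨a, .refl⟩
  exact (dif_pos h).trans (congrArg _ (hφ.const_const _ _ h.choose_spec).symm)

/-- Of two different universal variables one is quantified later, and by `var_univ` no earlier
variable belongs to its class. -/
theorem Consistent.univ_eq (hφ : Consistent φ) {x y : Var} (hx : (Quant.all, x) ∈ φ.quants)
    (hy : (Quant.all, y) ∈ φ.quants) (h : Eqv φ.atoms (.var x) (.var y)) : x = y := by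
  obtain ⟨P, Q, hP⟩ := List.append_of_mem hx
  have hy' := hy
  rw [hP, List.mem_append, List.mem_cons] at hy
  rcases hy with hy | hy | hy
  · exact absurd h.symm (hφ.var_univ _ _ _ hP _ (List.mem_map_of_mem hy))
  · exact (Prod.mk.inj hy).2.symm
  · obtain ⟨R, S, rfl⟩ := List.append_of_mem hy
    exact absurd h (hφ.var_univ (P ++ (Quant.all, x) :: R) _ S (by simp [hP]) _ (by simp))

theorem Consistent.forcedValue_univ (hφ : Consistent φ) {y : Var}
    (hy : (Quant.all, y) ∈ φ.quants) : forcedValue φ c f (.var y) = f y := by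
  have h : ¬ ∃ a, Eqv φ.atoms (.var y) (.const a) := fun ⟨a, ha⟩ => hφ.const_univ a y hy ha.symm
  have h' : ∃ x, (Quant.all, x) ∈ φ.quants ∧ Eqv φ.atoms (.var y) (.var x) := ⟨y, hy, .refl⟩
  exact ((dif_neg h).trans (dif_pos h')).trans
    (congrArg f (hφ.univ_eq hy h'.choose_spec.1 h'.choose_spec.2).symm)

/-- This makes the strategy playable: the value of a variable does not depend on a universal
variable outside its class, in particular not on one still to be chosen. -/
theorem forcedValue_update {y : Var} {a : A} (h : ¬ Eqv φ.atoms t (.var y)) :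
    forcedValue φ c (Function.update f y a) t = forcedValue φ c f t := by
  unfold forcedValue
  split_ifs with h1 h2
  · rfl
  · refine Function.update_of_ne (fun he => h ?_) _ _
    rw [← he]
    exact h2.choose_spec.2
  · rfl

/-- A false relational atom has, in each triple, a value outside `α` and one outside `β`. Neither is
`c`, so each comes from a constant or a universal variable. Equivalent arguments would share a value
outside both sets, contrary to the covering. These arguments thus form a refutation. -/
theorem Consistent.holds_forcedValue (hφ : Consistent φ) (hcover : α ∪ β = Set.univ)
    (hcα : c ∈ α) (hcβ : c ∈ β) {σ : Var → A} {a : Atom (TauReduct α β K C)} (ha : a ∈ φ.atoms)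
    (hσ : ∀ x ∈ a.vars, σ x = forcedValue φ c f (.var x)) : a.Holds σ := by
  have eval : ∀ t : Term (TauReduct α β K C), t.vars ⊆ a.vars →
      t.eval σ = forcedValue φ c f t := by
    rintro (x | d) ht
    · exact hσ x (ht rfl)
    · exact (hφ.forcedValue_const d).symm
  cases a with
  | eq s t =>
    exact ((eval s Set.subset_union_left).trans (forcedValue_congr
      (ReflTransGen.single (Or.inl ha)))).trans (eval t Set.subset_union_right).symm
  | rel r ts =>
    have hts : ∀ i, (ts i).eval σ = forcedValue φ c f (ts i) := fun i =>
      eval _ (Set.subset_iUnion (fun i => (ts i).vars) i)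
    by_contra hnot
    replace hnot := mt (mem_tau (k := r.1) (t := fun i => (ts i).eval σ)).2 hnot
    push Not at hnot
    choose J1 h1 using fun i => (hnot i).1
    choose J2 h2 using fun i => (hnot i).2
    have avoid : ∀ (S : Set A) i, c ∈ S → (ts i).eval σ ∉ S → Avoidable φ S (ts i) := by
      intro S i hc hi
      rw [hts] at hi
      rcases forcedValue_cases φ c f (ts i) with ⟨d, hd, he⟩ | ⟨y, hy, hd, he⟩ | he
      · exact Or.inl ⟨d, he ▸ hi, hd⟩
      · exact Or.inr ⟨y, hy, hd⟩
      · rw [he] at hi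
        exact absurd hc hi
    refine hφ.not_refutable r ts ha ⟨fun i => (J1 i, J2 i), fun i =>
      ⟨avoid _ _ hcα (h1 i), avoid _ _ hcβ (h2 i)⟩, fun i i' he => ?_⟩
    have hv := forcedValue_congr (c := c) (f := f) he
    rcases hcover ▸ Set.mem_univ (forcedValue φ c f (ts (tripleIndex i (J1 i)))) with h | h
    · exact h1 i ((hts (tripleIndex i (J1 i))).symm ▸ h)
    · exact h2 i' ((hts (tripleIndex i' (J2 i'))).symm ▸ hv ▸ h)

/-- Induction on the rest `Q` of the prefix, where `f` records the moves of the universal player. By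
`var_univ`, a new move leaves the values of the variables already played unchanged. -/
theorem Consistent.holdsFrom (hφ : Consistent φ) (hcover : α ∪ β = Set.univ)
    (hcα : c ∈ α) (hcβ : c ∈ β) (hs : φ.IsSentence) :
    ∀ (Q P : List (Quant × Var)) (σ f : Var → A), φ.quants = P ++ Q →
      (∀ x ∈ P.map Prod.snd, σ x = forcedValue φ c f (.var x)) → HoldsFrom φ.atoms Q σ
  | [], P, σ, f, hP, hσ => fun a ha => hφ.holds_forcedValue hcover hcα hcβ ha fun x hx =>
      hσ x (by
        rw [List.append_nil] at hP
        exact hP ▸ hs.2 a ha x hx)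
  | (Quant.all, y) :: Q, P, σ, f, hP, hσ => fun a => by
    have hn := hs.1
    rw [hP, List.map_append, List.nodup_append] at hn
    refine holdsFrom hφ hcover hcα hcβ hs Q (P ++ [(Quant.all, y)]) _ (Function.update f y a)
      (by simp [hP]) fun x hx => ?_
    rw [List.map_append, List.mem_append] at hx
    rcases hx with hx | hx
    · rw [Function.update_of_ne fun he => hn.2.2 x hx y (by simp) he, hσ x hx,
        forcedValue_update (hφ.var_univ _ _ _ hP x hx)]
    · obtain rfl : x = y := by simpa using hx
      rw [hφ.forcedValue_univ (by simp [hP]), Function.update_self, Function.update_self]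
  | (Quant.ex, y) :: Q, P, σ, f, hP, hσ => by
    have hn := hs.1
    rw [hP, List.map_append, List.nodup_append] at hn
    refine ⟨forcedValue φ c f (.var y), holdsFrom hφ hcover hcα hcβ hs Q (P ++ [(Quant.ex, y)]) _ f
      (by simp [hP]) fun x hx => ?_⟩
    rw [List.map_append, List.mem_append] at hx
    rcases hx with hx | hx
    · rw [Function.update_of_ne fun he => hn.2.2 x hx y (by simp) he, hσ x hx]
    · obtain rfl : x = y := by simpa using hx
      rw [Function.update_self]

theorem isTrue_iff_consistent (hα : α ≠ Set.univ) (hβ : β ≠ Set.univ)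
    (hcover : α ∪ β = Set.univ) (hmeet : (α ∩ β).Nonempty) (hs : φ.IsSentence) :
    φ.IsTrue ↔ Consistent φ :=
  ⟨Consistent.of_isTrue hα hβ hmeet hs, fun h σ => by
    obtain ⟨c, hcα, hcβ⟩ := hmeet
    exact h.holdsFrom hcover hcα hcβ hs φ.quants [] σ σ rfl (by simp)⟩

end Tau

end ConstraintLanguage

open PosTuple Relation

/-! ### Words divided into blocks -/

section Blocks

variable {Γ : Type u} (b : Γ → Bool)

/-- The longest run of symbols satisfying `b` that starts at position `i` of `w`. -/
def runAt (w : List Γ) (i : ℕ) : List Γ := (w.drop i).takeWhile b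

/-- Position `j` of `w` is the end of the block that starts at position `i`. -/
def BlockEnd (w : List Γ) (i j : ℕ) : Prop :=
  i < w.length ∧ j = i + 1 + (runAt b w (i + 1)).length

/-- The symbols satisfying `b`. -/
def RunSymbol : Set (Option Γ) := {o | ∃ c, o = some c ∧ b c = true}

variable {b} {w : List Γ} {i j : ℕ}

theorem runAt_cons {c : Γ} (h : w[i]? = some c) (hc : b c = true) :
    runAt b w i = c :: runAt b w (i + 1) := by
  obtain ⟨hi, rfl⟩ := List.getElem?_eq_some_iff.1 h
  rw [runAt, List.drop_eq_getElem_cons hi, List.takeWhile_cons_of_pos hc, runAt]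

theorem runAt_nil (h : w[i]? ∉ RunSymbol b) : runAt b w i = [] := by
  rcases lt_or_ge i w.length with hi | hi
  · rw [runAt, List.drop_eq_getElem_cons hi, List.takeWhile_cons_of_neg]
    exact fun hc => h ⟨_, List.getElem?_eq_getElem hi, hc⟩
  · rw [runAt, List.drop_eq_nil_of_le hi, List.takeWhile_nil]

theorem runAt_eq_nil_iff : runAt b w i = [] ↔ w[i]? ∉ RunSymbol b :=
  ⟨fun h ⟨_, h1, h2⟩ => by simp [runAt_cons h1 h2] at h, runAt_nil⟩

theorem runAt_length_eq_iff : ∀ {n i : ℕ}, i ≤ w.length → ((runAt b w i).length = n ↔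
    i + n ≤ w.length ∧ (∀ k < n, w[i + k]? ∈ RunSymbol b) ∧ w[i + n]? ∉ RunSymbol b)
  | 0, i, hi => by
    rw [List.length_eq_zero_iff, runAt_eq_nil_iff]
    simp [hi]
  | n + 1, i, hi => by
    by_cases h : w[i]? ∈ RunSymbol b
    · obtain ⟨c, h1, h2⟩ := h
      have hlt : i < w.length := (List.getElem?_eq_some_iff.1 h1).1
      rw [runAt_cons h1 h2, List.length_cons, Nat.add_right_cancel_iff,
        runAt_length_eq_iff (show i + 1 ≤ w.length from hlt)]
      rw [show i + 1 + n = i + (n + 1) by ring]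
      refine and_congr_right fun _ => and_congr_left fun _ => ⟨fun H k hk => ?_, fun H k hk => ?_⟩
      · cases k with
        | zero => exact ⟨c, h1, h2⟩
        | succ k =>
          rw [show i + (k + 1) = i + 1 + k by ring]
          exact H k (by omega)
      · rw [show i + 1 + k = i + (k + 1) by ring]
        exact H (k + 1) (by omega)
    · rw [runAt_nil h]
      exact ⟨fun h => by simp at h, fun H => absurd (H.2.1 0 (by omega)) h⟩

/-- The block is described by conditions on single symbols with one quantifier over tape positions,
which is the form that definability requires. -/
theorem blockEnd_iff : BlockEnd b w i j ↔ i < j ∧ j ≤ w.length ∧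
    (∀ k ≤ w.length + 1, i < k → k < j → w[k]? ∈ RunSymbol b) ∧ w[j]? ∉ RunSymbol b := by
  constructor
  · rintro ⟨hi, rfl⟩
    obtain ⟨h1, h2, h3⟩ := (runAt_length_eq_iff (show i + 1 ≤ w.length from hi)).1
      (rfl : (runAt b w (i + 1)).length = _)
    refine ⟨by omega, h1, fun k _ hik hk => ?_, h3⟩
    obtain ⟨d, rfl⟩ := Nat.exists_eq_add_of_le (Nat.succ_le_of_lt hik)
    exact h2 d (by omega)
  · rintro ⟨hij, hj, h2, h3⟩
    obtain ⟨d, rfl⟩ := Nat.exists_eq_add_of_le (Nat.succ_le_of_lt hij)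
    refine ⟨by omega, ?_⟩
    rw [(runAt_length_eq_iff (show i + 1 ≤ w.length by omega)).2
      ⟨hj, fun k hk => h2 _ (by omega) (by omega) (by omega), h3⟩]

theorem BlockEnd.le_length (h : BlockEnd b w i j) : j ≤ w.length := (blockEnd_iff.1 h).2.1

theorem BlockEnd.notMem (h : BlockEnd b w i j) : w[j]? ∉ RunSymbol b := (blockEnd_iff.1 h).2.2.2

theorem BlockEnd.eq {j' : ℕ} (h : BlockEnd b w i j) (h' : BlockEnd b w i j') : j = j' :=
  h.2.trans h'.2.symm

theorem drop_eq_runAt_append (w : List Γ) (i : ℕ) :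
    w.drop i = runAt b w i ++ w.drop (i + (runAt b w i).length) := by
  have h := List.takeWhile_append_dropWhile (p := b) (l := w.drop i)
  have h2 := congrArg (List.drop (runAt b w i).length) h
  rw [runAt, List.drop_left, List.drop_drop] at h2
  rw [runAt, ← h2, h]

/-- A block together with what follows it. -/
theorem BlockEnd.drop_eq (h : BlockEnd b w i j) {c : Γ} (hc : w[i]? = some c) :
    w.drop i = c :: runAt b w (i + 1) ++ w.drop j := by
  obtain ⟨hi, rfl⟩ := List.getElem?_eq_some_iff.1 hc
  rw [List.drop_eq_getElem_cons hi, h.2, List.cons_append, ← drop_eq_runAt_append]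

theorem blockEnd_of_drop_eq {c : Γ} {bs v : List Γ} (h : w.drop i = c :: bs ++ v)
    (hbs : ∀ x ∈ bs, b x = true) (hv : v[0]? ∉ RunSymbol b) :
    w[i]? = some c ∧ runAt b w (i + 1) = bs ∧ BlockEnd b w i (i + 1 + bs.length) ∧
      w.drop (i + 1 + bs.length) = v := by
  have hi : i < w.length := by
    by_contra hi
    rw [List.drop_eq_nil_of_le (not_lt.1 hi)] at h
    simp at h
  rw [List.drop_eq_getElem_cons hi, List.cons_append, List.cons.injEq] at h
  have hr : runAt b w (i + 1) = bs := by
    rw [runAt, h.2, List.takeWhile_append_of_pos hbs]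
    cases v with
    | nil => simp
    | cons x v => rw [List.takeWhile_cons_of_neg fun hx => hv ⟨x, by simp, hx⟩, List.append_nil]
  refine ⟨by rw [List.getElem?_eq_getElem hi, h.1], hr, ⟨hi, by rw [hr]⟩, ?_⟩
  rw [← List.drop_drop, h.2, List.drop_left]

variable (b) in
/-- The blocks that start at `i` and `j` agree except for their first symbols. -/
def SameTail (w : List Γ) (i j : ℕ) : Prop :=
  i < w.length ∧ j < w.length ∧ runAt b w (i + 1) = runAt b w (j + 1)

variable (b) in
/-- Both positions are followed by the same symbol satisfying `b`. -/
def WalkStep (w : List Γ) (x y : ℕ × ℕ) : Prop :=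
  x.1 + 1 = y.1 ∧ x.2 + 1 = y.2 ∧ ∃ c : Γ, b c = true ∧ w[x.1]? = some c ∧ w[x.2]? = some c

variable (b) in
/-- The runs at both positions end. -/
def WalkSame (w : List Γ) (x : ℕ × ℕ) : Prop :=
  w[x.1]? ∉ RunSymbol b ∧ w[x.2]? ∉ RunSymbol b

variable (b) in
/-- The runs at both positions differ in their first symbols. -/
def WalkDiff (w : List Γ) (x : ℕ × ℕ) : Prop :=
  ¬ WalkSame b w x ∧ ¬ ∃ c : Γ, b c = true ∧ w[x.1]? = some c ∧ w[x.2]? = some c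

/-- Deleting a common first symbol does not affect whether two runs are equal, so a walk carries the
question to its end. -/
theorem WalkStep.runAt_iff {x y : ℕ × ℕ} (h : ReflTransGen (WalkStep b w) x y) :
    runAt b w x.1 = runAt b w x.2 ↔ runAt b w y.1 = runAt b w y.2 := by
  induction h with
  | refl => rfl
  | @tail y z _ h ih =>
    obtain ⟨h1, h2, c, hc, h3, h4⟩ := h
    rw [ih, runAt_cons h3 hc, runAt_cons h4 hc, List.cons.injEq, h1, h2]
    simp

theorem WalkSame.runAt_eq {x : ℕ × ℕ} (h : WalkSame b w x) : runAt b w x.1 = runAt b w x.2 := by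
  rw [runAt_nil h.1, runAt_nil h.2]

theorem WalkDiff.runAt_ne {x : ℕ × ℕ} (h : WalkDiff b w x) : runAt b w x.1 ≠ runAt b w x.2 := by
  intro he
  by_cases h1 : w[x.1]? ∈ RunSymbol b
  · obtain ⟨c, h1, hc⟩ := h1
    by_cases h2 : w[x.2]? ∈ RunSymbol b
    · obtain ⟨d, h2, hd⟩ := h2
      rw [runAt_cons h1 hc, runAt_cons h2 hd, List.cons.injEq] at he
      exact h.2 ⟨c, hc, h1, by rw [h2, he.1]⟩
    · rw [runAt_cons h1 hc, runAt_nil h2] at he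
      exact List.cons_ne_nil _ _ he
  · rw [runAt_nil h1] at he
    exact h.1 ⟨h1, runAt_eq_nil_iff.1 he.symm⟩

/-- Two fingers advance together while they read the same bit. The alternative at the end certifies
equality as well as inequality, so comparing names needs no inductive counting. -/
theorem exists_walk (w : List Γ) : ∀ (n : ℕ) (x : ℕ × ℕ), x.1 ≤ w.length → x.2 ≤ w.length →
    w.length ≤ x.1 + n → ∃ y : ℕ × ℕ, y.1 ≤ w.length ∧ y.2 ≤ w.length ∧
      ReflTransGen (fun x y => TupleOnTape w y ∧ WalkStep b w x y) x y ∧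
      (WalkSame b w y ∨ WalkDiff b w y)
  | n, x, h1, h2, hn => by
    by_cases hs : ∃ c : Γ, b c = true ∧ w[x.1]? = some c ∧ w[x.2]? = some c
    · have hs' := hs
      obtain ⟨c, hc, h3, h4⟩ := hs
      have h3' := (List.getElem?_eq_some_iff.1 h3).1
      have h4' := (List.getElem?_eq_some_iff.1 h4).1
      cases n with
      | zero => omega
      | succ n =>
        obtain ⟨y, hy1, hy2, hy3, hy4⟩ := exists_walk w n (x.1 + 1, x.2 + 1) h3' h4' (by
          change _ ≤ x.1 + 1 + n
          omega)
        refine ⟨y, hy1, hy2, hy3.head ⟨?_, rfl, rfl, hs'⟩, hy4⟩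
        simp only [tupleOnTape_prod, tupleOnTape_nat]
        omega
    · by_cases h : WalkSame b w x
      · exact ⟨x, h1, h2, .refl, Or.inl h⟩
      · exact ⟨x, h1, h2, .refl, Or.inr ⟨h, hs⟩⟩

end Blocks

/-! ### Definability of blocks and of equality of names -/

section BlocksDefinable

variable {Γ : Type u} {b : Γ → Bool} {T : Type} [PosTuple T] {f g : T → ℕ}

namespace BiDef

/-- Position `p` of the word is cell `p + 1` of the tape. A register may also hold `w.length + 1`,
whose next cell is off the tape; the word has no symbol there, and only `none ∈ S` matters. -/
theorem symbol (S : Set (Option Γ)) (hf : IsPos f) : BiDef fun (w : List Γ) t => w[f t]? ∈ S := by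
  refine ((BiDef.ex (R := fun w t a => f t + 1 = a ∧ OfflineNTM.inputAt w a ∈
    {s : InputSymbol Γ | (s = .rightEnd ∧ none ∈ S) ∨ ∃ c, s = .letter c ∧ some c ∈ S})
    ((succ (by fun_prop) (by fun_prop)).and (letter _ (by fun_prop)))).or
    ((leLength hf).not.and (const (none ∈ S)))).of_iff fun w t ht => ?_
  have hle : f t ≤ w.length + 1 := by
    obtain ⟨v, hv, rfl⟩ := ht
    obtain ⟨g', -, hg'⟩ := hf
    rw [hg']
    exact hv _
  by_cases h : f t ≤ w.length
  · simp only [h, not_true, false_and, or_false]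
    constructor
    · intro hS
      refine ⟨f t + 1, by omega, rfl, ?_⟩
      cases hw : w[f t]? with
      | none =>
        refine Or.inl ⟨?_, hw ▸ hS⟩
        rw [OfflineNTM.inputAt_eq_rightEnd]
        have := List.getElem?_eq_none_iff.1 hw
        omega
      | some c => exact Or.inr ⟨c, OfflineNTM.inputAt_eq_letter.2 ⟨_, rfl, hw⟩, hw ▸ hS⟩
    · rintro ⟨_, -, rfl, ⟨h1, h2⟩ | ⟨c, h1, h2⟩⟩
      · rw [OfflineNTM.inputAt_eq_rightEnd] at h1
        rw [List.getElem?_eq_none_iff.2 (by omega)]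
        exact h2
      · obtain ⟨q, hq, h1⟩ := OfflineNTM.inputAt_eq_letter.1 h1
        obtain rfl : q = f t := by omega
        rw [h1]
        exact h2
  · rw [List.getElem?_eq_none_iff.2 (by omega)]
    simp only [h, not_false_eq_true, true_and]
    refine ⟨Or.inr, Or.rec (fun ⟨a, h1, h2, _⟩ => by omega) id⟩

theorem blockEnd (b : Γ → Bool) (hf : IsPos f) (hg : IsPos g) :
    BiDef fun (w : List Γ) t => BlockEnd b w (f t) (g t) :=
  ((lt hf hg).and ((leLength hg).and ((BiDef.all (R := fun w t k => f t < k → k < g t →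
    w[k]? ∈ RunSymbol b) ((lt (by fun_prop) (by fun_prop)).imp ((lt (by fun_prop)
      (by fun_prop)).imp (symbol _ (by fun_prop))))).and (symbol _ hg).not))).of_iff
    fun _ _ _ => blockEnd_iff

theorem ltLength (hf : IsPos f) : BiDef fun (w : List Γ) t => f t < w.length :=
  (symbol {none} hf).not.of_iff fun w t _ => by
    rw [Set.mem_singleton_iff, List.getElem?_eq_none_iff, not_le]

theorem sameTail [Finite Γ] (b : Γ → Bool) (hf : IsPos f) (hg : IsPos g) :
    BiDef fun (w : List Γ) t => SameTail b w (f t) (g t) := by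
  have hcommon : ∀ {U : Type} [PosTuple U] {f g : U → ℕ}, IsPos f → IsPos g →
      BiDef fun (w : List Γ) x => ∃ c : Γ, b c = true ∧ w[f x]? = some c ∧ w[g x]? = some c :=
    fun hf hg => exists_finite fun c => (const _).and ((symbol {some c} hf).and
      (symbol {some c} hg))
  have hwalk : Def fun (w : List Γ) (x : (((T × ℕ) × ℕ) × ℕ) × ℕ) =>
      ReflTransGen (fun x y : ℕ × ℕ => TupleOnTape w y ∧ WalkStep b w x y)
        (x.1.1.1.2, x.1.1.2) (x.1.2, x.2) :=
    Def.reach (R := fun w (_ : (((T × ℕ) × ℕ) × ℕ) × ℕ) => WalkStep b w)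
      ((succ (by fun_prop) (by fun_prop)).and ((succ (by fun_prop) (by fun_prop)).and
        (hcommon (by fun_prop) (by fun_prop)))).1 (by fun_prop) (by fun_prop)
  have hsame : BiDef fun (w : List Γ) (x : (((T × ℕ) × ℕ) × ℕ) × ℕ) =>
      WalkSame b w (x.1.2, x.2) :=
    (symbol _ (by fun_prop)).not.and (symbol _ (by fun_prop)).not
  have hdiff : BiDef fun (w : List Γ) (x : (((T × ℕ) × ℕ) × ℕ) × ℕ) =>
      WalkDiff b w (x.1.2, x.2) :=
    hsame.not.and (hcommon (by fun_prop) (by fun_prop)).not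
  have key : ∀ {P : List Γ → ℕ × ℕ → Prop},
      (Def fun (w : List Γ) (x : (((T × ℕ) × ℕ) × ℕ) × ℕ) => P w (x.1.2, x.2)) →
      Def fun (w : List Γ) t => ∃ i ≤ w.length + 1, ∃ j ≤ w.length + 1, ∃ k ≤ w.length + 1,
        ∃ l ≤ w.length + 1, (f t + 1 = i ∧ g t + 1 = j) ∧
          ReflTransGen (fun x y : ℕ × ℕ => TupleOnTape w y ∧ WalkStep b w x y) (i, j) (k, l) ∧
          P w (k, l) := fun hP =>
    Def.ex (Def.ex (Def.ex (Def.ex (((succ (by fun_prop) (by fun_prop)).1.and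
      (succ (by fun_prop) (by fun_prop)).1).and (hwalk.and hP)))))
  have hlt : BiDef fun (w : List Γ) t => f t < w.length ∧ g t < w.length :=
    (ltLength hf).and (ltLength hg)
  have mono : ∀ {w : List Γ} {x y : ℕ × ℕ},
      ReflTransGen (fun x y : ℕ × ℕ => TupleOnTape w y ∧ WalkStep b w x y) x y →
      ReflTransGen (WalkStep b w) x y := ReflTransGen.mono (fun _ _ h => h.2) _ _
  constructor
  · refine (hlt.1.and (key hsame.1)).of_iff fun w t _ => ?_
    constructor
    · rintro ⟨h1, h2, h3⟩
      obtain ⟨y, hy1, hy2, hr, hy⟩ := exists_walk (b := b) w w.length (f t + 1, g t + 1) h1 h2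
        (by change _ ≤ f t + 1 + _; omega)
      refine ⟨⟨h1, h2⟩, _, by omega, _, by omega, y.1, by omega, y.2, by omega, ⟨rfl, rfl⟩, hr,
        hy.resolve_right fun hd => ?_⟩
      exact hd.runAt_ne ((WalkStep.runAt_iff (mono hr)).1 h3)
    · rintro ⟨⟨h1, h2⟩, _, -, _, -, k, -, l, -, ⟨rfl, rfl⟩, hr, hs⟩
      exact ⟨h1, h2, (WalkStep.runAt_iff (mono hr)).2 hs.runAt_eq⟩
  · refine (hlt.2.or (key hdiff.1)).of_iff fun w t _ => ?_
    constructor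
    · intro h
      by_cases hl : f t < w.length ∧ g t < w.length
      · right
        obtain ⟨h1, h2⟩ := hl
        obtain ⟨y, hy1, hy2, hr, hy⟩ := exists_walk (b := b) w w.length (f t + 1, g t + 1) h1 h2
          (by change _ ≤ f t + 1 + _; omega)
        refine ⟨_, by omega, _, by omega, y.1, by omega, y.2, by omega, ⟨rfl, rfl⟩, hr,
          hy.resolve_left fun hd => ?_⟩
        exact h ⟨h1, h2, (WalkStep.runAt_iff (mono hr)).2 hd.runAt_eq⟩
      · exact Or.inl hl
    · rintro (h | ⟨_, -, _, -, k, -, l, -, ⟨rfl, rfl⟩, hr, hs⟩) ⟨h1, h2, h3⟩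
      · exact h ⟨h1, h2⟩
      · exact hs.runAt_ne ((WalkStep.runAt_iff (mono hr)).1 h3)

end BiDef

end BlocksDefinable

open PosTuple Relation

/-! ### Positions in encoded sentences -/

section FlatMap

variable {X : Type u} {Γ : Type v} {enc : X → List Γ} {head : Γ → Prop}

/-- If only the first symbols of the blocks `enc x` can be heads, then every head in a
concatenation of blocks starts a block. -/
theorem exists_split_of_head (henc : ∀ x, ∃ c l, enc x = c :: l ∧ ∀ y ∈ l, ¬ head y) {c : Γ}
    (hc : head c) : ∀ {L : List X} {p : ℕ}, (L.flatMap enc)[p]? = some c →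
      ∃ P x R, L = P ++ x :: R ∧ p = (P.flatMap enc).length ∧ (enc x)[0]? = some c
  | [], p, h => by simp at h
  | x :: L, p, h => by
    rw [List.flatMap_cons] at h
    rcases lt_or_ge p (enc x).length with hp | hp
    · rw [List.getElem?_append_left hp] at h
      cases p with
      | zero => exact ⟨[], x, L, rfl, rfl, h⟩
      | succ p =>
        obtain ⟨d, l, hl, hd⟩ := henc x
        rw [hl, List.getElem?_cons_succ] at h
        exact absurd hc (hd _ (List.mem_of_getElem? h))
    · rw [List.getElem?_append_right hp] at h
      obtain ⟨P, y, R, rfl, h2, h3⟩ := exists_split_of_head henc hc h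
      refine ⟨x :: P, y, R, rfl, ?_, h3⟩
      rw [List.flatMap_cons, List.length_append]
      omega

end FlatMap

namespace ConstraintLanguage

variable {A : Type u} {B : ConstraintLanguage.{u, v} A}

/-- The tokens that are bits. -/
def Token.isBit : Token B → Bool
  | .bit _ => true
  | _ => false

/-- The tokens that are quantifiers. -/
def quantTokens : Set (Option (Token B)) := {some .all, some .ex}

/-- The token of a quantifier. -/
def Quant.token : Quant → Token B
  | .all => .all
  | .ex => .ex

/-- Positions where no bit is written. -/
abbrev Clean (o : Option (Token B)) : Prop := o ∉ RunSymbol Token.isBit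

theorem clean_none : Clean (none : Option (Token B)) := fun ⟨_, h, _⟩ => nomatch h

theorem clean_some {c : Token B} (h : c.isBit = false) : Clean (some c) := fun ⟨_, h1, h2⟩ => by
  obtain rfl := Option.some.inj h1
  rw [h] at h2
  cases h2

theorem all_isBit (x : Var) : ∀ c ∈ x.map (Token.bit : Bool → Token B), c.isBit = true := by
  intro c hc
  obtain ⟨b, -, rfl⟩ := List.mem_map.1 hc
  rfl

theorem exists_eq_map_bit : ∀ {l : List (Token B)}, (∀ c ∈ l, c.isBit = true) →
    ∃ x : Var, l = x.map Token.bit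
  | [], _ => ⟨[], rfl⟩
  | c :: l, h => by
    obtain ⟨x, rfl⟩ := exists_eq_map_bit fun d hd => h d (List.mem_cons_of_mem _ hd)
    have hc := h c List.mem_cons_self
    cases c with
    | bit b => exact ⟨b :: x, rfl⟩
    | _ => cases hc

theorem exists_runAt_eq (w : List (Token B)) (i : ℕ) :
    ∃ x : Var, runAt Token.isBit w i = x.map Token.bit :=
  exists_eq_map_bit fun _ hc => List.mem_takeWhile_imp hc

theorem map_bit_injective : Function.Injective (List.map (Token.bit : Bool → Token B)) :=
  List.map_injective_iff.2 fun _ _ h => by injection h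

/-- The word `l` is written from position `i` to position `j`, and no bit follows. -/
def IsSeg (w : List (Token B)) (i j : ℕ) (l : List (Token B)) : Prop :=
  w.drop i = l ++ w.drop j ∧ j ≤ w.length ∧ Clean w[j]?

variable {w : List (Token B)} {i j k : ℕ} {l l' : List (Token B)}

theorem eq_of_drop_eq (h : w.drop i = w.drop j) (hi : i ≤ w.length) (hj : j ≤ w.length) :
    i = j := by
  have := congrArg List.length h
  rw [List.length_drop, List.length_drop] at this
  omega

theorem IsSeg.trans (h : IsSeg w i j l) (h' : IsSeg w j k l') : IsSeg w i k (l ++ l') :=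
  ⟨by rw [h.1, h'.1, List.append_assoc], h'.2⟩

theorem IsSeg.clean (h : IsSeg w i j l) (hl : Clean l[0]?) : Clean w[i]? := by
  have h0 : w[i]? = (w.drop i)[0]? := by rw [List.getElem?_drop, add_zero]
  rw [h0, h.1]
  cases l with
  | nil =>
    rw [List.nil_append, List.getElem?_drop, add_zero]
    exact h.2.2
  | cons c l => exact hl

/-- The cut is where the suffix `l' ++ w.drop j` begins. If `l'` began with a bit, the first part
would not be followed by a position free of bits, and a name ending it would be continued. -/
theorem IsSeg.split (h : IsSeg w i j (l ++ l')) (hl : Clean l'[0]?) :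
    ∃ k, IsSeg w i k l ∧ IsSeg w k j l' := by
  have hs : l' ++ w.drop j <:+ w := by
    refine List.IsSuffix.trans ⟨l, ?_⟩ (List.drop_suffix i w)
    rw [h.1, List.append_assoc]
  have hk := List.suffix_iff_eq_drop.1 hs
  have h2 : IsSeg w (w.length - (l' ++ w.drop j).length) j l' := ⟨hk.symm, h.2⟩
  refine ⟨_, ⟨?_, Nat.sub_le _ _, h2.clean hl⟩, h2⟩
  rw [← hk, h.1, List.append_assoc]

/-- Names have no terminator and end where the bits end. Since no bit follows a segment, the end of
a block is determined by its beginning. -/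
theorem isSeg_block {c : Token B} {x : Var} : IsSeg w i j (c :: x.map Token.bit) ↔
    BlockEnd Token.isBit w i j ∧ w[i]? = some c ∧
      runAt Token.isBit w (i + 1) = x.map Token.bit := by
  constructor
  · intro h
    have h0 : Clean (w.drop j)[0]? := by
      rw [List.getElem?_drop, add_zero]
      exact h.2.2
    obtain ⟨h1, h2, h3, h4⟩ := blockEnd_of_drop_eq h.1 (all_isBit x) h0
    rw [← eq_of_drop_eq h4 h3.le_length h.2.1]
    exact ⟨h3, h1, h2⟩
  · rintro ⟨h1, h2, h3⟩
    exact ⟨by rw [h1.drop_eq h2, h3], h1.le_length, h1.notMem⟩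

/-- The term `t` is written at position `i`. -/
def TermAt (w : List (Token B)) (i : ℕ) : Term B → Prop
  | .var x => w[i]? = some .var ∧ runAt Token.isBit w (i + 1) = x.map Token.bit
  | .const a => w[i]? = some (.const a)

theorem TermAt.lt_length {t : Term B} (h : TermAt w i t) : i < w.length := by
  cases t with
  | var x => exact (List.getElem?_eq_some_iff.1 h.1).1
  | const a => exact (List.getElem?_eq_some_iff.1 h).1

theorem TermAt.eq {t s : Term B} (h : TermAt w i t) (h' : TermAt w i s) : t = s := by
  cases t with
  | var x =>
    cases s with
    | var y => rw [map_bit_injective (h.2.symm.trans h'.2)]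
    | const b => cases h.1.symm.trans h'
  | const a =>
    cases s with
    | var y => cases h.symm.trans h'.1
    | const b => cases h.symm.trans h'; rfl

theorem IsSeg.termAt {t : Term B} (h : IsSeg w i j t.encode) : TermAt w i t := by
  cases t with
  | var x => exact (isSeg_block.1 h).2
  | const a => exact (isSeg_block (x := []).1 h).2.1

theorem exists_termAt_var (h : w[i]? = some .var) : ∃ x, TermAt w i (.var x) :=
  (exists_runAt_eq w (i + 1)).imp fun _ hx => ⟨h, hx⟩

/-- Some term is written from position `i` to position `j`. -/
def TermSeg (w : List (Token B)) (i j : ℕ) : Prop :=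
  BlockEnd Token.isBit w i j ∧ (w[i]? = some .var ∨ i + 1 = j ∧ ∃ a, w[i]? = some (.const a))

theorem termSeg_iff : TermSeg w i j ↔ ∃ t : Term B, IsSeg w i j t.encode := by
  constructor
  · rintro ⟨h, h1 | ⟨rfl, a, ha⟩⟩
    · obtain ⟨x, hx⟩ := exists_runAt_eq w (i + 1)
      exact ⟨.var x, isSeg_block.2 ⟨h, h1, hx⟩⟩
    · refine ⟨.const a, isSeg_block (x := []).2 ⟨h, ha, ?_⟩⟩
      exact List.eq_nil_of_length_eq_zero (by have := h.2; omega)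
  · rintro ⟨x | a, h⟩
    · have := isSeg_block.1 h
      exact ⟨this.1, Or.inl this.2.1⟩
    · have := isSeg_block (x := []).1 h
      refine ⟨this.1, Or.inr ⟨?_, a, this.2.1⟩⟩
      rw [this.1.2, this.2.2]
      rfl

theorem TermSeg.eq (h : TermSeg w i j) (h' : TermSeg w i k) : j = k := h.1.eq h'.1

/-- There are `n` terms written one after the other from position `i` to position `j`. -/
def TermChain (w : List (Token B)) : ℕ → ℕ → ℕ → Prop
  | 0, i, j => i = j ∧ j ≤ w.length ∧ Clean w[j]?
  | n + 1, i, j => ∃ k ≤ w.length + 1, TermChain w n i k ∧ TermSeg w k j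

theorem TermChain.eq : ∀ {n i j k}, TermChain w n i j → TermChain w n i k → j = k
  | 0, _, _, _, h, h' => h.1.symm.trans h'.1
  | n + 1, _, _, _, ⟨_, _, h1, h2⟩, ⟨_, _, h3, h4⟩ => by
    obtain rfl := h1.eq h3
    exact h2.eq h4

theorem clean_flatMap {X : Type*} {enc : X → List (Token B)}
    (henc : ∀ x, ∃ c l, enc x = c :: l ∧ c.isBit = false) (L : List X) :
    Clean (L.flatMap enc)[0]? := by
  cases L with
  | nil => exact clean_none
  | cons x L =>
    obtain ⟨c, l, h, hc⟩ := henc x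
    rw [List.flatMap_cons, h]
    exact clean_some hc

theorem Term.encode_head (t : Term B) : ∃ c l, t.encode = c :: l ∧ c.isBit = false := by
  cases t <;> exact ⟨_, _, rfl, rfl⟩

theorem Atom.encode_head (a : Atom B) : ∃ c l, a.encode = c :: l ∧ c.isBit = false := by
  cases a <;> exact ⟨_, _, rfl, rfl⟩

theorem encodeQuant_eq (q : Quant) (x : Var) :
    (encodeQuant (q, x) : List (Token B)) = q.token :: x.map Token.bit := by
  cases q <;> rfl

theorem encodeQuant_head (q : Quant × Var) :
    ∃ (c : Token B) (l : List (Token B)), encodeQuant q = c :: l ∧ c.isBit = false := by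
  obtain ⟨_ | _, _⟩ := q <;> exact ⟨_, _, rfl, rfl⟩

theorem termChain_iff (hi : i ≤ w.length) : ∀ {n j}, TermChain w n i j ↔
    ∃ L : List (Term B), L.length = n ∧ IsSeg w i j (L.flatMap Term.encode)
  | 0, j => by
    constructor
    · rintro ⟨rfl, h⟩
      exact ⟨[], rfl, rfl, h⟩
    · rintro ⟨L, hL, h⟩
      obtain rfl := List.eq_nil_of_length_eq_zero hL
      exact ⟨eq_of_drop_eq h.1 hi h.2.1, h.2⟩
  | n + 1, j => by
    constructor
    · rintro ⟨k, -, h1, h2⟩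
      obtain ⟨L, hL, h3⟩ := (termChain_iff hi).1 h1
      obtain ⟨t, h4⟩ := termSeg_iff.1 h2
      refine ⟨L ++ [t], by simp [hL], ?_⟩
      rw [List.flatMap_append, List.flatMap_singleton]
      exact h3.trans h4
    · rintro ⟨L, hL, h⟩
      have hne : L ≠ [] := by
        rintro rfl
        cases hL
      obtain ⟨L', t, rfl⟩ : ∃ L' t, L = L' ++ [t] :=
        ⟨L.dropLast, L.getLast hne, (List.dropLast_append_getLast hne).symm⟩
      rw [List.flatMap_append] at h
      obtain ⟨k, h1, h2⟩ := h.split (clean_flatMap Term.encode_head _)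
      rw [List.flatMap_singleton] at h2
      exact ⟨k, h1.2.1.trans (Nat.le_succ _), (termChain_iff hi).2
        ⟨L', by simpa using hL, h1⟩, termSeg_iff.2 ⟨t, h2⟩⟩

/-- The `m`-th of a sequence of terms, as found by counting terms. -/
theorem exists_termChain (hi : i ≤ w.length) {n : ℕ} {ts : Fin n → Term B}
    (h : IsSeg w i j ((List.ofFn ts).flatMap Term.encode)) (m : Fin n) :
    ∃ k ≤ w.length + 1, TermChain w m i k ∧ TermAt w k (ts m) := by
  have hm : m.1 < (List.ofFn ts).length := by simp
  rw [← List.take_append_drop m (List.ofFn ts), List.drop_eq_getElem_cons hm,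
    List.flatMap_append] at h
  obtain ⟨k, h1, h2⟩ := h.split (clean_flatMap Term.encode_head _)
  rw [List.flatMap_cons] at h2
  obtain ⟨k', h2, -⟩ := h2.split (clean_flatMap Term.encode_head _)
  refine ⟨k, h1.2.1.trans (Nat.le_succ _), (termChain_iff hi).2 ⟨_, ?_, h1⟩, ?_⟩
  · rw [List.length_take]
    omega
  · rw [List.getElem_ofFn] at h2
    exact h2.termAt

/-- Some quantified variable is written from position `i` to position `j`. -/
def QuantSeg (w : List (Token B)) (i j : ℕ) : Prop :=
  BlockEnd Token.isBit w i j ∧ w[i]? ∈ quantTokens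

theorem quantSeg_iff : QuantSeg w i j ↔ ∃ q, IsSeg w i j (encodeQuant q) := by
  constructor
  · rintro ⟨h, h1⟩
    obtain ⟨x, hx⟩ := exists_runAt_eq w (i + 1)
    rcases h1 with h1 | h1
    · exact ⟨(.all, x), isSeg_block.2 ⟨h, h1, hx⟩⟩
    · exact ⟨(.ex, x), isSeg_block.2 ⟨h, h1, hx⟩⟩
  · rintro ⟨⟨_ | _, x⟩, h⟩
    · have := isSeg_block.1 h
      exact ⟨this.1, Or.inl this.2.1⟩
    · have := isSeg_block.1 h
      exact ⟨this.1, Or.inr this.2.1⟩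

/-- Some atom is written from position `i` to position `j`. -/
def AtomSeg (w : List (Token B)) (i j : ℕ) : Prop :=
  ∃ k ≤ w.length + 1, i + 1 = k ∧ ((w[i]? = some .eq ∧ TermChain w 2 k j) ∨
    ∃ r, w[i]? = some (.rel r) ∧ TermChain w (B.arity r) k j)

theorem drop_eq_cons {c : Token B} (h : w[i]? = some c) : w.drop i = c :: w.drop (i + 1) := by
  obtain ⟨hi, rfl⟩ := List.getElem?_eq_some_iff.1 h
  exact List.drop_eq_getElem_cons hi

theorem IsSeg.tail {c : Token B} (h : IsSeg w i j (c :: l)) :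
    w[i]? = some c ∧ IsSeg w (i + 1) j l := by
  have h0 : w[i]? = (w.drop i)[0]? := by rw [List.getElem?_drop, add_zero]
  have h1 : w[i]? = some c := by rw [h0, h.1]; rfl
  refine ⟨h1, ?_, h.2⟩
  have := h.1
  rw [drop_eq_cons h1] at this
  exact (List.cons.inj this).2

theorem IsSeg.cons {c : Token B} (h1 : w[i]? = some c) (h : IsSeg w (i + 1) j l) :
    IsSeg w i j (c :: l) :=
  ⟨by rw [drop_eq_cons h1, h.1]; rfl, h.2⟩

theorem atomSeg_iff : AtomSeg w i j ↔ ∃ a : Atom B, IsSeg w i j a.encode := by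
  constructor
  · rintro ⟨_, -, rfl, ⟨h1, h2⟩ | ⟨r, h1, h2⟩⟩
    · obtain ⟨L, hL, h2⟩ := (termChain_iff (List.getElem?_eq_some_iff.1 h1).1).1 h2
      obtain ⟨s, t, rfl⟩ := List.length_eq_two.1 hL
      refine ⟨.eq s t, .cons h1 ?_⟩
      simpa using h2
    · obtain ⟨L, hL, h2⟩ := (termChain_iff (List.getElem?_eq_some_iff.1 h1).1).1 h2
      refine ⟨.rel r fun m => L[m.1], .cons h1 ?_⟩
      convert h2
      exact List.ext_getElem (by simp [hL]) (by simp)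
  · rintro ⟨s | ⟨r, ts⟩, h⟩
    · obtain ⟨h1, h2⟩ := h.tail
      have hi := (List.getElem?_eq_some_iff.1 h1).1
      exact ⟨i + 1, by omega, rfl, Or.inl ⟨h1, (termChain_iff hi).2 ⟨[_, _], rfl, by simpa using h2⟩⟩⟩
    · obtain ⟨h1, h2⟩ := h.tail
      have hi := (List.getElem?_eq_some_iff.1 h1).1
      exact ⟨i + 1, by omega, rfl, Or.inr ⟨r, h1, (termChain_iff hi).2 ⟨_, by simp, h2⟩⟩⟩

theorem exists_flatMap_of_reach {X : Type*} {enc : X → List (Token B)} {R : ℕ → ℕ → Prop}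
    (hR : ∀ i j, R i j → ∃ x, IsSeg w i j (enc x)) (h : ReflTransGen R i j) :
    ∃ L : List X, w.drop i = L.flatMap enc ++ w.drop j := by
  induction h with
  | refl => exact ⟨[], rfl⟩
  | tail _ h ih =>
    obtain ⟨L, hL⟩ := ih
    obtain ⟨x, hx⟩ := hR _ _ h
    exact ⟨L ++ [x], by rw [hL, hx.1]; simp⟩

theorem reach_of_isSeg {X : Type*} {enc : X → List (Token B)} {R : ℕ → ℕ → Prop}
    (henc : ∀ x, ∃ c l, enc x = c :: l ∧ c.isBit = false)
    (hR : ∀ i j x, IsSeg w i j (enc x) → R i j) : ∀ {L : List X} {i : ℕ}, i ≤ w.length →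
      IsSeg w i j (L.flatMap enc) → ReflTransGen R i j
  | [], i, hi, h => by rw [eq_of_drop_eq h.1 hi h.2.1]
  | x :: L, i, hi, h => by
    rw [List.flatMap_cons] at h
    obtain ⟨k, h1, h2⟩ := h.split (clean_flatMap henc _)
    exact (reach_of_isSeg henc hR h1.2.1 h2).head (hR _ _ _ h1)

/-- The word `w` is the encoding of a formula, as seen by a reader who proceeds block by block. -/
def IsEncoding (w : List (Token B)) : Prop :=
  ∃ a ≤ w.length + 1, a = 0 ∧ ∃ m ≤ w.length + 1,
    ReflTransGen (fun i j => TupleOnTape w j ∧ QuantSeg w i j) a m ∧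
      ∃ e ≤ w.length + 1, (e ≤ w.length ∧ ¬ e < w.length) ∧
        ReflTransGen (fun i j => TupleOnTape w j ∧ AtomSeg w i j) m e

/-- Reading the word block by block is reachability along segments, and the border between the
prefix and the atoms is guessed. -/
theorem isEncoding_iff : IsEncoding w ↔ ∃ φ : PHFormula B, φ.encode = w := by
  constructor
  · rintro ⟨_, -, rfl, m, -, h1, e, -, he, h2⟩
    obtain ⟨Q, hQ⟩ := exists_flatMap_of_reach (fun i j h => quantSeg_iff.1 h.2) h1
    obtain ⟨L, hL⟩ := exists_flatMap_of_reach (fun i j h => atomSeg_iff.1 h.2) h2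
    refine ⟨⟨Q, L⟩, ?_⟩
    rw [List.drop_zero] at hQ
    rw [hL, List.drop_eq_nil_of_le (by omega), List.append_nil] at hQ
    exact hQ.symm
  · rintro ⟨φ, hφ⟩
    have h : IsSeg w 0 w.length (φ.quants.flatMap encodeQuant ++ φ.atoms.flatMap Atom.encode) := by
      refine ⟨?_, le_rfl, ?_⟩
      · rw [List.drop_length, List.append_nil, List.drop_zero]
        exact hφ.symm
      · rw [List.getElem?_eq_none_iff.2 le_rfl]
        exact clean_none
    obtain ⟨m, h1, h2⟩ := h.split (clean_flatMap Atom.encode_head _)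
    refine ⟨0, Nat.zero_le _, rfl, m, h1.2.1.trans (Nat.le_succ _),
      reach_of_isSeg encodeQuant_head (fun i j x hx => ⟨?_, quantSeg_iff.2 ⟨x, hx⟩⟩)
        (Nat.zero_le _) h1, w.length, by omega, by omega,
      reach_of_isSeg Atom.encode_head (fun i j x hx => ⟨?_, atomSeg_iff.2 ⟨x, hx⟩⟩) h1.2.1 h2⟩
    · exact tupleOnTape_nat.2 (hx.2.1.trans (Nat.le_succ _))
    · exact tupleOnTape_nat.2 (hx.2.1.trans (Nat.le_succ _))

/-! ### Positions of quantifiers and atoms -/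

section Occurrences

variable {φ : PHFormula B}

theorem isSeg_encode (φ : PHFormula B) : IsSeg φ.encode 0 φ.encode.length
    (φ.quants.flatMap encodeQuant ++ φ.atoms.flatMap Atom.encode) := by
  refine ⟨?_, le_rfl, ?_⟩
  · rw [List.drop_length, List.append_nil, List.drop_zero]
    rfl
  · rw [List.getElem?_eq_none_iff.2 le_rfl]
    exact clean_none

theorem mem_encodeQuant {c : Token B} {q : Quant × Var} (h : c ∈ encodeQuant q) :
    some c ∈ quantTokens ∨ c.isBit = true := by
  obtain ⟨_ | _, x⟩ := q <;> rcases List.mem_cons.1 h with rfl | h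
  · exact Or.inl (Or.inl rfl)
  · exact Or.inr (all_isBit x _ h)
  · exact Or.inl (Or.inr rfl)
  · exact Or.inr (all_isBit x _ h)

/-- The tokens that occur in terms. -/
def Token.inTerm : Token B → Prop
  | .var => True
  | .const _ => True
  | .bit _ => True
  | _ => False

theorem mem_encodeTerm {c : Token B} {t : Term B} (h : c ∈ t.encode) : c.inTerm := by
  cases t with
  | var x =>
    rcases List.mem_cons.1 h with rfl | h
    · trivial
    · obtain ⟨b, -, rfl⟩ := List.mem_map.1 h
      trivial
  | const a =>
    obtain rfl := List.mem_singleton.1 h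
    trivial

theorem encodeAtom_eq (a : Atom B) : ∃ c l, a.encode = c :: l ∧ some c ∉ quantTokens ∧
    ∀ y ∈ l, Token.inTerm y := by
  cases a with
  | eq s t =>
    refine ⟨_, _, rfl, by simp [quantTokens], fun y hy => ?_⟩
    rcases List.mem_append.1 hy with hy | hy <;> exact mem_encodeTerm hy
  | rel r ts =>
    refine ⟨_, _, rfl, by simp [quantTokens], fun y hy => ?_⟩
    obtain ⟨t, -, hy⟩ := List.mem_flatMap.1 hy
    exact mem_encodeTerm hy

/-- Quantifier tokens occur neither in names nor in atoms, so each of them begins an entry of the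
prefix. -/
theorem exists_quants_split {q : Quant} {p : ℕ} (h : φ.encode[p]? = some q.token) :
    ∃ P x R, φ.quants = P ++ (q, x) :: R ∧
      p = (P.flatMap (encodeQuant (B := B))).length := by
  rcases lt_or_ge p (φ.quants.flatMap (encodeQuant (B := B))).length with hp | hp
  · rw [PHFormula.encode, List.getElem?_append_left hp] at h
    have henc : ∀ x : Quant × Var, ∃ (c : Token B) (l : List (Token B)), encodeQuant x = c :: l ∧
        ∀ y ∈ l, ¬ y.isBit = false := fun ⟨q, x⟩ =>
      ⟨_, _, encodeQuant_eq q x, fun y hy => by simp [all_isBit x y hy]⟩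
    obtain ⟨P, ⟨q', x⟩, R, h1, h2, h3⟩ := exists_split_of_head henc (by cases q <;> rfl) h
    refine ⟨P, x, R, ?_, h2⟩
    rw [h1]
    cases q <;> cases q' <;> first | rfl | cases h3
  · rw [PHFormula.encode, List.getElem?_append_right hp] at h
    obtain ⟨a, -, ha⟩ := List.mem_flatMap.1 (List.mem_of_getElem? h)
    obtain ⟨c, l, hc, h1, h2⟩ := encodeAtom_eq a
    rw [hc] at ha
    rcases List.mem_cons.1 ha with rfl | ha
    · cases q <;> simp [quantTokens, Quant.token] at h1
    · have := h2 _ ha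
      cases q <;> cases this

theorem isSeg_quant {P R : List (Quant × Var)} {q : Quant × Var}
    (h : φ.quants = P ++ q :: R) :
    ∃ j, IsSeg φ.encode (P.flatMap (encodeQuant (B := B))).length j (encodeQuant q) := by
  have h0 := isSeg_encode φ
  rw [h, List.flatMap_append, List.flatMap_cons, List.append_assoc, List.append_assoc] at h0
  have hcl : Clean (encodeQuant q ++ (R.flatMap (encodeQuant (B := B)) ++
      φ.atoms.flatMap Atom.encode))[0]? := by
    obtain ⟨c, l, h, hc⟩ := encodeQuant_head (B := B) q
    rw [h]
    exact clean_some hc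
  have hcl' : Clean (R.flatMap (encodeQuant (B := B)) ++ φ.atoms.flatMap Atom.encode)[0]? := by
    cases R with
    | nil => exact clean_flatMap Atom.encode_head _
    | cons q R =>
      obtain ⟨c, l, h, hc⟩ := encodeQuant_head (B := B) q
      rw [List.flatMap_cons, h]
      exact clean_some hc
  obtain ⟨k, h1, h2⟩ := h0.split hcl
  obtain ⟨j, h2, -⟩ := h2.split hcl'
  have hk : (P.flatMap (encodeQuant (B := B))).length = k := by
    have h3 := congrArg List.length h1.1
    rw [List.drop_zero, List.length_append, List.length_drop] at h3
    have := h1.2.1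
    omega
  exact ⟨j, hk ▸ h2⟩

theorem exists_isSeg_atom {a : Atom B} (ha : a ∈ φ.atoms) :
    ∃ i j, IsSeg φ.encode i j a.encode := by
  obtain ⟨m, -, h⟩ := (isSeg_encode φ).split (clean_flatMap Atom.encode_head _)
  obtain ⟨P, R, hP⟩ := List.append_of_mem ha
  rw [hP, List.flatMap_append] at h
  obtain ⟨i, -, h⟩ := h.split (clean_flatMap Atom.encode_head _)
  rw [List.flatMap_cons] at h
  obtain ⟨j, h, -⟩ := h.split (clean_flatMap Atom.encode_head _)
  exact ⟨i, j, h⟩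

/-- Equality and relation tokens occur neither in the prefix nor inside terms, so each of them
begins an atom. -/
theorem exists_atom_isSeg {c : Token B} {p : ℕ} (h : φ.encode[p]? = some c)
    (hc : c = .eq ∨ ∃ r, c = .rel r) :
    ∃ a ∈ φ.atoms, ∃ j, IsSeg φ.encode p j a.encode ∧ a.encode[0]? = some c := by
  rcases lt_or_ge p (φ.quants.flatMap (encodeQuant (B := B))).length with hp | hp
  · rw [PHFormula.encode, List.getElem?_append_left hp] at h
    obtain ⟨a, -, ha⟩ := List.mem_flatMap.1 (List.mem_of_getElem? h)
    rcases mem_encodeQuant ha with h | h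
    · obtain rfl | ⟨r, rfl⟩ := hc <;> simp [quantTokens] at h
    · obtain rfl | ⟨r, rfl⟩ := hc <;> cases h
  · have h' := h
    rw [PHFormula.encode, List.getElem?_append_right hp] at h
    have henc : ∀ x : Atom B, ∃ (c : Token B) (l : List (Token B)), x.encode = c :: l ∧
        ∀ y ∈ l, ¬ ¬ y.inTerm := fun x => by
      obtain ⟨c, l, h1, -, h2⟩ := encodeAtom_eq x
      exact ⟨c, l, h1, fun y hy => not_not.2 (h2 y hy)⟩
    obtain ⟨P, a, R, h1, h2, h3⟩ := exists_split_of_head henc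
      (by obtain rfl | ⟨r, rfl⟩ := hc <;> exact id) h
    refine ⟨a, by simp [h1], ?_⟩
    obtain ⟨m, hm, hs⟩ := (isSeg_encode φ).split (clean_flatMap Atom.encode_head _)
    rw [h1, List.flatMap_append] at hs
    obtain ⟨k, hk, hs⟩ := hs.split (clean_flatMap Atom.encode_head _)
    rw [List.flatMap_cons] at hs
    obtain ⟨j, hj, -⟩ := hs.split (clean_flatMap Atom.encode_head _)
    obtain rfl : k = p := by
      have e1 := congrArg List.length hm.1
      have e2 := congrArg List.length hk.1
      simp only [List.length_append, List.length_drop] at e1 e2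
      have := hm.2.1
      have := hk.2.1
      omega
    exact ⟨j, hj, h3⟩

end Occurrences

end ConstraintLanguage

open PosTuple Relation

/-! ### The criterion in terms of positions -/

namespace ConstraintLanguage

section Connected

variable {A : Type u} {B : ConstraintLanguage.{u, v} A}

/-- The arguments of an equality atom are written at positions `i` and `k`. -/
def EqArgs (w : List (Token B)) (i k : ℕ) : Prop :=
  ∃ p ≤ w.length + 1, p + 1 = i ∧ w[p]? = some .eq ∧ BlockEnd Token.isBit w i k

/-- The same term is written at positions `i` and `k`. -/
def SameTerm (w : List (Token B)) (i k : ℕ) : Prop :=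
  (w[i]? = some .var ∧ w[k]? = some .var ∧ SameTail Token.isBit w i k) ∨
    ∃ a, w[i]? = some (.const a) ∧ w[k]? = some (.const a)

/-- The terms at positions `i` and `k` are equal, or identified by an equality atom. -/
def Link (w : List (Token B)) (i k : ℕ) : Prop := SameTerm w i k ∨ EqArgs w i k ∨ EqArgs w k i

/-- The terms at positions `i` and `k` are equivalent. -/
def Conn (w : List (Token B)) (i k : ℕ) : Prop :=
  i ≤ w.length ∧ k ≤ w.length ∧ ReflTransGen (fun a b => b ≤ w.length ∧ Link w a b) i k

variable {w : List (Token B)} {i j k p : ℕ} {s t : Term B} {φ : PHFormula B}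

theorem SameTerm.termAt (h : SameTerm w i k) (ht : TermAt w i t) : TermAt w k t := by
  rcases h with ⟨h1, h2, h3⟩ | ⟨a, h1, h2⟩
  · cases t with
    | var x => exact ⟨h2, h3.2.2.symm.trans ht.2⟩
    | const b => cases h1.symm.trans ht
  · cases t with
    | var x => cases h1.symm.trans ht.1
    | const b =>
      cases h1.symm.trans ht
      exact h2

theorem sameTerm_of_termAt (h : TermAt w i t) (h' : TermAt w k t) : SameTerm w i k := by
  have hi := h.lt_length
  have hk := h'.lt_length
  cases t with
  | var x => exact Or.inl ⟨h.1, h'.1, hi, hk, h.2.trans h'.2.symm⟩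
  | const a => exact Or.inr ⟨a, h, h'⟩

theorem EqArgs.exists_atom (h : EqArgs φ.encode i k) :
    ∃ s t, Atom.eq s t ∈ φ.atoms ∧ TermAt φ.encode i s ∧ TermAt φ.encode k t := by
  obtain ⟨p, -, rfl, hp, hb⟩ := h
  obtain ⟨a, ha, j, hs, h0⟩ := exists_atom_isSeg hp (Or.inl rfl)
  cases a with
  | rel r ts => cases h0
  | eq s t =>
    obtain ⟨m, h1, h2⟩ := hs.tail.2.split (by
      obtain ⟨c, l, h, hc⟩ := t.encode_head
      rw [h]
      exact clean_some hc)
    obtain rfl := (termSeg_iff.2 ⟨s, h1⟩).1.eq hb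
    exact ⟨s, t, ha, h1.termAt, h2.termAt⟩

theorem exists_eqArgs (h : Atom.eq s t ∈ φ.atoms) :
    ∃ i k, EqArgs φ.encode i k ∧ TermAt φ.encode i s ∧ TermAt φ.encode k t := by
  obtain ⟨p, j, hs⟩ := exists_isSeg_atom h
  obtain ⟨hp, hs⟩ := hs.tail
  obtain ⟨m, h1, h2⟩ := hs.split (by
    obtain ⟨c, l, h, hc⟩ := t.encode_head
    rw [h]
    exact clean_some hc)
  have := (List.getElem?_eq_some_iff.1 hp).1
  exact ⟨p + 1, m, ⟨p, by omega, rfl, hp, (termSeg_iff.2 ⟨s, h1⟩).1⟩, h1.termAt, h2.termAt⟩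

theorem Conn.exists_eqv (h : Conn φ.encode i k) (ht : TermAt φ.encode i t) :
    ∃ s, TermAt φ.encode k s ∧ Eqv φ.atoms t s := by
  obtain ⟨-, -, h⟩ := h
  induction h with
  | refl => exact ⟨t, ht, .refl⟩
  | tail _ h ih =>
    obtain ⟨r, h1, h2⟩ := ih
    rcases h.2 with h | h | h
    · exact ⟨r, h.termAt h1, h2⟩
    · obtain ⟨s, s', h3, h4, h5⟩ := h.exists_atom
      obtain rfl := h1.eq h4
      exact ⟨s', h5, h2.tail (Or.inl h3)⟩
    · obtain ⟨s', s, h3, h4, h5⟩ := h.exists_atom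
      obtain rfl := h1.eq h5
      exact ⟨s', h4, h2.tail (Or.inr h3)⟩

/-- Every equality used is written somewhere in the word: a link between occurrences of the same
term leads there, and a link between the arguments leads across. -/
theorem Eqv.exists_conn (h : Eqv φ.atoms t s) (ht : TermAt φ.encode i t) :
    ∃ k, Conn φ.encode i k ∧ TermAt φ.encode k s := by
  induction h with
  | refl => exact ⟨i, ⟨ht.lt_length.le, ht.lt_length.le, .refl⟩, ht⟩
  | tail _ h ih =>
    obtain ⟨k, ⟨hi, -, h1⟩, h2⟩ := ih
    rcases h with h | h
    · obtain ⟨m, l, h3, h4, h5⟩ := exists_eqArgs h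
      exact ⟨l, ⟨hi, h5.lt_length.le, (h1.tail ⟨h4.lt_length.le, Or.inl
        (sameTerm_of_termAt h2 h4)⟩).tail ⟨h5.lt_length.le, Or.inr (Or.inl h3)⟩⟩, h5⟩
    · obtain ⟨l, m, h3, h5, h4⟩ := exists_eqArgs h
      exact ⟨l, ⟨hi, h5.lt_length.le, (h1.tail ⟨h4.lt_length.le, Or.inl
        (sameTerm_of_termAt h2 h4)⟩).tail ⟨h5.lt_length.le, Or.inr (Or.inr h3)⟩⟩, h5⟩

theorem conn_iff (ht : TermAt φ.encode i t) (hs : TermAt φ.encode k s) :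
    Conn φ.encode i k ↔ Eqv φ.atoms t s := by
  constructor
  · intro h
    obtain ⟨r, h1, h2⟩ := h.exists_eqv ht
    exact hs.eq h1 ▸ h2
  · intro h
    obtain ⟨l, ⟨h1, h2, h3⟩, h4⟩ := h.exists_conn ht
    exact ⟨h1, hs.lt_length.le, h3.tail ⟨hs.lt_length.le, Or.inl (sameTerm_of_termAt h4 hs)⟩⟩

/-- A constant or a quantified variable need not occur in any atom, but then its class is trivial. A
nontrivial equivalence begins with an equality atom, where the term is written. -/
theorem Eqv.exists_termAt (h : Eqv φ.atoms t s) (hne : t ≠ s) : ∃ i, TermAt φ.encode i t := by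
  rcases ReflTransGen.cases_head h with h | ⟨r, h | h, -⟩
  · exact absurd h hne
  · obtain ⟨i, -, -, h, -⟩ := exists_eqArgs h
    exact ⟨i, h⟩
  · obtain ⟨-, i, -, -, h⟩ := exists_eqArgs h
    exact ⟨i, h⟩

/-- Distinct equivalent terms occur at connected positions. -/
theorem Eqv.exists_positions (h : Eqv φ.atoms t s) (hne : t ≠ s) :
    ∃ i k, TermAt φ.encode i t ∧ TermAt φ.encode k s ∧ Conn φ.encode i k := by
  obtain ⟨i, hi⟩ := h.exists_termAt hne
  obtain ⟨k, hk, hs⟩ := h.exists_conn hi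
  exact ⟨i, k, hi, hs, hk⟩

/-! ### Quantified variables -/

/-- The quantifier `q` of the variable `x` is written at position `p`. -/
def QuantAt (w : List (Token B)) (q : Quant) (p : ℕ) (x : Var) : Prop :=
  w[p]? = some q.token ∧ runAt Token.isBit w (p + 1) = x.map Token.bit

theorem quantAt_iff {q : Quant} {x : Var} : QuantAt φ.encode q p x ↔
    ∃ P R, φ.quants = P ++ (q, x) :: R ∧ p = (P.flatMap (encodeQuant (B := B))).length := by
  constructor
  · rintro ⟨h1, h2⟩
    obtain ⟨P, y, R, hP, rfl⟩ := exists_quants_split h1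
    obtain ⟨j, hj⟩ := isSeg_quant hP
    rw [encodeQuant_eq] at hj
    obtain rfl := map_bit_injective (h2.symm.trans (isSeg_block.1 hj).2.2)
    exact ⟨P, R, hP, rfl⟩
  · rintro ⟨P, R, hP, rfl⟩
    obtain ⟨j, hj⟩ := isSeg_quant hP
    rw [encodeQuant_eq] at hj
    exact (isSeg_block.1 hj).2

theorem mem_quants_iff {q : Quant} {x : Var} :
    (q, x) ∈ φ.quants ↔ ∃ p, QuantAt φ.encode q p x := by
  simp only [quantAt_iff]
  constructor
  · intro h
    obtain ⟨P, R, h⟩ := List.append_of_mem h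
    exact ⟨_, P, R, h, rfl⟩
  · rintro ⟨_, P, R, h, -⟩
    simp [h]

theorem exists_quantAt (h : w[p]? ∈ quantTokens) : ∃ q x, QuantAt w q p x := by
  obtain ⟨x, hx⟩ := exists_runAt_eq w (p + 1)
  rcases h with h | h
  · exact ⟨.all, x, h, hx⟩
  · exact ⟨.ex, x, h, hx⟩

theorem QuantAt.mem {q : Quant} {x : Var} (h : QuantAt w q p x) : w[p]? ∈ quantTokens := by
  cases q
  · exact Or.inl h.1
  · exact Or.inr h.1

theorem QuantAt.lt_length {q : Quant} {x : Var} (h : QuantAt w q p x) : p < w.length :=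
  (List.getElem?_eq_some_iff.1 h.1).1

theorem QuantAt.sameTail_iff {q : Quant} {x y : Var} (h : QuantAt w q p x)
    (hi : TermAt w i (.var y)) : SameTail Token.isBit w p i ↔ x = y := by
  constructor
  · rintro ⟨-, -, he⟩
    rw [h.2, hi.2] at he
    exact map_bit_injective he
  · rintro rfl
    exact ⟨h.lt_length, hi.lt_length, h.2.trans hi.2.symm⟩

theorem QuantAt.split_of_lt {q q' : Quant} {x x' : Var} {p' : ℕ} (h : QuantAt φ.encode q p x)
    (h' : QuantAt φ.encode q' p' x') (hlt : p < p') :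
    ∃ P Q R, φ.quants = (P ++ (q, x) :: Q) ++ (q', x') :: R := by
  obtain ⟨P, R, h1, rfl⟩ := quantAt_iff.1 h
  obtain ⟨P', R', h2, rfl⟩ := quantAt_iff.1 h'
  have h3 := h1.symm.trans h2
  rcases List.append_eq_append_iff.1 h3 with ⟨S, rfl, h4⟩ | ⟨S, rfl, h4⟩
  · cases S with
    | nil => simp at hlt
    | cons a S =>
      obtain ⟨rfl, -⟩ := List.cons.inj h4
      exact ⟨P, S, R', h2⟩
  · rw [List.flatMap_append, List.length_append] at hlt
    omega

theorem exists_quantAt_lt {q q' : Quant} {x x' : Var} {P Q R : List (Quant × Var)}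
    (h : φ.quants = (P ++ (q, x) :: Q) ++ (q', x') :: R) :
    ∃ p p', p < p' ∧ QuantAt φ.encode q p x ∧ QuantAt φ.encode q' p' x' := by
  refine ⟨_, _, ?_, quantAt_iff.2 ⟨P, Q ++ (q', x') :: R, by simp [h], rfl⟩,
    quantAt_iff.2 ⟨_, R, h, rfl⟩⟩
  rw [List.flatMap_append, List.flatMap_cons, encodeQuant_eq]
  simp only [List.length_append, List.length_cons]
  omega

/-- The variable written at position `k` is quantified. -/
def BoundAt (w : List (Token B)) (k : ℕ) : Prop :=
  ∃ p ≤ w.length + 1, w[p]? ∈ quantTokens ∧ SameTail Token.isBit w p k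

/-- A universally quantified variable is written at position `k`. -/
def UnivAt (w : List (Token B)) (k : ℕ) : Prop :=
  w[k]? = some .var ∧ ∃ p ≤ w.length + 1, w[p]? = some .all ∧ SameTail Token.isBit w p k

theorem boundAt_iff {x : Var} (h : TermAt φ.encode k (.var x)) :
    BoundAt φ.encode k ↔ x ∈ φ.quants.map Prod.snd := by
  constructor
  · rintro ⟨p, -, hp, hs⟩
    obtain ⟨q, y, hy⟩ := exists_quantAt hp
    obtain rfl := (hy.sameTail_iff h).1 hs
    exact List.mem_map_of_mem (f := Prod.snd) (mem_quants_iff.2 ⟨p, hy⟩)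
  · intro hx
    obtain ⟨⟨q, y⟩, hq, rfl⟩ := List.mem_map.1 hx
    obtain ⟨p, hp⟩ := mem_quants_iff.1 hq
    exact ⟨p, by have := hp.lt_length; omega, hp.mem, (hp.sameTail_iff h).2 rfl⟩

theorem UnivAt.exists_var (h : UnivAt φ.encode k) :
    ∃ y, TermAt φ.encode k (.var y) ∧ (Quant.all, y) ∈ φ.quants := by
  obtain ⟨hk, p, -, hp, hs⟩ := h
  obtain ⟨y, hy⟩ := exists_termAt_var hk
  exact ⟨y, hy, mem_quants_iff.2 ⟨p, hp, hs.2.2.trans hy.2⟩⟩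

theorem univAt_of_mem {y : Var} (h : TermAt φ.encode k (.var y))
    (hy : (Quant.all, y) ∈ φ.quants) : UnivAt φ.encode k := by
  obtain ⟨p, hp⟩ := mem_quants_iff.1 hy
  exact ⟨h.1, p, by have := hp.lt_length; omega, hp.1, (hp.sameTail_iff h).2 rfl⟩

/-! ### Sentences -/

/-- The `m`-th argument of the atom at position `i` is written at position `k`. -/
def ArgAt (w : List (Token B)) (m i k : ℕ) : Prop :=
  ∃ p ≤ w.length + 1, i + 1 = p ∧ TermChain w m p k

theorem ArgAt.eq {m : ℕ} (h : ArgAt w m i j) (h' : ArgAt w m i k) : j = k := by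
  obtain ⟨_, -, rfl, h⟩ := h
  obtain ⟨_, -, rfl, h'⟩ := h'
  exact TermChain.eq h h'

theorem exists_argAt {r : B.Rel} {ts : Fin (B.arity r) → Term B}
    (h : IsSeg w i j (Atom.rel r ts).encode) (m : Fin (B.arity r)) :
    ∃ k, ArgAt w m i k ∧ TermAt w k (ts m) := by
  obtain ⟨h1, h2⟩ := h.tail
  have := (List.getElem?_eq_some_iff.1 h1).1
  obtain ⟨k, -, h3, h4⟩ := exists_termChain this h2 m
  exact ⟨k, ⟨i + 1, by omega, rfl, h3⟩, h4⟩

theorem exists_rel_isSeg {r : B.Rel} (h : φ.encode[p]? = some (.rel r)) :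
    ∃ ts, Atom.rel r ts ∈ φ.atoms ∧ ∃ j, IsSeg φ.encode p j (Atom.rel r ts).encode := by
  obtain ⟨a, ha, j, hs, h0⟩ := exists_atom_isSeg h (Or.inr ⟨r, rfl⟩)
  cases a with
  | eq s t => cases h0
  | rel r' ts =>
    cases h0
    exact ⟨ts, ha, j, hs⟩

/-- No variable is quantified twice. -/
def DistinctQuants (w : List (Token B)) : Prop :=
  ∀ p ≤ w.length + 1, ∀ p' ≤ w.length + 1, p < p' → w[p]? ∈ quantTokens →
    w[p']? ∈ quantTokens → ¬ SameTail Token.isBit w p p'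

theorem nodup_snd_of_split {X Y : Type*} : ∀ {l : List (X × Y)},
    (∀ P a y Q b R, l ≠ (P ++ (a, y) :: Q) ++ (b, y) :: R) → (l.map Prod.snd).Nodup
  | [], _ => List.nodup_nil
  | (a, y) :: l, h => by
    rw [List.map_cons, List.nodup_cons]
    refine ⟨fun hy => ?_, nodup_snd_of_split fun P c z Q d R he =>
      h ((a, y) :: P) c z Q d R (by rw [he]; rfl)⟩
    obtain ⟨⟨b, y'⟩, hb, rfl⟩ := List.mem_map.1 hy
    obtain ⟨Q, R, rfl⟩ := List.append_of_mem hb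
    exact h [] a y' Q b R rfl

theorem distinctQuants_iff : DistinctQuants φ.encode ↔ (φ.quants.map Prod.snd).Nodup := by
  constructor
  · intro h
    refine nodup_snd_of_split fun P a y Q b R he => ?_
    obtain ⟨p, p', hlt, h1, h2⟩ := exists_quantAt_lt he
    have := h1.lt_length
    have := h2.lt_length
    exact h p (by omega) p' (by omega) hlt h1.mem h2.mem
      ⟨h1.lt_length, h2.lt_length, h1.2.trans h2.2.symm⟩
  · intro h p _ p' _ hlt hp hp' hs
    obtain ⟨q, x, h1⟩ := exists_quantAt hp
    obtain ⟨q', x', h2⟩ := exists_quantAt hp'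
    have he := hs.2.2
    rw [h1.2, h2.2] at he
    obtain rfl := map_bit_injective he
    obtain ⟨P, Q, R, he⟩ := h1.split_of_lt h2 hlt
    rw [he] at h
    simp [List.nodup_append] at h

/-- Every variable of an atom is quantified. -/
def VarsBound (w : List (Token B)) : Prop :=
  (∀ i ≤ w.length + 1, ∀ k ≤ w.length + 1, EqArgs w i k →
    (w[i]? = some .var → BoundAt w i) ∧ (w[k]? = some .var → BoundAt w k)) ∧
  ∀ i ≤ w.length + 1, ∀ k ≤ w.length + 1, ∀ r : B.Rel, w[i]? = some (.rel r) →
    ∀ m : Fin (B.arity r), ArgAt w m i k → w[k]? = some .var → BoundAt w k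

theorem varsBound_iff : VarsBound φ.encode ↔
    ∀ a ∈ φ.atoms, ∀ x ∈ a.vars, x ∈ φ.quants.map Prod.snd := by
  constructor
  · rintro ⟨h1, h2⟩ (⟨s, t⟩ | ⟨r, ts⟩) ha x hx
    · obtain ⟨i, k, he, hs, ht⟩ := exists_eqArgs ha
      have h := h1 i (by have := hs.lt_length; omega) k (by have := ht.lt_length; omega) he
      rcases hx with hx | hx
      · cases s with
        | const a => cases hx
        | var y =>
          obtain rfl : x = y := hx
          exact (boundAt_iff hs).1 (h.1 hs.1)
      · cases t with
        | const a => cases hx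
        | var y =>
          obtain rfl : x = y := hx
          exact (boundAt_iff ht).1 (h.2 ht.1)
    · obtain ⟨m, hx⟩ := Set.mem_iUnion.1 hx
      obtain ⟨i, j, hs⟩ := exists_isSeg_atom ha
      obtain ⟨k, hk, ht⟩ := exists_argAt hs m
      have hi := hs.tail.1
      have := (List.getElem?_eq_some_iff.1 hi).1
      have := ht.lt_length
      have h := h2 i (by omega) k (by omega) r hi m hk
      generalize hm : ts m = t at hx ht
      cases t with
      | const a => cases hx
      | var y =>
        obtain rfl : x = y := hx
        exact (boundAt_iff ht).1 (h ht.1)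
  · intro h
    refine ⟨fun i _ k _ he => ?_, fun i _ k _ r hr m hk hv => ?_⟩
    · obtain ⟨s, t, ha, hs, ht⟩ := he.exists_atom
      refine ⟨fun hv => ?_, fun hv => ?_⟩
      · obtain ⟨x, hx⟩ := exists_termAt_var hv
        obtain rfl := hs.eq hx
        exact (boundAt_iff hx).2 (h _ ha x (Or.inl rfl))
      · obtain ⟨x, hx⟩ := exists_termAt_var hv
        obtain rfl := ht.eq hx
        exact (boundAt_iff hx).2 (h _ ha x (Or.inr rfl))
    · obtain ⟨ts, ha, j, hs⟩ := exists_rel_isSeg hr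
      obtain ⟨k', hk', ht⟩ := exists_argAt hs m
      obtain rfl := hk.eq hk'
      obtain ⟨x, hx⟩ := exists_termAt_var hv
      have hm := ht.eq hx
      exact (boundAt_iff hx).2 (h _ ha x (Set.mem_iUnion.2 ⟨m, by rw [hm]; rfl⟩))

end Connected

/-! ### Refutations and consistency in terms of positions -/

section Criterion

variable {A : Type u} {α β : Set A} {K : Set ℕ} {C : Set A}
  {w : List (Token (TauReduct α β K C))} {φ : PHFormula (TauReduct α β K C)} {i j k : ℕ}

/-- The term at position `k` is equivalent to a universal variable or to a constant outside `S`. -/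
def AvoidableAt (w : List (Token (TauReduct α β K C))) (S : Set A) (k : ℕ) : Prop :=
  ∃ l ≤ w.length + 1, Conn w k l ∧
    ((∃ a : (TauReduct α β K C).consts, a.1 ∉ S ∧ w[l]? = some (.const a)) ∨ UnivAt w l)

theorem avoidableAt_iff {S : Set A} {t : Term (TauReduct α β K C)} (ht : TermAt φ.encode k t) :
    AvoidableAt φ.encode S k ↔ Avoidable φ S t := by
  constructor
  · rintro ⟨l, -, hc, ⟨a, ha, hl⟩ | hu⟩
    · exact Or.inl ⟨a, ha, (conn_iff ht (s := .const a) hl).1 hc⟩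
    · obtain ⟨y, hy, hq⟩ := hu.exists_var
      exact Or.inr ⟨y, hq, (conn_iff ht hy).1 hc⟩
  · rintro (⟨a, ha, he⟩ | ⟨y, hy, he⟩)
    · obtain ⟨l, hc, hl⟩ := he.exists_conn ht
      exact ⟨l, by have := hl.lt_length; omega, hc, Or.inl ⟨a, ha, hl⟩⟩
    · obtain ⟨l, hc, hl⟩ := he.exists_conn ht
      exact ⟨l, by have := hl.lt_length; omega, hc, Or.inr (univAt_of_mem hl hy)⟩

/-- The universal player can falsify the atom `τ_k` at position `i`. -/
def RefutableAt (w : List (Token (TauReduct α β K C))) (k i : ℕ) : Prop :=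
  ∃ J : Fin k → Fin 3 × Fin 3,
    (∀ m, (∃ p ≤ w.length + 1, ArgAt w (tripleIndex m (J m).1) i p ∧ AvoidableAt w α p) ∧
      ∃ p ≤ w.length + 1, ArgAt w (tripleIndex m (J m).2) i p ∧ AvoidableAt w β p) ∧
    ∀ m m', ∃ p ≤ w.length + 1, ArgAt w (tripleIndex m (J m).1) i p ∧
      ∃ p' ≤ w.length + 1, ArgAt w (tripleIndex m' (J m').2) i p' ∧ ¬ Conn w p p'

/-- Each argument of the atom is written at a position determined by counting terms (`ArgAt.eq`), so
the same selections `J` work on both sides. -/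
theorem refutableAt_iff {r : K} {ts : Fin (3 * r.1) → Term (TauReduct α β K C)}
    (h : IsSeg φ.encode i j (Atom.rel (B := TauReduct α β K C) r ts).encode) :
    RefutableAt φ.encode r.1 i ↔ Refutable φ ts := by
  have harg : ∀ m : Fin (3 * r.1), ∃ k, ArgAt φ.encode m i k ∧ TermAt φ.encode k (ts m) :=
    exists_argAt h
  have hav : ∀ (S : Set A) (m : Fin (3 * r.1)), (∃ p ≤ φ.encode.length + 1,
      ArgAt φ.encode m i p ∧ AvoidableAt φ.encode S p) ↔ Avoidable φ S (ts m) := by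
    intro S m
    obtain ⟨k, hk, ht⟩ := harg m
    rw [← avoidableAt_iff ht]
    constructor
    · rintro ⟨p, -, hp, hA⟩
      exact hk.eq hp ▸ hA
    · exact fun hA => ⟨k, by have := ht.lt_length; omega, hk, hA⟩
  have hcn : ∀ m m' : Fin (3 * r.1), (∃ p ≤ φ.encode.length + 1, ArgAt φ.encode m i p ∧
      ∃ p' ≤ φ.encode.length + 1, ArgAt φ.encode m' i p' ∧ ¬ Conn φ.encode p p') ↔
      ¬ Eqv φ.atoms (ts m) (ts m') := by
    intro m m'
    obtain ⟨k, hk, ht⟩ := harg m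
    obtain ⟨k', hk', ht'⟩ := harg m'
    rw [← conn_iff ht ht']
    constructor
    · rintro ⟨p, -, hp, p', -, hp', hc⟩
      rwa [hk.eq hp, hk'.eq hp']
    · exact fun hc => ⟨k, by have := ht.lt_length; omega, hk, k',
        by have := ht'.lt_length; omega, hk', hc⟩
  unfold RefutableAt Refutable
  simp only [hav, hcn]

/-- The criterion for truth, in terms of positions. -/
def ConsistentAt (w : List (Token (TauReduct α β K C))) : Prop :=
  (∀ i ≤ w.length + 1, ∀ k ≤ w.length + 1, ∀ a, w[i]? = some (.const a) → UnivAt w k →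
    ¬ Conn w i k) ∧
  (∀ p ≤ w.length + 1, ∀ p' ≤ w.length + 1, ∀ i ≤ w.length + 1, ∀ k ≤ w.length + 1, p < p' →
    w[p]? ∈ quantTokens → w[p']? = some .all → w[i]? = some .var → w[k]? = some .var →
    SameTail Token.isBit w p i → SameTail Token.isBit w p' k → ¬ Conn w i k) ∧
  (∀ i ≤ w.length + 1, ∀ k ≤ w.length + 1, ∀ a b, w[i]? = some (.const a) →
    w[k]? = some (.const b) → Conn w i k → a = b) ∧
  ∀ i ≤ w.length + 1, ∀ r : K, w[i]? = some (.rel r) → ¬ RefutableAt w r.1 i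

/-- The first three conditions forbid equivalences of distinct terms, and these are witnessed at
positions by `Eqv.exists_positions`. The absence of repeated quantifiers ensures that a variable and
a later universal one are indeed distinct. -/
theorem consistentAt_iff (hs : (φ.quants.map Prod.snd).Nodup) :
    ConsistentAt φ.encode ↔ Consistent φ := by
  constructor
  · rintro ⟨h1, h2, h3, h4⟩
    refine ⟨fun a y hy he => ?_, fun P y R hP x hx he => ?_, fun a b he => ?_, fun r ts ha hr => ?_⟩
    · obtain ⟨i, k, hi, hk, hc⟩ := he.exists_positions (by simp)
      have := hi.lt_length
      have := hk.lt_length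
      exact h1 i (by omega) k (by omega) a hi (univAt_of_mem hk hy) hc
    · obtain ⟨⟨q, x'⟩, hq, rfl⟩ := List.mem_map.1 hx
      obtain ⟨P, Q, rfl⟩ := List.append_of_mem hq
      obtain ⟨p, p', hlt, hp, hp'⟩ := exists_quantAt_lt hP
      have hne : x' ≠ y := by
        rintro rfl
        rw [hP] at hs
        simp [List.nodup_append] at hs
      obtain ⟨i, k, hi, hk, hc⟩ := he.exists_positions (by simpa using hne)
      have := hi.lt_length
      have := hk.lt_length
      have := hp.lt_length
      have := hp'.lt_length
      exact h2 p (by omega) p' (by omega) i (by omega) k (by omega) hlt hp.mem hp'.1 hi.1 hk.1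
        ((hp.sameTail_iff hi).2 rfl) ((hp'.sameTail_iff hk).2 rfl) hc
    · by_contra hne
      obtain ⟨i, k, hi, hk, hc⟩ := he.exists_positions (by simpa using hne)
      have := hi.lt_length
      have := hk.lt_length
      exact hne (h3 i (by omega) k (by omega) a b hi hk hc)
    · obtain ⟨i, j, hseg⟩ := exists_isSeg_atom ha
      have hi := hseg.tail.1
      have := (List.getElem?_eq_some_iff.1 hi).1
      exact h4 i (by omega) r hi ((refutableAt_iff hseg).2 hr)
  · rintro ⟨h1, h2, h3, h4⟩
    refine ⟨fun i _ k _ a hi hk hc => ?_, fun p _ p' _ i _ k _ hlt hp hp' hi hk hpi hpk hc => ?_,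
      fun i _ k _ a b hi hk hc => ?_, fun i _ r hi hr => ?_⟩
    · obtain ⟨y, hy, hq⟩ := hk.exists_var
      exact h1 a y hq ((conn_iff (t := .const a) hi hy).1 hc)
    · obtain ⟨x, hx⟩ := exists_termAt_var hi
      obtain ⟨y, hy⟩ := exists_termAt_var hk
      obtain ⟨q, x', hq⟩ := exists_quantAt hp
      obtain rfl := (hq.sameTail_iff hx).1 hpi
      have hq' : QuantAt φ.encode .all p' y := ⟨hp', hpk.2.2.trans hy.2⟩
      obtain ⟨P, Q, R, hP⟩ := hq.split_of_lt hq' hlt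
      exact h2 _ y R hP x' (by simp) ((conn_iff hx hy).1 hc)
    · exact h3 a b ((conn_iff (t := .const a) (s := .const b) hi hk).1 hc)
    · obtain ⟨ts, ha, j, hseg⟩ := exists_rel_isSeg hi
      exact h4 r ts ha ((refutableAt_iff hseg).1 hr)

theorem mem_QCSP_iff (hα : α ≠ Set.univ) (hβ : β ≠ Set.univ)
    (hcover : α ∪ β = Set.univ) (hmeet : (α ∩ β).Nonempty) :
    w ∈ QCSP (TauReduct α β K C) ↔
      IsEncoding w ∧ DistinctQuants w ∧ VarsBound w ∧ ConsistentAt w := by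
  rw [isEncoding_iff]
  constructor
  · rintro ⟨φ, hs, ht, rfl⟩
    exact ⟨⟨φ, rfl⟩, distinctQuants_iff.2 hs.1, varsBound_iff.2 hs.2, (consistentAt_iff hs.1).2
      ((isTrue_iff_consistent hα hβ hcover hmeet hs).1 ht)⟩
  · rintro ⟨⟨φ, rfl⟩, h1, h2, h3⟩
    have hs : φ.IsSentence := ⟨distinctQuants_iff.1 h1, varsBound_iff.1 h2⟩
    exact ⟨φ, hs, (isTrue_iff_consistent hα hβ hcover hmeet hs).2
      ((consistentAt_iff hs.1).1 h3), rfl⟩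

end Criterion

end ConstraintLanguage

open PosTuple Relation

/-! ### Definability of the criterion -/

namespace ConstraintLanguage

section Definable

variable {A : Type u} {B : ConstraintLanguage.{u, v} A} {T : Type} [PosTuple T] {f g : T → ℕ}

instance [Finite A] [Finite B.Rel] : Finite (Token B) := by
  have : Finite B.consts := Subtype.finite
  refine Finite.of_surjective (α := Fin 4 ⊕ B.Rel ⊕ B.consts ⊕ Bool)
    (Sum.elim ![.all, .ex, .eq, .var] (Sum.elim .rel (Sum.elim .const .bit))) fun c => ?_
  cases c with
  | all => exact ⟨.inl 0, rfl⟩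
  | ex => exact ⟨.inl 1, rfl⟩
  | eq => exact ⟨.inl 2, rfl⟩
  | var => exact ⟨.inl 3, rfl⟩
  | rel r => exact ⟨.inr (.inl r), rfl⟩
  | const a => exact ⟨.inr (.inr (.inl a)), rfl⟩
  | bit b => exact ⟨.inr (.inr (.inr b)), rfl⟩

theorem biDef_token (c : Token B) (hf : IsPos f) :
    BiDef fun (w : List (Token B)) t => w[f t]? = some c :=
  BiDef.symbol {some c} hf

theorem biDef_eqArgs (hf : IsPos f) (hg : IsPos g) :
    BiDef fun (w : List (Token B)) t => EqArgs w (f t) (g t) :=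
  BiDef.ex (R := fun w t p => p + 1 = f t ∧ w[p]? = some .eq ∧
      BlockEnd Token.isBit w (f t) (g t))
    ((BiDef.succ (by fun_prop) (by fun_prop)).and ((biDef_token _ (by fun_prop)).and
      (BiDef.blockEnd _ (by fun_prop) (by fun_prop))))

variable [Finite A]

instance : Finite B.consts := Subtype.finite

theorem biDef_termSeg (hf : IsPos f) (hg : IsPos g) :
    BiDef fun (w : List (Token B)) t => TermSeg w (f t) (g t) :=
  (BiDef.blockEnd _ hf hg).and ((biDef_token _ hf).or ((BiDef.succ hf hg).and
    (BiDef.exists_finite fun _ => biDef_token _ hf)))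

/-- The recursion costs one quantifier per term, which is harmless because `n` does not depend on
the input: it is bounded by an arity. The tuple type varies since each quantifier adds a coordinate.
-/
theorem biDef_termChain : ∀ (n : ℕ) {T : Type} [PosTuple T] {f g : T → ℕ}, IsPos f → IsPos g →
    BiDef fun (w : List (Token B)) t => TermChain w n (f t) (g t)
  | 0, _, _, _, _, hf, hg =>
    (BiDef.eq hf hg).and ((BiDef.leLength hg).and (BiDef.symbol _ hg).not)
  | n + 1, _, _, f, g, hf, hg =>
    BiDef.ex (R := fun w t k => TermChain w n (f t) k ∧ TermSeg w k (g t))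
      ((biDef_termChain n (by fun_prop) (by fun_prop)).and
        (biDef_termSeg (by fun_prop) (by fun_prop)))

theorem biDef_argAt (m : ℕ) (hf : IsPos f) (hg : IsPos g) :
    BiDef fun (w : List (Token B)) t => ArgAt w m (f t) (g t) :=
  BiDef.ex (R := fun w t p => f t + 1 = p ∧ TermChain w m p (g t))
    ((BiDef.succ (by fun_prop) (by fun_prop)).and
      (biDef_termChain m (by fun_prop) (by fun_prop)))

variable [Finite B.Rel]

theorem biDef_sameTerm (hf : IsPos f) (hg : IsPos g) :
    BiDef fun (w : List (Token B)) t => SameTerm w (f t) (g t) :=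
  ((biDef_token _ hf).and ((biDef_token _ hg).and (BiDef.sameTail _ hf hg))).or
    (BiDef.exists_finite fun _ => (biDef_token _ hf).and (biDef_token _ hg))

/-- Here inductive counting enters. Nonequivalence of terms is required by refutations as well as by
the conditions on constants and universal variables. -/
theorem biDef_conn (hf : IsPos f) (hg : IsPos g) :
    BiDef fun (w : List (Token B)) t => Conn w (f t) (g t) :=
  (BiDef.reach (T := T) (R := fun (w : List (Token B)) _ => Link w)
    ((biDef_sameTerm (by fun_prop) (by fun_prop)).or ((biDef_eqArgs (by fun_prop)
      (by fun_prop)).or (biDef_eqArgs (by fun_prop) (by fun_prop))))).comp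
    (f := fun t => (t, f t, g t)) (by fun_prop)

theorem biDef_boundAt (hf : IsPos f) : BiDef fun (w : List (Token B)) t => BoundAt w (f t) :=
  BiDef.ex (R := fun w t p => w[p]? ∈ quantTokens ∧ SameTail Token.isBit w p (f t))
    ((BiDef.symbol _ (by fun_prop)).and (BiDef.sameTail _ (by fun_prop) (by fun_prop)))

theorem biDef_univAt (hf : IsPos f) : BiDef fun (w : List (Token B)) t => UnivAt w (f t) :=
  (biDef_token _ hf).and
    (BiDef.ex (R := fun w t p => w[p]? = some .all ∧ SameTail Token.isBit w p (f t))
      ((biDef_token _ (by fun_prop)).and (BiDef.sameTail _ (by fun_prop) (by fun_prop))))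

theorem biDef_atomSeg (hf : IsPos f) (hg : IsPos g) :
    BiDef fun (w : List (Token B)) t => AtomSeg w (f t) (g t) :=
  BiDef.ex (R := fun (w : List (Token B)) t k => f t + 1 = k ∧ ((w[f t]? = some .eq ∧ TermChain w 2 k (g t)) ∨
      ∃ r, w[f t]? = some (.rel r) ∧ TermChain w (B.arity r) k (g t)))
    ((BiDef.succ (by fun_prop) (by fun_prop)).and (((biDef_token _ (by fun_prop)).and
      (biDef_termChain 2 (by fun_prop) (by fun_prop))).or (BiDef.exists_finite fun _ =>
        (biDef_token _ (by fun_prop)).and (biDef_termChain _ (by fun_prop) (by fun_prop)))))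

/-- Well-formedness is never negated, so ordinary reachability suffices. -/
theorem def_isEncoding : Def fun (w : List (Token B)) (_ : Unit) => IsEncoding w := by
  refine Def.ex (R := fun w _ a => a = 0 ∧ ∃ m ≤ w.length + 1,
    ReflTransGen (fun i j => TupleOnTape w j ∧ QuantSeg w i j) a m ∧
      ∃ e ≤ w.length + 1, (e ≤ w.length ∧ ¬ e < w.length) ∧
        ReflTransGen (fun i j => TupleOnTape w j ∧ AtomSeg w i j) m e)
    ((BiDef.isZero (by fun_prop)).1.and (Def.ex (Def.and ?_ (Def.ex (Def.and
      ((BiDef.leLength (by fun_prop)).and (BiDef.ltLength (by fun_prop)).not).1 ?_)))))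
  · exact Def.reach (R := fun w _ => QuantSeg w)
      ((BiDef.blockEnd _ (by fun_prop) (by fun_prop)).and (BiDef.symbol _ (by fun_prop))).1
      (by fun_prop) (by fun_prop)
  · exact Def.reach (R := fun w _ => AtomSeg w) (biDef_atomSeg (by fun_prop) (by fun_prop)).1
      (by fun_prop) (by fun_prop)

theorem biDef_distinctQuants :
    BiDef fun (w : List (Token B)) (_ : Unit) => DistinctQuants w :=
  BiDef.all (BiDef.all ((BiDef.lt (by fun_prop) (by fun_prop)).imp
    ((BiDef.symbol _ (by fun_prop)).imp ((BiDef.symbol _ (by fun_prop)).imp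
      (BiDef.sameTail _ (by fun_prop) (by fun_prop)).not))))

theorem biDef_varsBound : BiDef fun (w : List (Token B)) (_ : Unit) => VarsBound w :=
  (BiDef.all (BiDef.all ((biDef_eqArgs (by fun_prop) (by fun_prop)).imp
    (((biDef_token _ (by fun_prop)).imp (biDef_boundAt (by fun_prop))).and
      ((biDef_token _ (by fun_prop)).imp (biDef_boundAt (by fun_prop))))))).and
  (BiDef.all (BiDef.all (BiDef.forall_finite fun r => (biDef_token _ (by fun_prop)).imp
    (BiDef.forall_finite fun m => (biDef_argAt _ (by fun_prop) (by fun_prop)).imp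
      ((biDef_token _ (by fun_prop)).imp (biDef_boundAt (by fun_prop)))))))

end Definable

section Tau

variable {A : Type u} {α β : Set A} {K : Set ℕ} {C : Set A} [Finite A] [Finite K]
  {T : Type} [PosTuple T] {f : T → ℕ}

instance : Finite (TauReduct α β K C).Rel := ‹Finite K›

theorem biDef_avoidableAt (S : Set A) (hf : IsPos f) :
    BiDef fun (w : List (Token (TauReduct α β K C))) t => AvoidableAt w S (f t) :=
  BiDef.ex (R := fun w t l => Conn w (f t) l ∧
    ((∃ a : (TauReduct α β K C).consts, a.1 ∉ S ∧ w[l]? = some (.const a)) ∨ UnivAt w l))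
    ((biDef_conn (by fun_prop) (by fun_prop)).and ((BiDef.exists_finite fun _ =>
      (BiDef.const _).and (biDef_token _ (by fun_prop))).or (biDef_univAt (by fun_prop))))

/-- For a fixed `k` there are finitely many selections `J`, so the choice becomes a finite
disjunction. -/
theorem biDef_refutableAt (k : ℕ) (hf : IsPos f) :
    BiDef fun (w : List (Token (TauReduct α β K C))) t => RefutableAt w k (f t) := by
  have h1 : ∀ (S : Set A) (m : ℕ), BiDef fun (w : List (Token (TauReduct α β K C))) t =>
      ∃ p ≤ w.length + 1, ArgAt w m (f t) p ∧ AvoidableAt w S p := fun S m =>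
    BiDef.ex (R := fun w t p => ArgAt w m (f t) p ∧ AvoidableAt w S p)
      ((biDef_argAt m (by fun_prop) (by fun_prop)).and (biDef_avoidableAt S (by fun_prop)))
  have h2 : ∀ m m' : ℕ, BiDef fun (w : List (Token (TauReduct α β K C))) t =>
      ∃ p ≤ w.length + 1, ArgAt w m (f t) p ∧ ∃ p' ≤ w.length + 1, ArgAt w m' (f t) p' ∧
        ¬ Conn w p p' := fun m m' =>
    BiDef.ex (R := fun w t p => ArgAt w m (f t) p ∧ ∃ p' ≤ w.length + 1, ArgAt w m' (f t) p' ∧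
        ¬ Conn w p p')
      ((biDef_argAt m (by fun_prop) (by fun_prop)).and
        (BiDef.ex (R := fun w (x : T × ℕ) p' => ArgAt w m' (f x.1) p' ∧ ¬ Conn w x.2 p')
          ((biDef_argAt m' (by fun_prop) (by fun_prop)).and
            (biDef_conn (by fun_prop) (by fun_prop)).not)))
  exact BiDef.exists_finite fun J => (BiDef.forall_finite fun m => (h1 α _).and (h1 β _)).and
    (BiDef.forall_finite fun m => BiDef.forall_finite fun m' => h2 _ _)

theorem biDef_consistentAt :
    BiDef fun (w : List (Token (TauReduct α β K C))) (_ : Unit) => ConsistentAt w := by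
  refine BiDef.and ?_ (BiDef.and ?_ (BiDef.and ?_ ?_))
  · exact BiDef.all (BiDef.all (BiDef.forall_finite fun a => (biDef_token _ (by fun_prop)).imp
      ((biDef_univAt (by fun_prop)).imp (biDef_conn (by fun_prop) (by fun_prop)).not)))
  · exact BiDef.all (BiDef.all (BiDef.all (BiDef.all ((BiDef.lt (by fun_prop) (by fun_prop)).imp
      ((BiDef.symbol _ (by fun_prop)).imp ((biDef_token _ (by fun_prop)).imp
        ((biDef_token _ (by fun_prop)).imp ((biDef_token _ (by fun_prop)).imp
          ((BiDef.sameTail _ (by fun_prop) (by fun_prop)).imp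
            ((BiDef.sameTail _ (by fun_prop) (by fun_prop)).imp
              (biDef_conn (by fun_prop) (by fun_prop)).not))))))))))
  · exact BiDef.all (BiDef.all (BiDef.forall_finite fun a => BiDef.forall_finite fun b =>
      (biDef_token _ (by fun_prop)).imp ((biDef_token _ (by fun_prop)).imp
        ((biDef_conn (by fun_prop) (by fun_prop)).imp (BiDef.const _)))))
  · exact BiDef.all (BiDef.forall_finite fun r => (biDef_token _ (by fun_prop)).imp
      (biDef_refutableAt _ (by fun_prop)).not)

/-- The quantified constraint satisfaction problem of the relations `τ_k` is in NL. -/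
theorem inNL_QCSP (hα : α ≠ Set.univ) (hβ : β ≠ Set.univ) (hcover : α ∪ β = Set.univ)
    (hmeet : (α ∩ β).Nonempty) : InNL (QCSP (TauReduct α β K C)) :=
  (def_isEncoding.and (biDef_distinctQuants.1.and
    (biDef_varsBound.1.and biDef_consistentAt.1))).inNL _
    fun _ => mem_QCSP_iff hα hβ hcover hmeet

end Tau

end ConstraintLanguage

/-! ### Near-unanimity polymorphisms -/

section NearUnanimity

variable {A : Type u} {n : ℕ}

/-- All arguments with at most one exception are equal to `x`. -/
def NearlyConstant (t : Fin n → A) (x : A) : Prop := ∃ i, ∀ j ≠ i, t j = x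

/-- Among three or more indices one avoids both exceptions. -/
theorem NearlyConstant.eq (hn : 3 ≤ n) {t : Fin n → A} {x y : A} (hx : NearlyConstant t x)
    (hy : NearlyConstant t y) : x = y := by
  obtain ⟨i, hi⟩ := hx
  obtain ⟨j, hj⟩ := hy
  obtain ⟨k, hk⟩ : ∃ k, k ∉ ({i, j} : Finset (Fin n)) := by
    by_contra! h
    have h1 := Finset.card_le_two (a := i) (b := j)
    rw [Finset.eq_univ_of_forall h, Finset.card_univ, Fintype.card_fin] at h1
    omega
  simp only [Finset.mem_insert, Finset.mem_singleton, not_or] at hk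
  exact (hi k hk.1).symm.trans (hj k hk.2)

open Classical in
/-- The operation that returns `x` on arguments nearly all equal to `x`, and `c` otherwise. -/
noncomputable def nearUnanimityOr (c : A) (t : Fin n → A) : A :=
  if h : ∃ x, NearlyConstant t x then h.choose else c

theorem nearUnanimityOr_eq (hn : 3 ≤ n) (c : A) {t : Fin n → A} {x : A}
    (h : NearlyConstant t x) : nearUnanimityOr c t = x := by
  have h' : ∃ x, NearlyConstant t x := ⟨x, h⟩
  exact (dif_pos h').trans (h'.choose_spec.eq hn h)

theorem nearlyConstant_of_ne {c : A} {t : Fin n → A} (h : nearUnanimityOr c t ≠ c) :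
    NearlyConstant t (nearUnanimityOr c t) := by
  by_cases h' : ∃ x, NearlyConstant t x
  · have he : nearUnanimityOr c t = h'.choose := dif_pos h'
    rw [he]
    exact h'.choose_spec
  · exact absurd (dif_neg h') h

theorem isNearUnanimity_nearUnanimityOr (hn : 3 ≤ n) (c : A) :
    IsNearUnanimity (nearUnanimityOr (n := n) c) :=
  ⟨hn, fun i _ _ => nearUnanimityOr_eq hn c ⟨i, fun _ hj => Function.update_of_ne hj _ _⟩⟩

/-- If the result violates `τ_k`, two coordinates per triple have values outside `α` and outside
`β`, hence different from `c`. There the operation returned a nearly unanimous value. At most `2 *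
k` of the `n` tuples are exceptional at one of these coordinates; any other tuple equals the result
there and cannot belong to `τ_k`. -/
theorem nearUnanimityOr_mem_tau {α β : Set A} {c : A} (hcα : c ∈ α) (hcβ : c ∈ β) {k : ℕ}
    (hk : 2 * k < n) {t : Fin n → Fin (3 * k) → A}
    (ht : ∀ j, t j ∈ tau α β k) : (fun p => nearUnanimityOr c fun j => t j p) ∈ tau α β k := by
  by_contra hnot
  rw [ConstraintLanguage.mem_tau] at hnot
  push Not at hnot
  choose J1 h1 using fun i => (hnot i).1
  choose J2 h2 using fun i => (hnot i).2
  have n1 := fun i => nearlyConstant_of_ne fun he => h1 i (he ▸ hcα)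
  have n2 := fun i => nearlyConstant_of_ne fun he => h2 i (he ▸ hcβ)
  choose e1 he1 using n1
  choose e2 he2 using n2
  obtain ⟨j, hj⟩ : ∃ j, j ∉ Finset.univ.image e1 ∪ Finset.univ.image e2 := by
    by_contra! h
    have hc := Finset.card_union_le (Finset.univ.image e1) (Finset.univ.image e2)
    have hc1 := Finset.card_image_le (s := Finset.univ) (f := e1)
    have hc2 := Finset.card_image_le (s := Finset.univ) (f := e2)
    rw [Finset.eq_univ_of_forall h] at hc
    simp only [Finset.card_univ, Fintype.card_fin] at hc hc1 hc2
    omega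
  simp only [Finset.mem_union, Finset.mem_image, Finset.mem_univ, true_and, not_or,
    not_exists] at hj
  obtain ⟨i, hi | hi⟩ := ConstraintLanguage.mem_tau.1 (ht j)
  · exact h1 i (he1 i j (fun h => hj.1 i h.symm) ▸ hi (J1 i))
  · exact h2 i (he2 i j (fun h => hj.2 i h.symm) ▸ hi (J2 i))

end NearUnanimity

theorem mainTheorem11 {A : Type*} [Finite A] (α β : Set A)
    (hα : α ≠ Set.univ) (hβ : β ≠ Set.univ) (hcover : α ∪ β = Set.univ)
    (hmeet : (α ∩ β).Nonempty) (K : Set ℕ) (hK : K.Finite) (C : Set A) :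
    InNL (ConstraintLanguage.QCSP ((tauLanguage α β).reduct K C)) ∧
    ∀ m : ℕ, 1 ≤ m → (∀ k ∈ K, k ≤ m) →
      ∃ f : (Fin (3 * m + 1) → A) → A,
        IsNearUnanimity f ∧ ((tauLanguage α β).reduct K C).IsPolymorphism f := by
  refine ⟨?_, fun m hm hle => ?_⟩
  · have : Finite K := hK
    exact ConstraintLanguage.inNL_QCSP hα hβ hcover hmeet
  · obtain ⟨c, hcα, hcβ⟩ := hmeet
    -- `1 ≤ m` gives the three arguments that near-unanimity needs, and `k ≤ m` gives `2 * k < 3 * m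
    -- + 1`. A constant tuple is nearly constant with any index as the exception, so constants are
    -- preserved.
    refine ⟨nearUnanimityOr c, isNearUnanimity_nearUnanimityOr (by omega) c,
      fun r t ht => nearUnanimityOr_mem_tau hcα hcβ ?_ ht, fun a _ =>
      nearUnanimityOr_eq (by omega) c ⟨0, fun _ _ => rfl⟩⟩
    have := hle r.1 r.2
    omega
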